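/- Let $p>2$ and let $H\ge 1$, $P\ge 0$, $L\ge 0$ be integers. For $\ell>0$ let $\mathcal G=\mathcal G_\ell$ be the regular single-knot metric graph of length $\ell$ consisting of $H$ half-lines, $P$ pendants of length $\ell$ and $L$ loops of length $2\ell$, all attached at one vertex $\mathbf 0$, which is placed at $x=0$ on every edge. Let $H^1(\mathcal G)$ be the space of continuous $u:\mathcal G\to\mathbb R$ that are $H^1$ on every edge. A bound-state is a nonzero $u\in H^1(\mathcal G)$ with $\int_{\mathcal G}u'\eta'+u\eta-|u|^{p-2}u\eta\,dx=0$ for all $\eta\in H^1(\mathcal G)$; an action ground-state is a bound-state that minimizes $$S(u)=\frac12\int_{\mathcal G}|u'|^2+|u|^2\,dx-\frac1p\int_{\mathcal G}|u|^p\,dx$$ among all bound-states. A dummy vertex is put at the midpoint of each loop, so that the compact core consists of $P+2L$ edges $\kappa$, each identified with $[0,\ell]$ with $\mathbf 0$ at $x=0$; $u_e$ is the restriction of $u$ to the edge $e$. A function $u$ is core-symmetric if $u_{\kappa_1}=u_{\kappa_2}$ for all compact edges $\kappa_1,\kappa_2$, and core-increasing if every $u_\kappa$ is strictly increasing on $[0,\ell]$.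 Let $$\varphi(x)=\left(\tfrac p2\right)^{\frac1{p-2}}\operatorname{sech}^{\frac2{p-2}}\left(\tfrac{p-2}2x\right)$$ be the real-line soliton. If $P+L\ge1$, we say that $u$ has incidence index $\theta=\frac{H^+-H^-}{P+2L}$ if for some $y>0$ it equals $\varphi(\cdot+y)$ on exactly $H^+$ of the half-lines and $\varphi(\cdot-y)$ on the remaining $H^-=H-H^+$ half-lines. There is $\ell_0>0$, depending only on $p,H,P,L$, such that for every $0<\ell<\ell_0$ the following hold. If $P+L\ge1$, every positive bound-state has an incidence index, and for all integers $H^+,H^-\ge0$ with $H^++H^-=H$ and $\theta=\frac{H^+-H^-}{P+2L}$: 1. if $H^+>H^-$, there is exactly one positive bound-state with incidence index $\theta$, up to permutations of the half-lines, and it is core-symmetric and core-increasing; 2. if $H^+=H^-$, there is exactly one positive bound-state with incidence index $\theta$, up to permutations of the half-lines, and it is constantly equal to $1$ on the compact core; 3. if $H^+<H^-$, there is no positive bound-state with incidence index $\theta$. Moreover, for all $P,L\ge 0$: (a) every action ground-state is, up to multiplication by $-1$, positive, core-symmetric, and either core-increasing or constantly equal to $1$ on the compact edges; (b) if $H=1$,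 there is an action ground-state, and it is unique up to multiplication by $-1$. -/

import Mathlib

open Set MeasureTheory

/-- A regular single-knot metric graph: `H` half-lines, `P` pendants of length `ℓ` and `L` loops of
length `2ℓ`, all attached at one vertex (the knot). -/
structure RegularKnotGraph where
  H : ℕ
  P : ℕ
  L : ℕ
  ℓ : ℝ

namespace RegularKnotGraph

/-- The edges: half-lines, pendants and loops. -/
abbrev Edge (G : RegularKnotGraph) : Type := Fin G.H ⊕ (Fin G.P ⊕ Fin G.L)

variable (G : RegularKnotGraph)

abbrev halfLine (h : Fin G.H) : G.Edge := Sum.inl h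

abbrev pendant (i : Fin G.P) : G.Edge := Sum.inr (Sum.inl i)

abbrev loop (j : Fin G.L) : G.Edge := Sum.inr (Sum.inr j)

/-- The interval that parametrizes an edge: `[0,∞)` for a half-line, `[0,ℓ]` for a pendant,
`[0,2ℓ]` for a loop. The knot is at `x = 0` on every edge, and also at `x = 2ℓ` on a loop. -/
def dom : G.Edge → Set ℝ
  | Sum.inl _ => Ici 0
  | Sum.inr (Sum.inl _) => Icc 0 G.ℓ
  | Sum.inr (Sum.inr _) => Icc 0 (2 * G.ℓ)

/-- A real function on the graph, given edge by edge. Only the values `u e x` with `x ∈ G.dom e`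
are meaningful. -/
abbrev Fn : Type := G.Edge → ℝ → ℝ

/-- Two functions agree at all points of the graph. -/
def Same (u v : G.Fn) : Prop := ∀ e, EqOn (u e) (v e) (G.dom e)

/-- Continuity at the knot: all edges take the same value at their ends attached to the knot. -/
def ContinuousAtKnot (u : G.Fn) : Prop :=
  ∃ c : ℝ, (∀ e, u e 0 = c) ∧ ∀ j, u (G.loop j) (2 * G.ℓ) = c

/-- `w ∈ H¹` on an interval `I` with left end point `0`: `w` is square integrable and is a primitive
of a square integrable function. Such a `w` is continuous on `I`, and its classical derivative
exists almost everywhere on `I` and is its weak derivative. -/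
def MemH1On (I : Set ℝ) (w : ℝ → ℝ) : Prop :=
  MemLp w 2 (volume.restrict I) ∧
    ∃ g : ℝ → ℝ, MemLp g 2 (volume.restrict I) ∧ ∀ x ∈ I, w x = w 0 + ∫ t in (0 : ℝ)..x, g t

/-- `u ∈ H¹(G)`: `u` is continuous on the graph and of class `H¹` on every edge. -/
def MemH1 (u : G.Fn) : Prop :=
  G.ContinuousAtKnot u ∧ ∀ e, MemH1On (G.dom e) (u e)

/-- A bound-state: a nontrivial weak solution `u ∈ H¹(G)` of `-u'' + u = |u|^(p-2) u`. -/
def IsBoundState (p : ℝ) (u : G.Fn) : Prop :=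
  G.MemH1 u ∧ (∃ e, ∃ x ∈ G.dom e, u e x ≠ 0) ∧
    ∀ η : G.Fn, G.MemH1 η →
      ∑ e, ∫ x in G.dom e,
        (deriv (u e) x * deriv (η e) x + u e x * η e x - |u e x| ^ (p - 2) * u e x * η e x) = 0

/-- The action functional. -/
noncomputable def action (p : ℝ) (u : G.Fn) : ℝ :=
  (1 / 2) * ∑ e, (∫ x in G.dom e, ((deriv (u e) x) ^ 2 + (u e x) ^ 2))
    - (1 / p) * ∑ e, ∫ x in G.dom e, |u e x| ^ p

/-- An action ground-state: a bound-state whose action is least among all bound-states. -/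
def IsActionGroundState (p : ℝ) (u : G.Fn) : Prop :=
  G.IsBoundState p u ∧ ∀ w, G.IsBoundState p w → G.action p u ≤ G.action p w

/-- Positivity at every point of the graph. -/
def Positive (u : G.Fn) : Prop := ∀ e, ∀ x ∈ G.dom e, 0 < u e x

/-- The compact edges, all of length `ℓ`, once a dummy vertex is put at the midpoint of each loop:
the pendants and the two halves of each loop. -/
abbrev CoreEdge : Type := Fin G.P ⊕ (Fin G.L × Bool)

/-- The restriction of `u` to a compact edge, parametrized by `[0,ℓ]` with the knot at `0`. -/
def onCore (u : G.Fn) : G.CoreEdge → ℝ → ℝ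
  | Sum.inl i => u (G.pendant i)
  | Sum.inr (j, false) => u (G.loop j)
  | Sum.inr (j, true) => fun x => u (G.loop j) (2 * G.ℓ - x)

def CoreSymmetric (u : G.Fn) : Prop :=
  ∀ κ₁ κ₂, EqOn (G.onCore u κ₁) (G.onCore u κ₂) (Icc 0 G.ℓ)

def CoreIncreasing (u : G.Fn) : Prop := ∀ κ, StrictMonoOn (G.onCore u κ) (Icc 0 G.ℓ)

def OneOnCore (u : G.Fn) : Prop := ∀ κ, ∀ x ∈ Icc 0 G.ℓ, G.onCore u κ x = 1

/-- The real-line soliton. -/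
noncomputable def soliton (p x : ℝ) : ℝ :=
  (p / 2) ^ (1 / (p - 2)) * (1 / Real.cosh ((p - 2) / 2 * x)) ^ (2 / (p - 2))

/-- For some `y > 0`, `u` is `φ(· + y)` on exactly `Hp` of the half-lines and `φ(· - y)` on the
other `Hm` of them, where `φ` is the soliton. -/
def HasCounts (p : ℝ) (u : G.Fn) (Hp Hm : ℕ) : Prop :=
  ∃ y : ℝ, 0 < y ∧ ∃ s : Finset (Fin G.H), s.card = Hp ∧ sᶜ.card = Hm ∧
    (∀ h ∈ s, ∀ x, 0 ≤ x → u (G.halfLine h) x = soliton p (x + y)) ∧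
    ∀ h ∉ s, ∀ x, 0 ≤ x → u (G.halfLine h) x = soliton p (x - y)

/-- `u` has incidence index `θ = (H⁺ - H⁻) / (P + 2L)`. -/
def HasIncidenceIndex (p : ℝ) (u : G.Fn) (θ : ℝ) : Prop :=
  ∃ Hp Hm : ℕ, G.HasCounts p u Hp Hm ∧ θ = ((Hp : ℝ) - (Hm : ℝ)) / ((G.P : ℝ) + 2 * (G.L : ℝ))

/-- A positive bound-state with incidence index `θ`. -/
def IsPositiveBoundStateWithIndex (p θ : ℝ) (u : G.Fn) : Prop :=
  G.IsBoundState p u ∧ G.Positive u ∧ G.HasIncidenceIndex p u θ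

/-- The function obtained from `u` by permuting the half-lines. -/
def permHalfLines (σ : Equiv.Perm (Fin G.H)) (u : G.Fn) : G.Fn
  | Sum.inl h => u (G.halfLine (σ h))
  | Sum.inr κ => u (Sum.inr κ)

/-- There is exactly one positive bound-state with incidence index `θ`, up to permutations of the
half-lines. -/
def UniquePositiveBoundState (p θ : ℝ) : Prop :=
  (∃ u, G.IsPositiveBoundStateWithIndex p θ u) ∧
    ∀ u v, G.IsPositiveBoundStateWithIndex p θ u → G.IsPositiveBoundStateWithIndex p θ v →
      ∃ σ : Equiv.Perm (Fin G.H), G.Same v (G.permHalfLines σ u)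

end RegularKnotGraph

/-! Testing the weak equation with broken lines shows that a bound-state solves `u'' = u - |u|^(p-2)
u` classically on each edge, with vanishing slope at the tips of the pendants and outgoing slopes at
the knot that sum to zero (`IsBoundState.exists_isClassical`). On a half-line, square integrability
forces the mechanical energy to vanish. If the knot value `c` is positive, each half-line therefore
carries `φ(· + y)` or `φ(· - y)`, with the same `y ≥ 0` determined by `φ(y) = c`
(`IsSol.exists_soliton`).

The compact edges are governed by one estimate, `abs_sub_le_of_short`: if two bounded solutions on a
short interval have equal slopes at some point, their difference is almost constant. So a slope at
one point and a value at another determine a solution, and loops are symmetric about their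
midpoints. Every compact edge thus carries the same Neumann solution, with a knot slope `m(c)` whose
sign is that of `c - 1`. A length-independent bound on positive solutions is needed first. It comes
from a lower bound for the slopes at the knot, which the Kirchhoff condition turns into an upper
bound, and from conservation of energy (`exists_bound_of_positive`).

The Kirchhoff condition now reads `m(φ(y)) = -θ φ'(y)`. For `θ > 0` it forces `φ(y) > 1`. In that
range the left side strictly decreases in `y` and the right side strictly increases, which gives
uniqueness; the intermediate value theorem gives existence (`exists_matching`). For `θ = 0` it
forces `φ(y) = 1`, and the core is constant. For `θ < 0` it forces `c = φ(y) < 1`. Then `|m(c)|` is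
at most a constant times `ℓ c`, whereas `|φ'(y)|` is at least `c √(1 - 2/p)`, which is impossible
when `ℓ` is small (`IsProfile.index_not_neg`).

For ground-states, testing a bound-state with itself makes the action a positive multiple of `∫
|u|^p`. The positive bound-state with `H⁺ = H` is a competitor whose action is bounded independently
of `ℓ`. Hence a ground-state has bounded `H¹` norm, varies little on the short core, is bounded
there, and by comparison with zero does not change sign. The classification then applies. For `H =
1` only `H⁺ = 1` is possible, so every bound-state of no larger action than the competitor equals it
up to sign. This gives existence and uniqueness without a compactness argument. When there are no
compact edges, the role of the competitor is played by the half-soliton with `y = 0`. -/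

namespace RegularKnotGraph

/-! ### The nonlinearity -/

/-- The right-hand side of the equation `u'' = u - |u|^(p-2) u`. -/
noncomputable def reaction (p t : ℝ) : ℝ := t - |t| ^ (p - 2) * t

/-- The mechanical energy of a solution of `u'' = reaction p u` with value `u` and slope `v`. -/
noncomputable def energy (p u v : ℝ) : ℝ := v ^ 2 / 2 - u ^ 2 / 2 + |u| ^ p / p

/-- `U` solves `u'' = reaction p u` on `S` with derivative `V`. -/
def IsSol (p : ℝ) (S : Set ℝ) (U V : ℝ → ℝ) : Prop :=
  ∀ x ∈ S, HasDerivWithinAt U (V x) S x ∧ HasDerivWithinAt V (reaction p (U x)) S x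

/-- Away from `0` this is the product rule. At `0` the difference quotient is exactly `|t| ^ q`,
which tends to `0`, so the nonlinearity is differentiable there as well. -/
theorem hasDerivAt_abs_rpow_mul_self {q : ℝ} (hq : 0 < q) (t : ℝ) :
    HasDerivAt (fun t : ℝ => |t| ^ q * t) ((q + 1) * |t| ^ q) t := by
  rcases eq_or_ne t 0 with rfl | ht
  · rw [hasDerivAt_iff_tendsto_slope]
    have hc : Filter.Tendsto (fun t : ℝ => |t| ^ q) (nhdsWithin 0 {0}ᶜ)
        (nhds ((q + 1) * |0| ^ q)) := by
      have : ContinuousAt (fun t : ℝ => |t| ^ q) 0 :=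
        (continuous_abs.rpow_const (fun _ => Or.inr hq.le)).continuousAt
      have h := this.tendsto
      simp only [abs_zero, Real.zero_rpow hq.ne'] at h
      simpa [Real.zero_rpow hq.ne'] using h.mono_left nhdsWithin_le_nhds
    refine hc.congr' ?_
    filter_upwards [self_mem_nhdsWithin] with x hx
    have hx : x ≠ 0 := hx
    simp [slope_def_field, hx]
  · have h := ((hasDerivAt_abs ht).rpow_const (p := q) (Or.inl (abs_ne_zero.2 ht))).mul
      (hasDerivAt_id t)
    refine h.congr_deriv ?_
    have h1 : |t| ^ q = |t| ^ (q - 1) * |t| := by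
      rw [← Real.rpow_add_one (abs_ne_zero.2 ht)]; ring_nf
    have h2 : (SignType.sign t : ℝ) * t = |t| := sign_mul_self t
    simp only [id]
    calc _ = q * |t| ^ (q - 1) * ((SignType.sign t : ℝ) * t) + |t| ^ q := by ring
      _ = _ := by rw [h2, h1]; ring

theorem hasDerivAt_reaction {p : ℝ} (hp : 2 < p) (t : ℝ) :
    HasDerivAt (reaction p) (1 - (p - 1) * |t| ^ (p - 2)) t := by
  have := (hasDerivAt_id t).sub (hasDerivAt_abs_rpow_mul_self (sub_pos.2 hp) t)
  refine this.congr_deriv ?_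
  ring

theorem continuous_reaction {p : ℝ} (hp : 2 < p) : Continuous (reaction p) :=
  continuous_iff_continuousAt.2 fun t => (hasDerivAt_reaction hp t).continuousAt

theorem reaction_zero (p : ℝ) : reaction p 0 = 0 := by simp [reaction]

theorem reaction_one (p : ℝ) : reaction p 1 = 0 := by simp [reaction]

theorem reaction_neg (p t : ℝ) : reaction p (-t) = -reaction p t := by
  simp only [reaction, abs_neg]; ring

theorem reaction_le_self {p t : ℝ} (ht : 0 ≤ t) : reaction p t ≤ t := by
  have : 0 ≤ |t| ^ (p - 2) * t := by positivity
  simp only [reaction]; linarith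

theorem reaction_lipschitz {p : ℝ} (hp : 2 < p) {A s t : ℝ} (hs : |s| ≤ A) (ht : |t| ≤ A) :
    |reaction p s - reaction p t| ≤ (1 + (p - 1) * A ^ (p - 2)) * |s - t| := by
  have h := (convex_Icc (-A) A).norm_image_sub_le_of_norm_hasDerivWithin_le
    (f := reaction p) (f' := fun t => 1 - (p - 1) * |t| ^ (p - 2))
    (C := 1 + (p - 1) * A ^ (p - 2))
    (fun x _ => (hasDerivAt_reaction hp x).hasDerivWithinAt) ?_ (abs_le.1 ht) (abs_le.1 hs)
  · simpa using h
  · intro x hx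
    have hx' : |x| ≤ A := abs_le.2 hx
    have h1 : |x| ^ (p - 2) ≤ A ^ (p - 2) :=
      Real.rpow_le_rpow (abs_nonneg x) hx' (by linarith)
    have h2 : 0 ≤ |x| ^ (p - 2) := by positivity
    have h3 : (p - 1) * |x| ^ (p - 2) ≤ (p - 1) * A ^ (p - 2) :=
      mul_le_mul_of_nonneg_left h1 (by linarith)
    have h4 : 0 ≤ (p - 1) * |x| ^ (p - 2) := mul_nonneg (by linarith) h2
    rw [Real.norm_eq_abs, abs_le]
    constructor <;> linarith

/-- This monotonicity above the equilibrium `1` drives both sides of the uniqueness argument for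
positive indices. -/
theorem reaction_strictAntiOn {p : ℝ} (hp : 2 < p) : StrictAntiOn (reaction p) (Ici 1) := by
  refine strictAntiOn_of_deriv_neg (convex_Ici 1) (continuous_reaction hp).continuousOn ?_
  intro x hx
  rw [interior_Ici] at hx
  have hx : 1 < x := hx
  rw [(hasDerivAt_reaction hp x).deriv, abs_of_pos (by linarith)]
  have : 1 < x ^ (p - 2) := Real.one_lt_rpow hx (by linarith)
  nlinarith

theorem reaction_pos {p t : ℝ} (hp : 2 < p) (h0 : 0 < t) (h1 : t < 1) : 0 < reaction p t := by
  have : t ^ (p - 2) < 1 := Real.rpow_lt_one h0.le h1 (by linarith)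
  simp only [reaction, abs_of_pos h0]
  nlinarith

theorem reaction_neg_of_one_lt {p t : ℝ} (hp : 2 < p) (h1 : 1 < t) : reaction p t < 0 := by
  rw [← reaction_one p]
  exact reaction_strictAntiOn hp self_mem_Ici h1.le h1

/-! ### Solutions of the equation -/

namespace IsSol

variable {p : ℝ} {S : Set ℝ} {U V : ℝ → ℝ}

theorem mono (h : IsSol p S U V) {T : Set ℝ} (hT : T ⊆ S) : IsSol p T U V :=
  fun x hx => ⟨(h x (hT hx)).1.mono hT, (h x (hT hx)).2.mono hT⟩

theorem continuousOn (h : IsSol p S U V) : ContinuousOn U S :=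
  fun x hx => (h x hx).1.continuousWithinAt

theorem continuousOn_deriv (h : IsSol p S U V) : ContinuousOn V S :=
  fun x hx => (h x hx).2.continuousWithinAt

theorem neg (h : IsSol p S U V) : IsSol p S (-U) (-V) := fun x hx =>
  ⟨(h x hx).1.neg, by simpa [reaction_neg] using (h x hx).2.neg⟩

theorem congr (h : IsSol p S U V) {U' : ℝ → ℝ} (hU : EqOn U' U S) : IsSol p S U' V :=
  fun x hx => ⟨(h x hx).1.congr hU (hU hx), by rw [hU hx]; exact (h x hx).2⟩

theorem reflect {b : ℝ} (h : IsSol p (Icc 0 b) U V) :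
    IsSol p (Icc 0 b) (fun x => U (b - x)) (fun x => -V (b - x)) := by
  intro x hx
  have hm : MapsTo (fun x => b - x) (Icc 0 b) (Icc 0 b) := fun y hy =>
    ⟨by linarith [hy.2], by linarith [hy.1]⟩
  have hd : HasDerivWithinAt (fun x => b - x) (-1) (Icc 0 b) x := by
    simpa using (hasDerivWithinAt_id x (Icc 0 b)).const_sub b
  have h1 := (h _ (hm hx)).1.scomp x hd hm
  have h2 := ((h _ (hm hx)).2.scomp x hd hm).neg
  refine ⟨h1.congr_deriv (by simp), h2.congr_deriv (by simp)⟩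

theorem energy_eq (hp : 2 < p) (hS : Convex ℝ S) (h : IsSol p S U V) {x y : ℝ} (hx : x ∈ S)
    (hy : y ∈ S) : energy p (U x) (V x) = energy p (U y) (V y) := by
  have hd : ∀ x ∈ S, HasDerivWithinAt (fun x => energy p (U x) (V x)) 0 S x := by
    intro x hx
    obtain ⟨h1, h2⟩ := h x hx
    have h3 := (hasDerivAt_abs_rpow (U x) (by linarith : 1 < p)).comp_hasDerivWithinAt x h1
    have := (((h2.pow 2).div_const 2).sub ((h1.pow 2).div_const 2)).add (h3.div_const p)
    refine this.congr_deriv ?_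
    have : p ≠ 0 := by linarith
    simp only [reaction]
    field_simp
    ring
  have := hS.norm_image_sub_le_of_norm_hasDerivWithin_le (C := 0) hd (by simp) hy hx
  simpa [sub_eq_zero] using this

/-- The field is only locally Lipschitz, so the Grönwall argument runs on each `[0, b]` inside a
strip that contains both solutions. -/
theorem eqOn_of_initial (hp : 2 < p) (h : IsSol p (Ici 0) U V) {U' V' : ℝ → ℝ}
    (h' : IsSol p (Ici 0) U' V') (h0 : U 0 = U' 0) (h1 : V 0 = V' 0) : EqOn U U' (Ici 0) := by
  intro b hb
  have hb : 0 ≤ b := hb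
  have hsub : Icc 0 b ⊆ Ici 0 := Icc_subset_Ici_self
  obtain ⟨A₁, hA₁⟩ := isCompact_Icc.exists_bound_of_continuousOn (h.continuousOn.mono hsub)
  obtain ⟨A₂, hA₂⟩ := isCompact_Icc.exists_bound_of_continuousOn (h'.continuousOn.mono hsub)
  set A := max A₁ A₂
  have hA0 : 0 ≤ A := (norm_nonneg _).trans ((hA₁ 0 ⟨le_rfl, hb⟩).trans (le_max_left _ _))
  set K := 1 + (p - 1) * A ^ (p - 2)
  have hK1 : 1 ≤ K := by
    have : 0 ≤ (p - 1) * A ^ (p - 2) := mul_nonneg (by linarith) (by positivity)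
    simp only [K]; linarith
  have hlip : ∀ t ∈ Ico 0 b, LipschitzOnWith K.toNNReal
      (fun z : ℝ × ℝ => (z.2, reaction p z.1)) {z | |z.1| ≤ A} := by
    intro t _
    refine LipschitzOnWith.of_dist_le_mul fun x hx y hy => ?_
    rw [Real.coe_toNNReal _ (by linarith)]
    rw [Prod.dist_eq, Prod.dist_eq]
    have hD : 0 ≤ max (dist x.1 y.1) (dist x.2 y.2) := le_max_of_le_left dist_nonneg
    refine max_le ?_ ?_
    · exact (le_max_right (dist x.1 y.1) (dist x.2 y.2)).trans (by nlinarith)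
    · simp only [Real.dist_eq]
      exact (reaction_lipschitz hp hx hy).trans
        (mul_le_mul_of_nonneg_left (le_max_left _ _) (by linarith))
  have key := ODE_solution_unique_of_mem_Icc_right hlip (f := fun x => (U x, V x))
    (g := fun x => (U' x, V' x))
    ((h.continuousOn.mono hsub).prodMk (h.continuousOn_deriv.mono hsub))
    (fun t ht => ((h t ht.1).1.prodMk (h t ht.1).2).mono (Ici_subset_Ici.2 ht.1))
    (fun t ht => (hA₁ t ⟨ht.1, ht.2.le⟩).trans (le_max_left _ _))
    ((h'.continuousOn.mono hsub).prodMk (h'.continuousOn_deriv.mono hsub))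
    (fun t ht => ((h' t ht.1).1.prodMk (h' t ht.1).2).mono (Ici_subset_Ici.2 ht.1))
    (fun t ht => (hA₂ t ⟨ht.1, ht.2.le⟩).trans (le_max_right _ _)) (by simp [h0, h1])
  exact congrArg Prod.fst (key ⟨hb, le_rfl⟩)

end IsSol

/-- On a short interval, a solution of a linear differential inequality of the second order with a
critical point stays close to any of its values. -/
theorem abs_sub_le_of_short {a K : ℝ} {d e e' : ℝ → ℝ} (hK0 : 0 ≤ K) (hK : a ^ 2 * K ≤ 1 / 3)
    (hd : ∀ x ∈ Icc 0 a, HasDerivWithinAt d (e x) (Icc 0 a) x)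
    (he : ∀ x ∈ Icc 0 a, HasDerivWithinAt e (e' x) (Icc 0 a) x)
    (hb : ∀ x ∈ Icc 0 a, |e' x| ≤ K * |d x|) {x₀ x₁ : ℝ} (hx₀ : x₀ ∈ Icc 0 a) (h₀ : e x₀ = 0)
    (hx₁ : x₁ ∈ Icc 0 a) {x : ℝ} (hx : x ∈ Icc 0 a) :
    |d x - d x₁| ≤ |d x₁| / 2 ∧ |e x| ≤ a * K * (3 / 2 * |d x₁|) := by
  have ha : 0 ≤ a := hx.1.trans hx.2
  obtain ⟨m, hm, hmax⟩ := isCompact_Icc.exists_isMaxOn ⟨x, hx⟩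
    (show ContinuousOn (fun x => |d x|) (Icc 0 a) from
      ContinuousOn.abs fun x hx => (hd x hx).continuousWithinAt)
  have hmax : ∀ y ∈ Icc 0 a, |d y| ≤ |d m| := hmax
  have dist_le : ∀ y ∈ Icc 0 a, ∀ z ∈ Icc 0 a, |y - z| ≤ a := fun y hy z hz =>
    abs_le.2 ⟨by linarith [hy.1, hz.2], by linarith [hy.2, hz.1]⟩
  have he1 : ∀ y ∈ Icc 0 a, |e y| ≤ a * K * |d m| := by
    intro y hy
    have := (convex_Icc 0 a).norm_image_sub_le_of_norm_hasDerivWithin_le (C := K * |d m|) he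
      (fun z hz => (hb z hz).trans (mul_le_mul_of_nonneg_left (hmax z hz) hK0)) hx₀ hy
    rw [h₀, sub_zero, Real.norm_eq_abs, Real.norm_eq_abs] at this
    refine this.trans ?_
    calc _ ≤ K * |d m| * a :=
          mul_le_mul_of_nonneg_left (dist_le y hy x₀ hx₀) (by positivity)
      _ = _ := by ring
  have hd1 : ∀ y ∈ Icc 0 a, |d y - d x₁| ≤ |d m| / 3 := by
    intro y hy
    have := (convex_Icc 0 a).norm_image_sub_le_of_norm_hasDerivWithin_le hd he1 hx₁ hy
    rw [Real.norm_eq_abs, Real.norm_eq_abs] at this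
    refine this.trans ?_
    calc _ ≤ a * K * |d m| * a :=
          mul_le_mul_of_nonneg_left (dist_le y hy x₁ hx₁) (by positivity)
      _ = a ^ 2 * K * |d m| := by ring
      _ ≤ 1 / 3 * |d m| := mul_le_mul_of_nonneg_right hK (abs_nonneg _)
      _ = _ := by ring
  -- Absorption: `|d m| ≤ |d x₁| + |d m| / 3`. This is where the threshold `1 / 3` produces the
  -- constants `3 / 2` and `1 / 2`.
  have hm' : |d m| ≤ 3 / 2 * |d x₁| := by
    have h1 := hd1 m hm
    have h2 := abs_sub_abs_le_abs_sub (d m) (d x₁)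
    linarith
  refine ⟨(hd1 x hx).trans (by linarith), (he1 x hx).trans ?_⟩
  exact mul_le_mul_of_nonneg_left hm' (by positivity)

/-! ### The soliton -/

/-- The derivative of the soliton. -/
noncomputable def solitonSlope (p x : ℝ) : ℝ := -(Real.tanh ((p - 2) / 2 * x) * soliton p x)

section Soliton

variable {p : ℝ}

theorem soliton_pos (hp : 2 < p) (x : ℝ) : 0 < soliton p x := by
  have := Real.cosh_pos ((p - 2) / 2 * x)
  have : 0 < p / 2 := by linarith
  unfold soliton
  positivity

theorem soliton_neg (p x : ℝ) : soliton p (-x) = soliton p x := by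
  simp [soliton]

theorem solitonSlope_neg (p x : ℝ) : solitonSlope p (-x) = -solitonSlope p x := by
  simp [solitonSlope, soliton_neg, Real.tanh_neg]

theorem solitonSlope_zero (p : ℝ) : solitonSlope p 0 = 0 := by simp [solitonSlope]

theorem soliton_rpow (hp : 2 < p) (x : ℝ) :
    soliton p x ^ (p - 2) = p / 2 * (1 / Real.cosh ((p - 2) / 2 * x)) ^ 2 := by
  have hc := Real.cosh_pos ((p - 2) / 2 * x)
  have h2 : p - 2 ≠ 0 := by linarith
  have hp2 : 0 ≤ p / 2 := by linarith
  rw [soliton, Real.mul_rpow (by positivity) (by positivity), ← Real.rpow_mul hp2,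
    ← Real.rpow_mul (by positivity), one_div_mul_cancel h2, Real.rpow_one,
    div_mul_cancel₀ _ h2]
  norm_num

theorem tanh_sq_eq (x : ℝ) : Real.tanh x ^ 2 = 1 - (1 / Real.cosh x) ^ 2 := by
  have := (Real.cosh_pos x).ne'
  rw [Real.tanh_eq_sinh_div_cosh, div_pow, Real.sinh_sq]
  field_simp

theorem hasDerivAt_soliton (hp : 2 < p) (x : ℝ) :
    HasDerivAt (soliton p) (solitonSlope p x) x := by
  set b := (p - 2) / 2 with hb
  have hb0 : b ≠ 0 := by simp only [hb]; linarith
  have hc := Real.cosh_pos (b * x)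
  have h1 : HasDerivAt (fun x => 1 / Real.cosh (b * x))
      (-(b * Real.sinh (b * x)) / Real.cosh (b * x) ^ 2) x := by
    have h := ((hasDerivAt_id x).const_mul b).cosh
    simp only [id, mul_one] at h
    have := h.inv hc.ne'
    simp only [one_div]
    refine this.congr_deriv ?_
    ring
  have h2 := (h1.rpow_const (p := 2 / (p - 2)) (Or.inl (by positivity))).const_mul
    ((p / 2) ^ (1 / (p - 2)))
  refine h2.congr_deriv ?_
  have h3 : (1 / Real.cosh (b * x)) ^ (2 / (p - 2) - 1) =
      (1 / Real.cosh (b * x)) ^ (2 / (p - 2)) * Real.cosh (b * x) := by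
    rw [Real.rpow_sub_one (by positivity)]
    field_simp
  have hbp : 2 / (p - 2) = 1 / b := by rw [hb]; field_simp
  simp only [solitonSlope, soliton, ← hb]
  rw [h3, hbp, Real.tanh_eq_sinh_div_cosh]
  field_simp

theorem hasDerivAt_solitonSlope (hp : 2 < p) (x : ℝ) :
    HasDerivAt (solitonSlope p) (reaction p (soliton p x)) x := by
  set b := (p - 2) / 2 with hb
  have hc := (Real.cosh_pos (b * x)).ne'
  have h1 : HasDerivAt (fun x => Real.tanh (b * x)) (b * (1 / Real.cosh (b * x)) ^ 2) x := by
    have hl : HasDerivAt (fun x => b * x) b x := by simpa using (hasDerivAt_id x).const_mul b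
    have h := hl.sinh.div hl.cosh hc
    have he : (fun x => Real.tanh (b * x)) = (fun x => Real.sinh (b * x)) / fun x =>
        Real.cosh (b * x) := by
      funext y; simp [Real.tanh_eq_sinh_div_cosh]
    rw [he]
    refine h.congr_deriv ?_
    field_simp
    rw [Real.cosh_sq]
    ring
  have h2 := (h1.mul (hasDerivAt_soliton hp x)).neg
  refine h2.congr_deriv ?_
  have hq := soliton_rpow hp x
  have ht := tanh_sq_eq (b * x)
  rw [← hb] at hq
  simp only [reaction, abs_of_pos (soliton_pos hp x), hq, solitonSlope, ← hb]
  have hbp : p / 2 = b + 1 := by rw [hb]; ring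
  rw [hbp]
  linear_combination soliton p x * ht

/-- The soliton runs along the zero-energy curve of the phase plane. The lower bound for its slope
when its value is below `1` is read off from this identity. -/
theorem solitonSlope_sq (hp : 2 < p) (x : ℝ) :
    solitonSlope p x ^ 2 = soliton p x ^ 2 * (1 - 2 / p * soliton p x ^ (p - 2)) := by
  have h0 : p ≠ 0 := by linarith
  rw [soliton_rpow hp, solitonSlope, neg_sq, mul_pow, tanh_sq_eq]
  field_simp

theorem isSol_soliton (hp : 2 < p) (S : Set ℝ) (y : ℝ) :
    IsSol p S (fun x => soliton p (x + y)) (fun x => solitonSlope p (x + y)) := fun x _ =>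
  ⟨((hasDerivAt_soliton hp (x + y)).comp_add_const x y).hasDerivWithinAt,
    ((hasDerivAt_solitonSlope hp (x + y)).comp_add_const x y).hasDerivWithinAt⟩

theorem continuous_soliton (hp : 2 < p) : Continuous (soliton p) :=
  continuous_iff_continuousAt.2 fun x => (hasDerivAt_soliton hp x).continuousAt

theorem continuous_solitonSlope (hp : 2 < p) : Continuous (solitonSlope p) :=
  continuous_iff_continuousAt.2 fun x => (hasDerivAt_solitonSlope hp x).continuousAt

theorem solitonSlope_neg_of_pos (hp : 2 < p) {x : ℝ} (hx : 0 < x) : solitonSlope p x < 0 := by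
  have h1 : 0 < (p - 2) / 2 * x := mul_pos (by linarith) hx
  have h2 : 0 < Real.tanh ((p - 2) / 2 * x) := by
    rw [Real.tanh_eq_sinh_div_cosh]
    exact div_pos (Real.sinh_pos_iff.2 h1) (Real.cosh_pos _)
  have := mul_pos h2 (soliton_pos hp x)
  simp only [solitonSlope]; linarith

theorem abs_solitonSlope_le (hp : 2 < p) (x : ℝ) : |solitonSlope p x| ≤ soliton p x := by
  refine abs_le_of_sq_le_sq ?_ (soliton_pos hp x).le
  rw [solitonSlope_sq hp]
  have h1 : 0 ≤ 2 / p * soliton p x ^ (p - 2) := by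
    have := soliton_pos hp x
    have : 0 < p := by linarith
    positivity
  nlinarith [sq_nonneg (soliton p x)]

theorem soliton_strictAntiOn (hp : 2 < p) : StrictAntiOn (soliton p) (Ici 0) := by
  refine strictAntiOn_of_deriv_neg (convex_Ici 0) (continuous_soliton hp).continuousOn ?_
  intro x hx
  rw [interior_Ici] at hx
  rw [(hasDerivAt_soliton hp x).deriv]
  exact solitonSlope_neg_of_pos hp hx

theorem soliton_le_exp (hp : 2 < p) (x : ℝ) :
    soliton p x ≤ (p / 2) ^ (1 / (p - 2)) * 2 ^ (2 / (p - 2)) * Real.exp (-x) := by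
  have hc := Real.cosh_pos ((p - 2) / 2 * x)
  have h2 : p - 2 ≠ 0 := by linarith
  have h1 : 1 / Real.cosh ((p - 2) / 2 * x) ≤ 2 * Real.exp (-((p - 2) / 2 * x)) := by
    rw [div_le_iff₀ hc, Real.cosh_eq]
    have e1 := Real.exp_pos (-((p - 2) / 2 * x))
    have e2 : Real.exp (-((p - 2) / 2 * x)) * Real.exp ((p - 2) / 2 * x) = 1 := by
      rw [← Real.exp_add]; simp
    nlinarith
  have h3 := Real.rpow_le_rpow (by positivity) h1 (show 0 ≤ 2 / (p - 2) from
    div_nonneg (by norm_num) (by linarith))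
  rw [Real.mul_rpow (by norm_num) (Real.exp_pos _).le, ← Real.exp_mul] at h3
  have h4 : -((p - 2) / 2 * x) * (2 / (p - 2)) = -x := by field_simp
  rw [h4] at h3
  rw [soliton, mul_assoc]
  exact mul_le_mul_of_nonneg_left h3 (Real.rpow_nonneg (by linarith) _)

theorem one_lt_soliton_zero (hp : 2 < p) : 1 < soliton p 0 := by
  have h := soliton_rpow hp 0
  simp only [mul_zero, Real.cosh_zero, ne_eq, one_ne_zero, not_false_eq_true, div_self, one_pow,
    mul_one] at h
  by_contra hle
  have := Real.rpow_le_one (soliton_pos hp 0).le (not_lt.1 hle) (by linarith : 0 ≤ p - 2)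
  linarith

theorem soliton_le_zero (hp : 2 < p) (x : ℝ) : soliton p x ≤ soliton p 0 := by
  rcases le_total 0 x with hx | hx
  · exact (soliton_strictAntiOn hp).antitoneOn self_mem_Ici hx hx
  · rw [← soliton_neg]
    exact (soliton_strictAntiOn hp).antitoneOn self_mem_Ici (neg_nonneg.2 hx) (neg_nonneg.2 hx)

theorem exists_soliton_eq (hp : 2 < p) {c : ℝ} (h0 : 0 < c) (h1 : c ≤ soliton p 0) :
    ∃ y, 0 ≤ y ∧ soliton p y = c := by
  set D := (p / 2) ^ (1 / (p - 2)) * (2 : ℝ) ^ (2 / (p - 2))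
  have ht : Filter.Tendsto (fun x => D * Real.exp (-x)) Filter.atTop (nhds (D * 0)) :=
    Real.tendsto_exp_neg_atTop_nhds_zero.const_mul D
  rw [mul_zero] at ht
  obtain ⟨R, hR1, hR2⟩ := ((ht.eventually_lt_const h0).and
    (Filter.eventually_ge_atTop 0)).exists
  obtain ⟨y, hy, hyc⟩ := intermediate_value_Icc' hR2 (continuous_soliton hp).continuousOn
    ⟨(soliton_le_exp hp R).trans hR1.le, h1⟩
  exact ⟨y, hy.1, hyc⟩

theorem energy_zero_iff (hp : 2 < p) {u v : ℝ} (hu : 0 < u) :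
    energy p u v = 0 ↔ v ^ 2 = u ^ 2 * (1 - 2 / p * u ^ (p - 2)) := by
  have h0 : p ≠ 0 := by linarith
  have h1 : u ^ p = u ^ (p - 2) * u ^ 2 := by
    rw [← Real.rpow_natCast u 2, ← Real.rpow_add hu]; norm_num
  rw [energy, abs_of_pos hu, h1]
  constructor
  · intro h
    field_simp at h ⊢
    linarith
  · intro h
    rw [h]
    field_simp
    ring

/-- A point of the phase plane with zero energy lies on the orbit of the soliton. -/
theorem exists_soliton_of_energy_zero (hp : 2 < p) {u v : ℝ} (hu : 0 < u)
    (hE : energy p u v = 0) : ∃ y, 0 ≤ y ∧ soliton p y = u ∧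
      (v = solitonSlope p y ∨ v = solitonSlope p (-y)) := by
  have hE' := (energy_zero_iff hp hu).1 hE
  have hM := soliton_rpow hp 0
  simp only [mul_zero, Real.cosh_zero, ne_eq, one_ne_zero, not_false_eq_true, div_self, one_pow,
    mul_one] at hM
  have h0 : 0 < p := by linarith
  have hle : u ≤ soliton p 0 := by
    rw [← Real.rpow_le_rpow_iff hu.le (soliton_pos hp 0).le (by linarith : 0 < p - 2), hM]
    -- Above the maximum of the soliton the zero-energy relation would make `v ^ 2` negative.
    by_contra hlt
    have h2 : 1 < 2 / p * u ^ (p - 2) := by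
      rw [div_mul_eq_mul_div, lt_div_iff₀ h0]; linarith
    nlinarith [sq_nonneg v, pow_pos hu 2]
  obtain ⟨y, hy0, hy⟩ := exists_soliton_eq hp hu hle
  refine ⟨y, hy0, hy, ?_⟩
  rw [solitonSlope_neg]
  refine sq_eq_sq_iff_eq_or_eq_neg.1 ?_
  rw [hE', solitonSlope_sq hp, hy]

end Soliton

/-! ### Sobolev functions on an interval -/

/-- The intervals that parametrize an edge. -/
def IsEdgeDomain (I : Set ℝ) : Prop := I = Ici 0 ∨ ∃ a, 0 < a ∧ I = Icc 0 a

section Interval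

variable {I : Set ℝ} {w : ℝ → ℝ}

theorem isEdgeDomain_Ici : IsEdgeDomain (Ici 0) := Or.inl rfl

theorem isEdgeDomain_Icc {a : ℝ} (ha : 0 < a) : IsEdgeDomain (Icc 0 a) := Or.inr ⟨a, ha, rfl⟩

namespace IsEdgeDomain

theorem measurableSet (hI : IsEdgeDomain I) : MeasurableSet I := by
  rcases hI with rfl | ⟨a, _, rfl⟩
  exacts [measurableSet_Ici, measurableSet_Icc]

theorem convex (hI : IsEdgeDomain I) : Convex ℝ I := by
  rcases hI with rfl | ⟨a, _, rfl⟩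
  exacts [convex_Ici 0, convex_Icc 0 a]

theorem zero_mem (hI : IsEdgeDomain I) : 0 ∈ I := by
  rcases hI with rfl | ⟨a, ha, rfl⟩
  exacts [self_mem_Ici, ⟨le_rfl, ha.le⟩]

theorem nonneg (hI : IsEdgeDomain I) {x : ℝ} (hx : x ∈ I) : 0 ≤ x := by
  rcases hI with rfl | ⟨a, _, rfl⟩
  exacts [hx, hx.1]

theorem Icc_subset (hI : IsEdgeDomain I) {b : ℝ} (hb : b ∈ I) : Icc 0 b ⊆ I := by
  rcases hI with rfl | ⟨a, _, rfl⟩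
  exacts [Icc_subset_Ici_self, Icc_subset_Icc_right hb.2]

theorem ae_mem_nhds (hI : IsEdgeDomain I) : ∀ᵐ x, x ∈ I → I ∈ nhds x := by
  rcases hI with rfl | ⟨a, _, rfl⟩
  · filter_upwards [Measure.ae_ne volume (0 : ℝ)] with x hx hxI
    exact Ici_mem_nhds (lt_of_le_of_ne hxI hx.symm)
  · filter_upwards [Measure.ae_ne volume (0 : ℝ), Measure.ae_ne volume a] with x hx hxa hxI
    exact Icc_mem_nhds (lt_of_le_of_ne hxI.1 hx.symm) (lt_of_le_of_ne hxI.2 hxa)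

theorem ae_of_forall_Icc (hI : IsEdgeDomain I) {P : ℝ → Prop}
    (h : ∀ b ∈ I, ∀ᵐ x, x ∈ Icc 0 b → P x) : ∀ᵐ x, x ∈ I → P x := by
  rcases hI with rfl | ⟨a, ha, rfl⟩
  · have : ∀ n : ℕ, ∀ᵐ x, x ∈ Icc (0 : ℝ) n → P x := fun n => h n (mem_Ici.2 (Nat.cast_nonneg n))
    filter_upwards [ae_all_iff.2 this] with x hx hx0
    obtain ⟨n, hn⟩ := exists_nat_ge x
    exact hx n ⟨hx0, hn⟩
  · exact h a ⟨ha.le, le_rfl⟩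

end IsEdgeDomain

theorem MemLp.intervalIntegrable_of_mem {g : ℝ → ℝ} (hI : IsEdgeDomain I)
    (hg : MemLp g 2 (volume.restrict I)) {b : ℝ} (hb : b ∈ I) :
    IntervalIntegrable g volume 0 b := by
  rw [intervalIntegrable_iff_integrableOn_Icc_of_le (hI.nonneg hb)]
  exact (hg.mono_measure (Measure.restrict_mono_set _ (hI.Icc_subset hb))).integrable (by norm_num)

namespace MemH1On

theorem absolutelyContinuous (hI : IsEdgeDomain I) (hw : MemH1On I w) {b : ℝ} (hb : b ∈ I) :
    AbsolutelyContinuousOnInterval w 0 b := by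
  obtain ⟨_, g, hg, hgw⟩ := hw
  have h1 := (MemLp.intervalIntegrable_of_mem hI hg
    hb).absolutelyContinuousOnInterval_intervalIntegral left_mem_uIcc
  have h2 : AbsolutelyContinuousOnInterval (fun _ : ℝ => w 0) 0 b :=
    ((LipschitzWith.const (w 0)).lipschitzOnWith (s := uIcc 0 b)).absolutelyContinuousOnInterval
  have h3 := h2.fun_add h1
  -- `w` agrees with the primitive on `I` only, so absolute continuity is transferred through its
  -- ε–δ form, which involves values in the interval only.
  rw [absolutelyContinuousOnInterval_iff] at h3 ⊢
  intro ε hε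
  obtain ⟨δ, hδ, h⟩ := h3 ε hε
  refine ⟨δ, hδ, fun E hE hd => ?_⟩
  convert h E hE hd using 2 with i hi
  have hsub : uIcc 0 b ⊆ I := by
    rw [uIcc_of_le (hI.nonneg hb)]; exact hI.Icc_subset hb
  have hi := hE.1 i hi
  rw [hgw _ (hsub hi.1), hgw _ (hsub hi.2)]

theorem continuousOn (hI : IsEdgeDomain I) (hw : MemH1On I w) : ContinuousOn w I := by
  rcases hI with rfl | ⟨a, ha, rfl⟩
  · intro x hx
    have hx : 0 ≤ x := hx
    have h := (absolutelyContinuous isEdgeDomain_Ici hw (b := x + 1)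
      (by simp only [mem_Ici]; linarith)).continuousOn
    rw [uIcc_of_le (by linarith)] at h
    refine (h x ⟨hx, by linarith⟩).mono_of_mem_nhdsWithin ?_
    rw [← Ici_inter_Iic]
    exact Filter.inter_mem self_mem_nhdsWithin
      (mem_nhdsWithin_of_mem_nhds (Iic_mem_nhds (by linarith)))
  · have h := (absolutelyContinuous (isEdgeDomain_Icc ha) hw ⟨ha.le, le_rfl⟩).continuousOn
    rwa [uIcc_of_le ha.le] at h

/-- By Lebesgue differentiation the classical derivative agrees almost everywhere with the square
integrable density, so integrals may be written with `deriv`. -/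
theorem memLp_deriv (hI : IsEdgeDomain I) (hw : MemH1On I w) :
    MemLp (deriv w) 2 (volume.restrict I) := by
  obtain ⟨_, g, hg, hgw⟩ := hw
  refine (memLp_congr_ae ?_).2 hg
  refine (ae_restrict_iff' hI.measurableSet).2 (hI.ae_of_forall_Icc fun b hb => ?_)
  filter_upwards [(MemLp.intervalIntegrable_of_mem hI hg hb).ae_hasDerivAt_integral,
    Measure.ae_ne volume (0 : ℝ), Measure.ae_ne volume b] with x hx hx0 hxb hxI
  rw [uIcc_of_le (hI.nonneg hb)] at hx
  have h1 := (hx hxI 0 ⟨le_rfl, hI.nonneg hb⟩).const_add (w 0)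
  refine (h1.congr_of_eventuallyEq ?_).deriv
  filter_upwards [Icc_mem_nhds (lt_of_le_of_ne hxI.1 hx0.symm) (lt_of_le_of_ne hxI.2 hxb)]
    with y hy
  exact hgw y (hI.Icc_subset hb hy)

theorem mono (hI : IsEdgeDomain I) (hw : MemH1On I w) {b : ℝ} (hb : b ∈ I) :
    MemH1On (Icc 0 b) w := by
  obtain ⟨h1, g, hg, hgw⟩ := hw
  have hle := Measure.restrict_mono_set volume (hI.Icc_subset hb)
  exact ⟨h1.mono_measure hle, g, hg.mono_measure hle, fun x hx => hgw x (hI.Icc_subset hb hx)⟩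

end MemH1On

/-- A differentiable function with continuous derivative, both square integrable, is of class
`H¹`. -/
theorem memH1On_of_hasDerivWithinAt {v : ℝ → ℝ} (hI : IsEdgeDomain I)
    (h : ∀ x ∈ I, HasDerivWithinAt w (v x) I x) (hv : ContinuousOn v I)
    (hw2 : MemLp w 2 (volume.restrict I)) (hv2 : MemLp v 2 (volume.restrict I)) :
    MemH1On I w := by
  refine ⟨hw2, v, hv2, fun x hx => ?_⟩
  have hsub := hI.Icc_subset hx
  have hx0 := hI.nonneg hx
  rw [intervalIntegral.integral_eq_sub_of_hasDeriv_right_of_le hx0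
    (fun y hy => ((h y (hsub hy)).continuousWithinAt).mono hsub)
    (fun y hy => ?_) ((hv.mono hsub).intervalIntegrable_of_Icc hx0)]
  · ring
  · refine ((h y (hsub ⟨hy.1.le, hy.2.le⟩)).mono hsub).hasDerivAt
      (Icc_mem_nhds hy.1 hy.2) |>.hasDerivWithinAt

/-- A Lipschitz function that vanishes beyond `b` is of class `H¹`. -/
theorem memH1On_of_lipschitz {K : NNReal} (hI : IsEdgeDomain I) (hw : LipschitzWith K w) (b : ℝ)
    (hb : ∀ t ∈ I, b < t → w t = 0) : MemH1On I w := by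
  have hIb : I ∩ Icc 0 b ⊆ I := inter_subset_left
  have hm : MeasurableSet (I ∩ Icc 0 b) := hI.measurableSet.inter measurableSet_Icc
  have hfin : volume (I ∩ Icc 0 b) ≠ ⊤ :=
    ((measure_mono inter_subset_right).trans_lt measure_Icc_lt_top).ne
  have hbd : ∀ᵐ x, x ∈ I → b < x → deriv w x = 0 := by
    filter_upwards [hI.ae_mem_nhds] with x hx hxI hbx
    have : w =ᶠ[nhds x] fun _ => 0 := by
      filter_upwards [hx hxI, Ioi_mem_nhds hbx] with y hy hy'
      exact hb y hy hy'
    rw [this.deriv_eq, deriv_const]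
  have key : ∀ g : ℝ → ℝ, AEStronglyMeasurable g volume → (∃ C, ∀ x ∈ Icc 0 b, |g x| ≤ C) →
      (∀ᵐ x, x ∈ I → b < x → g x = 0) → MemLp g 2 (volume.restrict I) := by
    rintro g hg ⟨C, hC⟩ h0
    have : MemLp ((I ∩ Icc 0 b).indicator g) 2 (volume.restrict I) := by
      rw [memLp_indicator_iff_restrict hm, Measure.restrict_restrict hm,
        inter_eq_left.2 hIb]
      have : IsFiniteMeasure (volume.restrict (I ∩ Icc 0 b)) :=
        ⟨by rw [Measure.restrict_apply_univ]; exact hfin.lt_top⟩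
      refine MemLp.of_bound hg.restrict C ?_
      refine (ae_restrict_iff' hm).2 (Filter.Eventually.of_forall fun x hx => hC x hx.2)
    refine (memLp_congr_ae ?_).1 this
    refine (ae_restrict_iff' hI.measurableSet).2 ?_
    filter_upwards [h0] with x hx hxI
    by_cases hxb : x ≤ b
    · exact indicator_of_mem (show x ∈ I ∩ Icc 0 b from ⟨hxI, hI.nonneg hxI, hxb⟩) g
    · rw [indicator_of_notMem (fun h => hxb h.2.2), hx hxI (not_le.1 hxb)]
  refine ⟨key w hw.continuous.aestronglyMeasurable ?_ (Filter.Eventually.of_forall hb), deriv w,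
    key _ (stronglyMeasurable_deriv w).aestronglyMeasurable
      ⟨K, fun x _ => norm_deriv_le_of_lipschitz hw⟩ hbd, fun x _ => ?_⟩
  · exact isCompact_Icc.exists_bound_of_continuousOn hw.continuous.continuousOn
  · have := (hw.lipschitzOnWith (s := uIcc 0 x)).absolutelyContinuousOnInterval
    rw [this.integral_deriv_eq_sub]
    ring

/-- Integration by parts against a function of class `C¹`. -/
theorem integral_mul_deriv_add {b : ℝ} (hb : 0 ≤ b) {V k η : ℝ → ℝ}
    (hV : ∀ x ∈ Icc 0 b, HasDerivWithinAt V (k x) (Icc 0 b) x) (hk : ContinuousOn k (Icc 0 b))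
    (hη : AbsolutelyContinuousOnInterval η 0 b) :
    ∫ x in (0 : ℝ)..b, (V x * deriv η x + k x * η x) = V b * η b - V 0 * η 0 := by
  obtain ⟨C, hC⟩ := isCompact_Icc.exists_bound_of_continuousOn hk
  -- A bounded derivative makes `V` Lipschitz, hence absolutely continuous, so the product formula
  -- for absolutely continuous functions applies.
  have hlip : LipschitzOnWith C.toNNReal V (uIcc 0 b) := by
    rw [uIcc_of_le hb]
    refine (convex_Icc 0 b).lipschitzOnWith_of_nnnorm_hasDerivWithin_le hV fun x hx => ?_
    rw [← NNReal.coe_le_coe, coe_nnnorm]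
    exact (hC x hx).trans (Real.le_coe_toNNReal C)
  rw [← hlip.absolutelyContinuousOnInterval.integral_deriv_mul_eq_sub hη]
  refine intervalIntegral.integral_congr_ae ?_
  filter_upwards [Measure.ae_ne volume b] with x hxb hx
  rw [uIoc_of_le hb] at hx
  rw [((hV x ⟨hx.1.le, hx.2⟩).hasDerivAt
    (Icc_mem_nhds hx.1 (lt_of_le_of_ne hx.2 hxb))).deriv]
  ring

end Interval

/-! ### Regularity of weak solutions on an edge -/

section Regularity

/-- The broken line that vanishes at `0` and beyond `b`, with its kink at `x`. -/
noncomputable def tent (b x t : ℝ) : ℝ := min t x - x / b * min t b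

theorem tent_zero {b x : ℝ} (hx : 0 ≤ x) (hb : 0 ≤ b) : tent b x 0 = 0 := by
  simp [tent, hx, hb]

theorem tent_of_le {b x t : ℝ} (hxb : x ≤ b) (ht : t ≤ x) : tent b x t = t - x / b * t := by
  rw [tent, min_eq_left ht, min_eq_left (ht.trans hxb)]

theorem tent_of_mem {b x t : ℝ} (ht : t ∈ Icc x b) : tent b x t = x - x / b * t := by
  rw [tent, min_eq_right ht.1, min_eq_left ht.2]

theorem tent_of_ge {b x t : ℝ} (hb : 0 < b) (hxb : x ≤ b) (ht : b ≤ t) : tent b x t = 0 := by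
  rw [tent, min_eq_right (hxb.trans ht), min_eq_right ht, div_mul_cancel₀ _ hb.ne', sub_self]

theorem exists_lipschitzWith_tent (b x : ℝ) : ∃ K, LipschitzWith K (tent b x) := by
  have h1 : LipschitzWith 1 (fun t : ℝ => min t x) := LipschitzWith.id.min_const x
  have h2 : LipschitzWith 1 (fun t : ℝ => min t b) := LipschitzWith.id.min_const b
  exact ⟨_, h1.sub ((lipschitzWith_smul (x / b)).comp h2)⟩

/-- On `[0, b]`, `tent b x` is the Green function of `-d²/dt²` with Dirichlet conditions and pole
`x`. Testing with it represents `w x` by integrals of the continuous function `reaction p ∘ w`, and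
this representation can be differentiated twice. -/
theorem isSol_of_weak_Icc {p : ℝ} (hp : 2 < p) {b : ℝ} (hb : 0 < b) {w : ℝ → ℝ}
    (hw : MemH1On (Icc 0 b) w)
    (hweak : ∀ x ∈ Ioo 0 b, ∫ t in Icc 0 b,
      (deriv w t * deriv (tent b x) t + reaction p (w t) * tent b x t) = 0) :
    ∃ V, IsSol p (Icc 0 b) w V := by
  have hI := isEdgeDomain_Icc hb
  have hwc := hw.continuousOn hI
  have hac := hw.absolutelyContinuous hI ⟨hb.le, le_rfl⟩
  have hkc : ContinuousOn (fun t => reaction p (w t)) (Icc 0 b) :=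
    (continuous_reaction hp).comp_continuousOn hwc
  -- A continuous extension to the whole line, so that the fundamental theorem of calculus also
  -- holds at the end points.
  set k : ℝ → ℝ := IccExtend hb.le ((Icc 0 b).domRestrict fun t => reaction p (w t)) with hk
  have hkcont : Continuous k := (continuousOn_iff_continuous_domRestrict.1 hkc).Icc_extend'
  have hkeq : ∀ t ∈ Icc 0 b, k t = reaction p (w t) := fun t ht => by
    rw [hk, IccExtend_of_mem _ _ ht, domRestrict_apply]
  have hki : ∀ x y, IntervalIntegrable k volume x y := fun x y => hkcont.intervalIntegrable x y
  have hmk : Continuous fun t => t * k t := continuous_id.mul hkcont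
  have hmi : ∀ x y, IntervalIntegrable (fun t => t * k t) volume x y :=
    fun x y => hmk.intervalIntegrable x y
  -- This constant turns out to be the slope of `w` at `b`.
  set C := (w b - w 0) / b + (∫ t in (0 : ℝ)..b, t * k t) / b with hC
  have hform : ∀ x ∈ Icc 0 b,
      w x = w 0 + x * C - (∫ t in (0 : ℝ)..x, t * k t) - x * ∫ t in x..b, k t := by
    intro x hx
    rcases eq_or_lt_of_le hx.1 with rfl | hx0
    · simp
    rcases eq_or_lt_of_le hx.2 with rfl | hxb
    · simp only [intervalIntegral.integral_same, mul_zero, sub_zero]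
      rw [hC]; field_simp; ring
    have h0 := hweak x ⟨hx0, hxb⟩
    have hdw : ∀ y z, y ∈ Icc 0 b → z ∈ Icc 0 b → y ≤ z →
        IntervalIntegrable (deriv w) volume y z ∧ ∫ t in y..z, deriv w t = w z - w y := by
      intro y z hy hz hyz
      have hm : AbsolutelyContinuousOnInterval w y z := hac.mono (by
        rw [uIcc_of_le hyz, uIcc_of_le hb.le]; exact Icc_subset_Icc hy.1 hz.2)
      exact ⟨hm.intervalIntegrable_deriv, hm.integral_deriv_eq_sub⟩
    obtain ⟨i1, e1⟩ := hdw 0 x ⟨le_rfl, hb.le⟩ hx hx0.le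
    obtain ⟨i2, e2⟩ := hdw x b hx ⟨hb.le, le_rfl⟩ hxb.le
    rw [integral_Icc_eq_integral_Ioc, ← intervalIntegral.integral_of_le hb.le] at h0
    have hd1 : ∀ t ∈ Ioo 0 x, deriv (tent b x) t = 1 - x / b := by
      intro t ht
      have : tent b x =ᶠ[nhds t] fun t => t - x / b * t := by
        filter_upwards [Iio_mem_nhds ht.2] with y hy
        exact tent_of_le hxb.le (le_of_lt hy)
      rw [this.deriv_eq]
      have := ((hasDerivAt_id' t).fun_sub ((hasDerivAt_id' t).const_mul (x / b))).deriv
      simpa using this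
    have hd2 : ∀ t ∈ Ioo x b, deriv (tent b x) t = -(x / b) := by
      intro t ht
      have : tent b x =ᶠ[nhds t] fun t => x - x / b * t := by
        filter_upwards [Ioo_mem_nhds ht.1 ht.2] with y hy
        exact tent_of_mem ⟨hy.1.le, hy.2.le⟩
      rw [this.deriv_eq]
      simp
    have j1 : IntervalIntegrable (fun t => deriv w t * (1 - x / b) + (1 - x / b) * (t * k t))
        volume 0 x := (i1.mul_const _).add ((hmi 0 x).const_mul _)
    have j2 : IntervalIntegrable (fun t => deriv w t * -(x / b) + (x * k t - x / b * (t * k t)))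
        volume x b := (i2.mul_const _).add (((hki x b).const_mul _).sub ((hmi x b).const_mul _))
    have a1 : ∀ᵐ t, t ∈ uIoc 0 x → deriv w t * (1 - x / b) + (1 - x / b) * (t * k t) =
        deriv w t * deriv (tent b x) t + reaction p (w t) * tent b x t := by
      filter_upwards [Measure.ae_ne volume x] with t htx ht
      rw [uIoc_of_le hx0.le] at ht
      rw [hd1 t ⟨ht.1, lt_of_le_of_ne ht.2 htx⟩, tent_of_le hxb.le ht.2,
        hkeq t ⟨ht.1.le, ht.2.trans hxb.le⟩]
      ring
    have a2 : ∀ᵐ t, t ∈ uIoc x b → deriv w t * -(x / b) + (x * k t - x / b * (t * k t)) =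
        deriv w t * deriv (tent b x) t + reaction p (w t) * tent b x t := by
      filter_upwards [Measure.ae_ne volume b] with t htb ht
      rw [uIoc_of_le hxb.le] at ht
      rw [hd2 t ⟨ht.1, lt_of_le_of_ne ht.2 htb⟩, tent_of_mem ⟨ht.1.le, ht.2⟩,
        hkeq t ⟨hx0.le.trans ht.1.le, ht.2⟩]
      ring
    have b1 := intervalIntegral.integral_congr_ae a1
    have b2 := intervalIntegral.integral_congr_ae a2
    rw [← intervalIntegral.integral_add_adjacent_intervals
      (j1.congr_ae ((ae_restrict_iff' measurableSet_uIoc).2 a1))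
      (j2.congr_ae ((ae_restrict_iff' measurableSet_uIoc).2 a2)), ← b1, ← b2,
      intervalIntegral.integral_add (i1.mul_const _) ((hmi 0 x).const_mul _),
      intervalIntegral.integral_add (i2.mul_const _)
        (((hki x b).const_mul _).sub ((hmi x b).const_mul _)),
      intervalIntegral.integral_sub ((hki x b).const_mul _) ((hmi x b).const_mul _)] at h0
    simp only [intervalIntegral.integral_mul_const, intervalIntegral.integral_const_mul] at h0
    rw [e1, e2] at h0
    have hsplit := intervalIntegral.integral_add_adjacent_intervals (hmi 0 x) (hmi x b)
    rw [hC, ← hsplit]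
    field_simp at h0 ⊢
    linarith
  refine ⟨fun x => C - ∫ t in x..b, k t, fun x hx => ?_⟩
  have hR : HasDerivAt (fun x => ∫ t in x..b, k t) (-k x) x :=
    intervalIntegral.integral_hasDerivAt_left (hki x b)
      (hkcont.stronglyMeasurableAtFilter _ _) hkcont.continuousAt
  have hL : HasDerivAt (fun x => ∫ t in (0 : ℝ)..x, t * k t) (x * k x) x :=
    intervalIntegral.integral_hasDerivAt_right (hmi 0 x)
      (hmk.stronglyMeasurableAtFilter _ _) hmk.continuousAt
  constructor
  · have := ((((hasDerivAt_id x).mul_const C).const_add (w 0)).sub hL).sub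
      ((hasDerivAt_id x).mul hR)
    refine (this.hasDerivWithinAt.congr_deriv ?_).congr hform (hform x hx)
    simp only [id]; ring
  · have := (hR.const_sub C).hasDerivWithinAt (s := Icc 0 b)
    exact this.congr_deriv (by rw [neg_neg, hkeq x hx])

/-- The derivatives found on different intervals agree by uniqueness of derivatives within `[0, ∞)`,
so `derivWithin` serves for all of them. -/
theorem isSol_Ici_of_forall_Icc {p : ℝ} {w : ℝ → ℝ}
    (h : ∀ b, 0 < b → ∃ V, IsSol p (Icc 0 b) w V) : ∃ V, IsSol p (Ici 0) w V := by
  have hn : ∀ x b : ℝ, x < b → Icc 0 b ∈ nhdsWithin x (Ici 0) := fun x b hxb => by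
    rw [← Ici_inter_Iic]
    exact Filter.inter_mem self_mem_nhdsWithin (mem_nhdsWithin_of_mem_nhds (Iic_mem_nhds hxb))
  refine ⟨derivWithin w (Ici 0), fun x hx => ?_⟩
  have hx : 0 ≤ x := hx
  obtain ⟨V, hV⟩ := h (x + 1) (by linarith)
  have hy : ∀ y ∈ Icc 0 (x + 1), y < x + 1 → HasDerivWithinAt w (V y) (Ici 0) y :=
    fun y hy hlt => (hV y hy).1.mono_of_mem_nhdsWithin (hn y _ hlt)
  have hVy : ∀ y ∈ Icc 0 (x + 1), y < x + 1 → derivWithin w (Ici 0) y = V y :=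
    fun y hy' hlt => (hy y hy' hlt).derivWithin (uniqueDiffOn_Ici 0 y hy'.1)
  have hxm : x ∈ Icc 0 (x + 1) := ⟨hx, by linarith⟩
  rw [hVy x hxm (by linarith)]
  refine ⟨hy x hxm (by linarith), ?_⟩
  have h2 := (hV x hxm).2.mono_of_mem_nhdsWithin (hn x _ (by linarith))
  refine h2.congr_of_eventuallyEq ?_ (hVy x hxm (by linarith))
  filter_upwards [self_mem_nhdsWithin, mem_nhdsWithin_of_mem_nhds
    (Iio_mem_nhds (by linarith : x < x + 1))] with y hy0 hy1
  exact hVy y ⟨hy0, le_of_lt hy1⟩ hy1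

theorem IsSol.deriv_eq {p : ℝ} {S : Set ℝ} {U V : ℝ → ℝ} (h : IsSol p S U V) {x : ℝ}
    (hx : x ∈ S) (hn : S ∈ nhds x) : deriv U x = V x :=
  ((h x hx).1.hasDerivAt hn).deriv

theorem IsSol.ae_deriv_eq {p : ℝ} {I : Set ℝ} (hI : IsEdgeDomain I) {U V : ℝ → ℝ}
    (h : IsSol p I U V) : ∀ᵐ x ∂volume.restrict I, deriv U x = V x := by
  refine (ae_restrict_iff' hI.measurableSet).2 ?_
  filter_upwards [hI.ae_mem_nhds] with x hx hxI
  exact h.deriv_eq hxI (hx hxI)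

theorem IsSol.memLp_deriv {p : ℝ} {I : Set ℝ} (hI : IsEdgeDomain I) {U V : ℝ → ℝ}
    (h : IsSol p I U V) (hU : MemH1On I U) : MemLp V 2 (volume.restrict I) :=
  (memLp_congr_ae (h.ae_deriv_eq hI)).1 (hU.memLp_deriv hI)

end Regularity

/-! ### Solutions on a half-line -/

section HalfLine

variable {p : ℝ} {U V : ℝ → ℝ}

/-- The derivative `2 U V` of `U ^ 2` is at most `U ^ 2 + V ^ 2`, which is integrable. -/
theorem IsSol.bounded_of_memH1On (h : IsSol p (Ici 0) U V) (hU : MemH1On (Ici 0) U) :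
    ∃ A, ∀ x ∈ Ici (0 : ℝ), |U x| ≤ A := by
  have hV := h.memLp_deriv isEdgeDomain_Ici hU
  have i1 : IntegrableOn (fun x => U x ^ 2 + V x ^ 2) (Ici 0) :=
    hU.1.integrable_sq.add hV.integrable_sq
  set Q := ∫ x in Ici (0 : ℝ), (U x ^ 2 + V x ^ 2)
  refine ⟨1 + (U 0 ^ 2 + Q), fun x hx => ?_⟩
  have hx : 0 ≤ x := hx
  have hsub : Icc 0 x ⊆ Ici (0 : ℝ) := Icc_subset_Ici_self
  have hc : ContinuousOn (fun x => 2 * U x * V x) (Icc 0 x) :=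
    ((continuousOn_const.mul h.continuousOn).mul h.continuousOn_deriv).mono hsub
  have e1 : ∫ t in (0 : ℝ)..x, 2 * U t * V t = U x ^ 2 - U 0 ^ 2 := by
    refine intervalIntegral.integral_eq_sub_of_hasDeriv_right_of_le hx
      (f := fun t => U t ^ 2) ((h.continuousOn.pow 2).mono hsub) (fun t ht => ?_)
      (hc.intervalIntegrable_of_Icc hx)
    have := ((h t ht.1.le).1.fun_pow 2).hasDerivAt (Ici_mem_nhds ht.1)
    simpa using this.hasDerivWithinAt
  have e2 : ∫ t in (0 : ℝ)..x, 2 * U t * V t ≤ ∫ t in (0 : ℝ)..x, (U t ^ 2 + V t ^ 2) := by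
    refine intervalIntegral.integral_mono_on hx (hc.intervalIntegrable_of_Icc hx)
      ((intervalIntegrable_iff_integrableOn_Icc_of_le hx).2 (i1.mono_set hsub)) fun t _ => ?_
    nlinarith [sq_nonneg (U t - V t)]
  have e3 : ∫ t in (0 : ℝ)..x, (U t ^ 2 + V t ^ 2) ≤ Q := by
    rw [intervalIntegral.integral_of_le hx]
    refine setIntegral_mono_set i1 (Filter.Eventually.of_forall fun t => ?_)
      (Ioc_subset_Icc_self.trans hsub).eventuallyLE
    simp only [Pi.zero_apply]; positivity
  nlinarith [sq_abs (U x), sq_nonneg (|U x| - 1), abs_nonneg (U x)]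

theorem integrableOn_abs_rpow (hp : 2 < p) {I : Set ℝ} (hI : MeasurableSet I)
    (hU : MemLp U 2 (volume.restrict I)) (hc : ContinuousOn U I) {A : ℝ}
    (hA : ∀ x ∈ I, |U x| ≤ A) : IntegrableOn (fun x => |U x| ^ p) I := by
  have hc' : ContinuousOn (fun x => |U x| ^ p) I :=
    hc.abs.rpow_const fun _ _ => Or.inr (by linarith)
  refine Integrable.mono' (hU.integrable_sq.const_mul (A ^ (p - 2)))
    (hc'.aestronglyMeasurable hI)
    ((ae_restrict_iff' hI).2 (Filter.Eventually.of_forall fun t ht => ?_))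
  rw [Real.norm_of_nonneg (by positivity)]
  have h1 : |U t| ^ p = |U t| ^ (p - 2) * U t ^ 2 := by
    rw [← sq_abs, ← Real.rpow_natCast, ← Real.rpow_add_of_nonneg (abs_nonneg _) (by linarith)
      (by norm_num)]
    norm_num
  rw [h1]
  have h2 : |U t| ^ (p - 2) ≤ A ^ (p - 2) :=
    Real.rpow_le_rpow (abs_nonneg _) (hA t ht) (by linarith)
  gcongr

/-- The energy is both constant and integrable on a set of infinite measure. -/
theorem IsSol.energy_eq_zero (hp : 2 < p) (h : IsSol p (Ici 0) U V) (hU : MemH1On (Ici 0) U)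
    {x : ℝ} (hx : x ∈ Ici (0 : ℝ)) : energy p (U x) (V x) = 0 := by
  obtain ⟨A, hA⟩ := h.bounded_of_memH1On hU
  have hV := h.memLp_deriv isEdgeDomain_Ici hU
  have i3 : IntegrableOn (fun x => |U x| ^ p / p) (Ici 0) :=
    (integrableOn_abs_rpow hp measurableSet_Ici hU.1 h.continuousOn hA).div_const p
  have hint : IntegrableOn (fun x => energy p (U x) (V x)) (Ici 0) :=
    ((hV.integrable_sq.div_const 2).sub (hU.1.integrable_sq.div_const 2)).add i3
  have hconst : IntegrableOn (fun _ : ℝ => energy p (U x) (V x)) (Ici 0) :=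
    hint.congr_fun (fun y hy => h.energy_eq hp (convex_Ici 0) hy hx) measurableSet_Ici
  rw [integrableOn_const_iff] at hconst
  rcases hconst with h0 | h0
  · simpa using h0
  · simp at h0

theorem IsSol.eqOn_zero (hp : 2 < p) (h : IsSol p (Ici 0) U V) (hU : MemH1On (Ici 0) U)
    (h0 : U 0 = 0) : EqOn U 0 (Ici 0) := by
  have hE := h.energy_eq_zero hp hU self_mem_Ici
  have hV0 : V 0 = 0 := by
    simpa [energy, h0, Real.zero_rpow (by linarith : p ≠ 0)] using hE
  have hz : IsSol p (Ici 0) (0 : ℝ → ℝ) 0 := fun x _ =>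
    ⟨hasDerivWithinAt_const _ _ _, by
      rw [Pi.zero_apply, reaction_zero]; exact hasDerivWithinAt_const x (Ici (0 : ℝ)) (0 : ℝ)⟩
  exact h.eqOn_of_initial hp hz (by simp [h0]) (by simp [hV0])

/-- A square integrable solution on a half-line that starts from a positive value is a piece of the
soliton. -/
theorem IsSol.exists_soliton (hp : 2 < p) (h : IsSol p (Ici 0) U V) (hU : MemH1On (Ici 0) U)
    (h0 : 0 < U 0) : ∃ y, 0 ≤ y ∧ soliton p y = U 0 ∧
      ((V 0 = solitonSlope p y ∧ ∀ x, 0 ≤ x → U x = soliton p (x + y)) ∨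
        (V 0 = -solitonSlope p y ∧ ∀ x, 0 ≤ x → U x = soliton p (x - y))) := by
  obtain ⟨y, hy0, hy, hV⟩ := exists_soliton_of_energy_zero hp h0
    (h.energy_eq_zero hp hU self_mem_Ici)
  refine ⟨y, hy0, hy, hV.imp (fun hV => ⟨hV, fun x hx => ?_⟩) fun hV => ⟨?_, fun x hx => ?_⟩⟩
  · exact h.eqOn_of_initial hp (isSol_soliton hp _ y) (by simp [hy]) (by simp [hV]) hx
  · rw [hV, solitonSlope_neg]
  · exact h.eqOn_of_initial hp (isSol_soliton hp _ (-y)) (by simp [hy, soliton_neg])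
      (by simp [hV]) hx

end HalfLine

/-! ### Bound-states as classical solutions -/

section EdgeIntegrals

variable {p : ℝ} {U V η : ℝ → ℝ}

/-- The integrand of the weak formulation on an edge. -/
noncomputable def weakIntegrand (p : ℝ) (U η : ℝ → ℝ) (x : ℝ) : ℝ :=
  deriv U x * deriv η x + U x * η x - |U x| ^ (p - 2) * U x * η x

theorem weakIntegrand_eq (p : ℝ) (U η : ℝ → ℝ) (x : ℝ) :
    weakIntegrand p U η x = deriv U x * deriv η x + reaction p (U x) * η x := by
  simp only [weakIntegrand, reaction]; ring

theorem IsSol.integral_interval (hp : 2 < p) {I : Set ℝ} (hI : IsEdgeDomain I)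
    (h : IsSol p I U V) (hη : MemH1On I η) {b : ℝ} (hb : b ∈ I) :
    ∫ x in (0 : ℝ)..b, weakIntegrand p U η x = V b * η b - V 0 * η 0 := by
  have hsub := hI.Icc_subset hb
  have hb0 := hI.nonneg hb
  rw [← integral_mul_deriv_add hb0 (fun x hx => (h x (hsub hx)).2.mono hsub)
    ((continuous_reaction hp).comp_continuousOn (h.continuousOn.mono hsub))
    (hη.absolutelyContinuous hI hb)]
  refine intervalIntegral.integral_congr_ae ?_
  filter_upwards [hI.ae_mem_nhds] with x hx hxb
  rw [uIoc_of_le hb0] at hxb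
  have hxI := hsub (Ioc_subset_Icc_self hxb)
  rw [weakIntegrand_eq, h.deriv_eq hxI (hx hxI)]

theorem IsSol.integral_Icc (hp : 2 < p) {a : ℝ} (ha : 0 < a) (h : IsSol p (Icc 0 a) U V)
    (hη : MemH1On (Icc 0 a) η) :
    ∫ x in Icc 0 a, weakIntegrand p U η x = V a * η a - V 0 * η 0 := by
  rw [integral_Icc_eq_integral_Ioc, ← intervalIntegral.integral_of_le ha.le,
    h.integral_interval hp (isEdgeDomain_Icc ha) hη ⟨ha.le, le_rfl⟩]

theorem IsSol.memLp_reaction (hp : 2 < p) (h : IsSol p (Ici 0) U V) (hU : MemH1On (Ici 0) U) :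
    MemLp (fun x => reaction p (U x)) 2 (volume.restrict (Ici 0)) := by
  obtain ⟨A, hA⟩ := h.bounded_of_memH1On hU
  have hA0 : 0 ≤ A := (abs_nonneg _).trans (hA 0 self_mem_Ici)
  refine MemLp.of_le_mul (c := 1 + (p - 1) * A ^ (p - 2)) hU.1
    (((continuous_reaction hp).comp_continuousOn h.continuousOn).aestronglyMeasurable
      measurableSet_Ici)
    ((ae_restrict_iff' measurableSet_Ici).2 (Filter.Eventually.of_forall fun x hx => ?_))
  have := reaction_lipschitz hp (hA x hx) (t := 0) (by simpa using hA0)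
  simpa [reaction_zero] using this

/-- Integration by parts up to `R` leaves the boundary term `V R * η R`, and the point is that it
tends to zero. -/
theorem IsSol.integral_Ici (hp : 2 < p) (h : IsSol p (Ici 0) U V) (hU : MemH1On (Ici 0) U)
    (hη : MemH1On (Ici 0) η) :
    ∫ x in Ici 0, weakIntegrand p U η x = -(V 0 * η 0) := by
  have hI := isEdgeDomain_Ici
  have hint : IntegrableOn (weakIntegrand p U η) (Ici 0) := by
    have h1 : IntegrableOn (fun x => deriv U x * deriv η x) (Ici 0) :=
      MemLp.integrable_mul (hU.memLp_deriv hI) (hη.memLp_deriv hI)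
    have h2 : IntegrableOn (fun x => reaction p (U x) * η x) (Ici 0) :=
      MemLp.integrable_mul (h.memLp_reaction hp hU) hη.1
    exact (h1.add h2).congr_fun (fun x _ => (weakIntegrand_eq p U η x).symm) measurableSet_Ici
  have hVη : IntegrableOn (fun x => V x * η x) (Ici 0) :=
    MemLp.integrable_mul (h.memLp_deriv hI hU) hη.1
  set J := ∫ x in Ici 0, weakIntegrand p U η x with hJ
  have ht : Filter.Tendsto (fun R : ℝ => ∫ x in (0 : ℝ)..R, weakIntegrand p U η x) Filter.atTop
      (nhds J) := by
    rw [hJ, integral_Ici_eq_integral_Ioi]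
    exact intervalIntegral_tendsto_integral_Ioi 0 (hint.mono_set Ioi_subset_Ici_self)
      Filter.tendsto_id
  have ht' : Filter.Tendsto (fun R : ℝ => V R * η R) Filter.atTop (nhds (J + V 0 * η 0)) := by
    refine (ht.add_const (V 0 * η 0)).congr' ?_
    filter_upwards [Filter.eventually_ge_atTop 0] with R hR
    rw [h.integral_interval hp hI hη hR]; ring
  -- The boundary term has a limit. If the limit were nonzero, `V * η` would be bounded away from
  -- zero near infinity and could not be integrable.
  by_contra hne
  have hl : 0 < |J + V 0 * η 0| := abs_pos.2 fun h0 => hne (by linarith)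
  obtain ⟨R, hR⟩ := Filter.eventually_atTop.1
    (ht'.abs.eventually_const_lt (by linarith : |J + V 0 * η 0| / 2 < |J + V 0 * η 0|))
  have hc : IntegrableOn (fun _ : ℝ => |J + V 0 * η 0| / 2) (Ici (max R 0)) := by
    refine Integrable.mono' ((hVη.mono_set (Ici_subset_Ici.2 (le_max_right R 0))).abs)
      aestronglyMeasurable_const
      ((ae_restrict_iff' measurableSet_Ici).2 (Filter.Eventually.of_forall fun x hx => ?_))
    rw [Real.norm_of_nonneg (by positivity)]
    exact (hR x ((le_max_left R 0).trans hx)).le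
  rw [integrableOn_const_iff] at hc
  rcases hc with h0 | h0
  · rw [enorm_eq_zero] at h0; linarith
  · simp at h0

end EdgeIntegrals

variable (G : RegularKnotGraph)

theorem isEdgeDomain_dom (hℓ : 0 < G.ℓ) : ∀ e, IsEdgeDomain (G.dom e)
  | Sum.inl _ => isEdgeDomain_Ici
  | Sum.inr (Sum.inl _) => isEdgeDomain_Icc hℓ
  | Sum.inr (Sum.inr _) => isEdgeDomain_Icc (by linarith)

/-- The sum of the outgoing derivatives at the knot, where `V` is the derivative on each edge. -/
def outflow (V : G.Fn) : ℝ :=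
  ∑ h, V (G.halfLine h) 0 + (∑ i, V (G.pendant i) 0
    + ∑ j, (V (G.loop j) 0 - V (G.loop j) (2 * G.ℓ)))

/-- `u` is a classical solution with derivative `V` that satisfies the Kirchhoff condition at the
knot and the Neumann condition at the tips of the pendants. -/
structure IsClassical (p : ℝ) (u V : G.Fn) : Prop where
  memH1 : G.MemH1 u
  sol : ∀ e, IsSol p (G.dom e) (u e) (V e)
  neumann : ∀ i, V (G.pendant i) G.ℓ = 0
  kirchhoff : G.outflow V = 0

variable {G} {p : ℝ} {u V η : G.Fn}

/-- Only boundary terms survive integration by parts. At the knot they share the factor `c`, and at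
the pendant tips the value of `η` is free; this is how the vertex conditions emerge. -/
theorem sum_weakIntegrand (hp : 2 < p) (hℓ : 0 < G.ℓ) (hu : G.MemH1 u)
    (hs : ∀ e, IsSol p (G.dom e) (u e) (V e)) (hη : G.MemH1 η) {c : ℝ} (hc : ∀ e, η e 0 = c)
    (hc' : ∀ j, η (G.loop j) (2 * G.ℓ) = c) :
    ∑ e, ∫ x in G.dom e, weakIntegrand p (u e) (η e) x =
      ∑ i, V (G.pendant i) G.ℓ * η (G.pendant i) G.ℓ - G.outflow V * c := by
  have h1 : ∀ h, ∫ x in G.dom (G.halfLine h),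
      weakIntegrand p (u (G.halfLine h)) (η (G.halfLine h)) x = -(V (G.halfLine h) 0 * c) :=
    fun h => by
      rw [← hc (G.halfLine h)]
      exact (hs (G.halfLine h)).integral_Ici hp (hu.2 _) (hη.2 _)
  have h2 : ∀ i, ∫ x in G.dom (G.pendant i),
      weakIntegrand p (u (G.pendant i)) (η (G.pendant i)) x =
        V (G.pendant i) G.ℓ * η (G.pendant i) G.ℓ - V (G.pendant i) 0 * c := fun i => by
      rw [← hc (G.pendant i)]
      exact (hs (G.pendant i)).integral_Icc hp hℓ (hη.2 _)
  have h3 : ∀ j, ∫ x in G.dom (G.loop j),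
      weakIntegrand p (u (G.loop j)) (η (G.loop j)) x =
        -((V (G.loop j) 0 - V (G.loop j) (2 * G.ℓ)) * c) := fun j => by
      have := (hs (G.loop j)).integral_Icc hp (by linarith) (hη.2 (G.loop j))
      rw [hc, hc'] at this
      refine Eq.trans this ?_
      ring
  rw [Fintype.sum_sum_type, Fintype.sum_sum_type, Finset.sum_congr rfl fun h _ => h1 h,
    Finset.sum_congr rfl fun i _ => h2 i, Finset.sum_congr rfl fun j _ => h3 j]
  simp only [outflow, Finset.sum_sub_distrib, Finset.sum_neg_distrib, ← Finset.sum_mul]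
  ring

theorem IsClassical.isBoundState (hp : 2 < p) (hℓ : 0 < G.ℓ) (h : G.IsClassical p u V)
    (h0 : ∃ e, ∃ x ∈ G.dom e, u e x ≠ 0) : G.IsBoundState p u := by
  refine ⟨h.memH1, h0, fun η hη => ?_⟩
  obtain ⟨c, hc, hc'⟩ := hη.1
  refine (sum_weakIntegrand hp hℓ h.memH1 h.sol hη hc hc').trans ?_
  simp [h.neumann, h.kirchhoff]

theorem memH1On_zero (I : Set ℝ) : MemH1On I 0 :=
  ⟨MemLp.zero, 0, MemLp.zero, fun x _ => by simp⟩

/-- A test function on one edge that vanishes at the knot extends by zero to the graph. On a loop it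
must vanish at both ends. -/
theorem IsBoundState.weak_edge (hu : G.IsBoundState p u) {e : G.Edge} {w : ℝ → ℝ}
    (hw : MemH1On (G.dom e) w) (h0 : w 0 = 0) (hl : ∀ j, e = G.loop j → w (2 * G.ℓ) = 0) :
    ∫ x in G.dom e, weakIntegrand p (u e) w x = 0 := by
  classical
  have hη : G.MemH1 (Pi.single e w) := by
    refine ⟨⟨0, fun e' => ?_, fun j => ?_⟩, fun e' => ?_⟩
    · rcases eq_or_ne e' e with rfl | hne
      · simpa using h0
      · simp [hne]
    · rcases eq_or_ne (G.loop j) e with rfl | hne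
      · simpa using hl j rfl
      · rw [Pi.single_eq_of_ne hne, Pi.zero_apply]
    · rcases eq_or_ne e' e with rfl | hne
      · simpa using hw
      · rw [Pi.single_eq_of_ne hne]; exact memH1On_zero _
  have h := hu.2.2 _ hη
  rw [Finset.sum_eq_single e] at h
  · rw [Pi.single_eq_same] at h
    exact h
  · intro e' _ hne
    rw [Pi.single_eq_of_ne hne]
    simp
  · simp

theorem setIntegral_weakIntegrand_tent {b x : ℝ} (hb : 0 < b) (hxb : x ≤ b) (w : ℝ → ℝ) :
    ∫ t in Ici 0, weakIntegrand p w (tent b x) t =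
      ∫ t in Icc 0 b, weakIntegrand p w (tent b x) t := by
  refine setIntegral_eq_of_subset_of_forall_sdiff_eq_zero measurableSet_Ici
    Icc_subset_Ici_self fun t ht => ?_
  have hbt : b < t := by
    by_contra hle
    exact ht.2 ⟨ht.1, not_lt.1 hle⟩
  have h1 : tent b x =ᶠ[nhds t] fun _ => 0 := by
    filter_upwards [Ioi_mem_nhds hbt] with y hy
    exact tent_of_ge hb hxb (le_of_lt hy)
  simp [weakIntegrand, h1.deriv_eq, tent_of_ge hb hxb hbt.le]

theorem IsBoundState.exists_isSol (hp : 2 < p) (hℓ : 0 < G.ℓ) (hu : G.IsBoundState p u)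
    (e : G.Edge) : ∃ V, IsSol p (G.dom e) (u e) V := by
  have hI := G.isEdgeDomain_dom hℓ
  have htent : ∀ b x, 0 < b → x ∈ Ioo 0 b → ∀ e, (∀ t ∈ G.dom e, b < t → tent b x t = 0) →
      MemH1On (G.dom e) (tent b x) := fun b x hb hx e h => by
    obtain ⟨K, hK⟩ := exists_lipschitzWith_tent b x
    exact memH1On_of_lipschitz (hI e) hK b h
  have hcomp : ∀ a, 0 < a → G.dom e = Icc 0 a → (∀ j, e = G.loop j → a = 2 * G.ℓ) →
      ∃ V, IsSol p (G.dom e) (u e) V := by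
    intro a ha hdom hl
    have hw := hu.1.2 e
    rw [hdom] at hw ⊢
    refine isSol_of_weak_Icc hp ha hw fun x hx => ?_
    have := hu.weak_edge (e := e) (w := tent a x) (htent a x ha hx e fun t ht hat => by
      rw [hdom] at ht; exact absurd ht.2 (not_le.2 hat)) (tent_zero hx.1.le ha.le)
      fun j hj => tent_of_ge ha hx.2.le (hl j hj).le
    rw [hdom] at this
    simpa only [weakIntegrand_eq] using this
  match e with
  | Sum.inl h =>
    refine isSol_Ici_of_forall_Icc fun b hb => ?_
    have hw : MemH1On (Ici 0) (u (Sum.inl h)) := hu.1.2 (Sum.inl h)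
    refine isSol_of_weak_Icc hp hb (hw.mono isEdgeDomain_Ici (mem_Ici.2 hb.le)) fun x hx => ?_
    have := hu.weak_edge (e := Sum.inl h) (w := tent b x)
      (htent b x hb hx _ fun t _ hbt => tent_of_ge hb hx.2.le hbt.le)
      (tent_zero hx.1.le hb.le) (fun j hj => by simp at hj)
    have h2 := (setIntegral_weakIntegrand_tent hb hx.2.le _).symm.trans this
    simpa only [weakIntegrand_eq] using h2
  | Sum.inr (Sum.inl i) => exact hcomp G.ℓ hℓ rfl fun j hj => by simp at hj
  | Sum.inr (Sum.inr j) => exact hcomp (2 * G.ℓ) (by linarith) rfl fun _ _ => rfl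

theorem IsBoundState.exists_isClassical (hp : 2 < p) (hℓ : 0 < G.ℓ) (hu : G.IsBoundState p u) :
    ∃ V, G.IsClassical p u V := by
  choose V hV using hu.exists_isSol hp hℓ
  have hN : ∀ i, V (G.pendant i) G.ℓ = 0 := by
    intro i
    -- The function `x` vanishes at the knot but not at the tip, so testing with it isolates the
    -- Neumann condition.
    have hw : MemH1On (G.dom (G.pendant i)) id :=
      memH1On_of_lipschitz (isEdgeDomain_Icc hℓ) LipschitzWith.id G.ℓ
        fun t ht hlt => absurd ht.2 (not_le.2 hlt)
    have h1 := hu.weak_edge hw rfl fun j hj => by simp at hj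
    have h2 := ((hV (G.pendant i)).integral_Icc hp hℓ hw).symm.trans h1
    simpa [hℓ.ne'] using h2
  refine ⟨V, hu.1, hV, hN, ?_⟩
  -- Equal to `1` on the core and cut off on the half-lines, which isolates the Kirchhoff condition.
  let η : G.Fn := Sum.elim (fun _ t => max (1 - t) 0) fun _ _ => 1
  have hη : G.MemH1 η := by
    refine ⟨⟨1, ?_, fun j => rfl⟩, ?_⟩
    · rintro (h | κ)
      · simp [η]
      · rfl
    · rintro (h | i | j)
      · have : LipschitzWith 1 (fun t : ℝ => max (1 - t) 0) := by
          have h1 : LipschitzWith 1 (fun t : ℝ => 1 - t) := by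
            refine LipschitzWith.of_dist_le_mul fun s t => ?_
            rw [Real.dist_eq, Real.dist_eq, ← abs_neg]
            simp
          exact h1.max_const 0
        exact memH1On_of_lipschitz isEdgeDomain_Ici this 1
          fun t _ ht => max_eq_right (by linarith)
      · exact memH1On_of_lipschitz (isEdgeDomain_Icc hℓ) (LipschitzWith.const 1) G.ℓ
          fun t ht hlt => absurd ht.2 (not_le.2 hlt)
      · exact memH1On_of_lipschitz (isEdgeDomain_Icc (by linarith : 0 < 2 * G.ℓ))
          (LipschitzWith.const 1) (2 * G.ℓ) fun t ht hlt => absurd ht.2 (not_le.2 hlt)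
  have h1 := sum_weakIntegrand hp hℓ hu.1 hV hη (c := 1)
    (by rintro (h | κ)
        · simp [η]
        · rfl) fun j => rfl
  have h2 : ∑ e, ∫ x in G.dom e, weakIntegrand p (u e) (η e) x = 0 := hu.2.2 η hη
  rw [h2] at h1
  simp only [hN, zero_mul, Finset.sum_const_zero, mul_one, zero_sub] at h1
  linarith

/-! ### Solutions on a short interval -/

/-- A Lipschitz constant of the reaction term on `[-A, A]`. -/
noncomputable def lipConst (p A : ℝ) : ℝ := 1 + (p - 1) * A ^ (p - 2)

theorem one_le_lipConst {p A : ℝ} (hp : 2 < p) (hA : 0 ≤ A) : 1 ≤ lipConst p A := by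
  have : 0 ≤ (p - 1) * A ^ (p - 2) := mul_nonneg (by linarith) (by positivity)
  simp only [lipConst]; linarith

theorem isSol_zero (p : ℝ) (S : Set ℝ) : IsSol p S (fun _ => 0) (fun _ => 0) := fun x _ =>
  ⟨hasDerivWithinAt_const _ _ _, by
    simp only [reaction_zero]; exact hasDerivWithinAt_const _ _ _⟩

theorem isSol_one (p : ℝ) (S : Set ℝ) : IsSol p S (fun _ => 1) (fun _ => 0) := fun x _ =>
  ⟨hasDerivWithinAt_const _ _ _, by
    simp only [reaction_one]; exact hasDerivWithinAt_const _ _ _⟩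

/-- Once `|u| ^ (p - 2) ≥ p`, the term `|u| ^ p / p` dominates `u ^ 2`, so the energy is at least `u
^ 2 / 2`. -/
theorem exists_bound_of_energy_le {p : ℝ} (hp : 2 < p) (E : ℝ) :
    ∃ A, ∀ u v, energy p u v ≤ E → |u| ≤ A := by
  have hp0 : 0 < p := by linarith
  refine ⟨max (p ^ (1 / (p - 2))) (1 + 2 * |E|), fun u v h => ?_⟩
  by_contra hlt
  rw [not_le, max_lt_iff] at hlt
  obtain ⟨h1, h2⟩ := hlt
  have h3 : p ≤ |u| ^ (p - 2) := by
    have := Real.rpow_le_rpow (by positivity) h1.le (by linarith : 0 ≤ p - 2)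
    rwa [← Real.rpow_mul hp0.le, one_div_mul_cancel (by linarith), Real.rpow_one] at this
  have h4 : |u| ^ p = |u| ^ (p - 2) * |u| ^ 2 := by
    rw [← Real.rpow_natCast, ← Real.rpow_add_of_nonneg (abs_nonneg _) (by linarith) (by norm_num)]
    norm_num
  have h5 : |u| ^ 2 ≤ |u| ^ p / p := by
    rw [le_div_iff₀ hp0, h4]
    nlinarith [sq_nonneg |u|]
  rw [energy, ← sq_abs u] at h
  have h6 := le_abs_self E
  nlinarith [sq_nonneg v, abs_nonneg E]

namespace IsSol

variable {p a A : ℝ} {U V U' V' : ℝ → ℝ}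

theorem sub_close (hp : 2 < p) (ha : a ^ 2 * lipConst p A ≤ 1 / 3) (h : IsSol p (Icc 0 a) U V)
    (h' : IsSol p (Icc 0 a) U' V') (hA : ∀ x ∈ Icc 0 a, |U x| ≤ A)
    (hA' : ∀ x ∈ Icc 0 a, |U' x| ≤ A) {x₀ x₁ : ℝ} (hx₀ : x₀ ∈ Icc 0 a) (h₀ : V x₀ = V' x₀)
    (hx₁ : x₁ ∈ Icc 0 a) {x : ℝ} (hx : x ∈ Icc 0 a) :
    |U x - U' x - (U x₁ - U' x₁)| ≤ |U x₁ - U' x₁| / 2 ∧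
      |V x - V' x| ≤ a * lipConst p A * (3 / 2 * |U x₁ - U' x₁|) := by
  have hA0 : 0 ≤ A := (abs_nonneg _).trans (hA x hx)
  have hK := one_le_lipConst hp hA0
  exact abs_sub_le_of_short (d := fun x => U x - U' x) (e := fun x => V x - V' x)
    (by linarith) ha (fun y hy => (h y hy).1.sub (h' y hy).1)
    (fun y hy => (h y hy).2.sub (h' y hy).2)
    (fun y hy => reaction_lipschitz hp (hA y hy) (hA' y hy)) hx₀ (sub_eq_zero.2 h₀) hx₁ hx

/-- Mixed data, a slope at `x₀` and a value at `x₁`, determine the solution. This replaces the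
initial value problem on the compact edges. -/
theorem eqOn_of_short (hp : 2 < p) (ha : a ^ 2 * lipConst p A ≤ 1 / 3) (h : IsSol p (Icc 0 a) U V)
    (h' : IsSol p (Icc 0 a) U' V') (hA : ∀ x ∈ Icc 0 a, |U x| ≤ A)
    (hA' : ∀ x ∈ Icc 0 a, |U' x| ≤ A) {x₀ x₁ : ℝ} (hx₀ : x₀ ∈ Icc 0 a) (h₀ : V x₀ = V' x₀)
    (hx₁ : x₁ ∈ Icc 0 a) (h₁ : U x₁ = U' x₁) :
    EqOn U U' (Icc 0 a) ∧ EqOn V V' (Icc 0 a) := by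
  constructor <;> intro x hx
  · have := (h.sub_close hp ha h' hA hA' hx₀ h₀ hx₁ hx).1
    simp only [h₁, sub_self, sub_zero, abs_zero, zero_div, abs_nonpos_iff] at this
    exact sub_eq_zero.1 this
  · have := (h.sub_close hp ha h' hA hA' hx₀ h₀ hx₁ hx).2
    simp only [h₁, sub_self, abs_zero, mul_zero, abs_nonpos_iff] at this
    exact sub_eq_zero.1 this

theorem lt_of_short (hp : 2 < p) (ha : a ^ 2 * lipConst p A ≤ 1 / 3) (h : IsSol p (Icc 0 a) U V)
    (h' : IsSol p (Icc 0 a) U' V') (hA : ∀ x ∈ Icc 0 a, |U x| ≤ A)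
    (hA' : ∀ x ∈ Icc 0 a, |U' x| ≤ A) {x₀ x₁ : ℝ} (hx₀ : x₀ ∈ Icc 0 a) (h₀ : V x₀ = V' x₀)
    (hx₁ : x₁ ∈ Icc 0 a) (h₁ : U x₁ < U' x₁) {x : ℝ} (hx : x ∈ Icc 0 a) : U x < U' x := by
  have := (h.sub_close hp ha h' hA hA' hx₀ h₀ hx₁ hx).1
  rw [abs_of_neg (sub_neg.2 h₁)] at this
  have := (abs_le.1 this).2
  linarith

/-- On a short interval, a solution with a critical point has the sign of its initial value. -/
theorem pos_of_short (hp : 2 < p) (ha : a ^ 2 * lipConst p A ≤ 1 / 3) (h : IsSol p (Icc 0 a) U V)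
    (hA : ∀ x ∈ Icc 0 a, |U x| ≤ A) {x₀ : ℝ} (hx₀ : x₀ ∈ Icc 0 a) (h₀ : V x₀ = 0) (h0 : 0 < U 0)
    {x : ℝ} (hx : x ∈ Icc 0 a) : 0 < U x := by
  have hA0 : 0 ≤ A := (abs_nonneg _).trans (hA x hx)
  exact (isSol_zero p _).lt_of_short hp ha h (fun _ _ => by simpa using hA0) hA hx₀ h₀.symm
    ⟨le_rfl, hx.1.trans hx.2⟩ h0 hx

theorem eq_zero_of_short (hp : 2 < p) (ha : a ^ 2 * lipConst p A ≤ 1 / 3)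
    (h : IsSol p (Icc 0 a) U V) (hA : ∀ x ∈ Icc 0 a, |U x| ≤ A) {x₀ : ℝ} (hx₀ : x₀ ∈ Icc 0 a)
    (h₀ : V x₀ = 0) (h0 : U 0 = 0) {x : ℝ} (hx : x ∈ Icc 0 a) : U x = 0 := by
  have hA0 : 0 ≤ A := (abs_nonneg _).trans (hA x hx)
  exact (h.eqOn_of_short hp ha (isSol_zero p _) hA (fun _ _ => by simpa using hA0) hx₀ h₀
    ⟨le_rfl, hx.1.trans hx.2⟩ h0).1 hx

/-- On a short interval, a solution that takes the same value at both ends is symmetric. -/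
theorem symm_of_short (hp : 2 < p) (ha0 : 0 < a) (ha : a ^ 2 * lipConst p A ≤ 1 / 3)
    (h : IsSol p (Icc 0 a) U V) (hA : ∀ x ∈ Icc 0 a, |U x| ≤ A) (h0 : U 0 = U a) {x : ℝ}
    (hx : x ∈ Icc 0 a) : U (a - x) = U x ∧ V (a - x) = -V x := by
  -- The difference between the solution and its reflection vanishes at both ends. Rolle's theorem
  -- gives a point of equal slopes, and uniqueness for mixed data finishes the argument.
  obtain ⟨z, hz, hzV⟩ := exists_hasDerivAt_eq_zero (f := fun x => U (a - x) - U x)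
    (f' := fun x => -V (a - x) - V x) ha0
    (h.reflect.continuousOn.sub h.continuousOn) (by simp [h0])
    (fun x hx => ((h.reflect x ⟨hx.1.le, hx.2.le⟩).1.sub
      (h x ⟨hx.1.le, hx.2.le⟩).1).hasDerivAt (Icc_mem_nhds hx.1 hx.2))
  have := h.reflect.eqOn_of_short hp ha h
    (fun x hx => hA _ ⟨by linarith [hx.2], by linarith [hx.1]⟩) hA (x₀ := z)
    ⟨hz.1.le, hz.2.le⟩ (sub_eq_zero.1 hzV) (x₁ := 0) ⟨le_rfl, ha0.le⟩ (by simp [h0])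
  exact ⟨this.1 hx, by rw [← this.2 hx, neg_neg]⟩

/-- A nonnegative solution with a critical point does not start too steeply downwards. -/
theorem neg_le_slope (h : IsSol p (Icc 0 a) U V) (hU : ∀ x ∈ Icc 0 a, 0 ≤ U x) {x₀ : ℝ}
    (hx₀ : x₀ ∈ Icc 0 a) (h₀ : V x₀ = 0) : -U 0 ≤ V 0 := by
  have h0 : (0 : ℝ) ∈ Icc 0 a := ⟨le_rfl, hx₀.1.trans hx₀.2⟩
  -- The factor `exp (-x)` cancels `V`, leaving `reaction p U - U`, which is nonpositive for
  -- nonnegative `U`. At the critical point the product is nonnegative.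
  have hd : ∀ x ∈ Icc 0 a, HasDerivWithinAt (fun x => (V x + U x) * Real.exp (-x))
      ((reaction p (U x) - U x) * Real.exp (-x)) (Icc 0 a) x := fun x hx => by
    have he : HasDerivWithinAt (fun x => Real.exp (-x)) (-Real.exp (-x)) (Icc 0 a) x := by
      simpa using ((hasDerivAt_id x).neg.exp).hasDerivWithinAt (s := Icc 0 a)
    refine (((h x hx).2.add (h x hx).1).mul he).congr_deriv ?_
    simp only [Pi.add_apply]
    ring
  have hanti : AntitoneOn (fun x => (V x + U x) * Real.exp (-x)) (Icc 0 a) := by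
    refine antitoneOn_of_hasDerivWithinAt_nonpos (convex_Icc 0 a)
      (fun x hx => (hd x hx).continuousWithinAt)
      (fun x hx => (hd x (interior_subset hx)).mono interior_subset) fun x hx => ?_
    have := reaction_le_self (p := p) (hU x (interior_subset hx))
    exact mul_nonpos_of_nonpos_of_nonneg (by linarith) (Real.exp_pos _).le
  have h1 := hanti h0 hx₀ hx₀.1
  simp only [h₀, zero_add, neg_zero, Real.exp_zero, mul_one] at h1
  have h2 := mul_nonneg (hU x₀ hx₀) (Real.exp_pos (-x₀)).le
  linarith

theorem strictAntiOn_slope (h : IsSol p (Icc 0 a) U V)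
    (hneg : ∀ x ∈ Icc 0 a, reaction p (U x) < 0) : StrictAntiOn V (Icc 0 a) :=
  strictAntiOn_of_hasDerivWithinAt_neg (convex_Icc 0 a) h.continuousOn_deriv
    (fun x hx => ((h x (interior_subset hx)).2.mono interior_subset))
    fun x hx => hneg x (interior_subset hx)

/-! #### Solutions with a Neumann condition at the right end -/

theorem neumann_eq_one (hp : 2 < p) (hA1 : 1 ≤ A) (ha0 : 0 < a)
    (ha : a ^ 2 * lipConst p A ≤ 1 / 3) (h : IsSol p (Icc 0 a) U V)
    (hA : ∀ x ∈ Icc 0 a, |U x| ≤ A) (hN : V a = 0) (h0 : U 0 = 1) {x : ℝ} (hx : x ∈ Icc 0 a) :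
    U x = 1 ∧ V x = 0 := by
  have := h.eqOn_of_short hp ha (isSol_one p _) hA (fun _ _ => by simpa using hA1)
    (x₀ := a) ⟨ha0.le, le_rfl⟩ hN (x₁ := 0) ⟨le_rfl, ha0.le⟩ h0
  exact ⟨this.1 hx, this.2 hx⟩

theorem one_lt_of_neumann (hp : 2 < p) (hA1 : 1 ≤ A) (ha0 : 0 < a)
    (ha : a ^ 2 * lipConst p A ≤ 1 / 3) (h : IsSol p (Icc 0 a) U V)
    (hA : ∀ x ∈ Icc 0 a, |U x| ≤ A) (hN : V a = 0) (h0 : 1 < U 0) {x : ℝ} (hx : x ∈ Icc 0 a) :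
    1 < U x :=
  (isSol_one p _).lt_of_short hp ha h (fun _ _ => by simpa using hA1) hA
    (x₀ := a) ⟨ha0.le, le_rfl⟩ hN.symm (x₁ := 0) ⟨le_rfl, ha0.le⟩ h0 hx

theorem neumann_slope_pos (hp : 2 < p) (hA1 : 1 ≤ A) (ha0 : 0 < a)
    (ha : a ^ 2 * lipConst p A ≤ 1 / 3) (h : IsSol p (Icc 0 a) U V)
    (hA : ∀ x ∈ Icc 0 a, |U x| ≤ A) (hN : V a = 0) (h0 : 1 < U 0) {x : ℝ} (hx : x ∈ Ico 0 a) :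
    0 < V x := by
  have hanti := h.strictAntiOn_slope fun y hy =>
    reaction_neg_of_one_lt hp (h.one_lt_of_neumann hp hA1 ha0 ha hA hN h0 hy)
  rw [← hN]
  exact hanti ⟨hx.1, hx.2.le⟩ ⟨ha0.le, le_rfl⟩ hx.2

theorem neumann_strictMonoOn (hp : 2 < p) (hA1 : 1 ≤ A) (ha0 : 0 < a)
    (ha : a ^ 2 * lipConst p A ≤ 1 / 3) (h : IsSol p (Icc 0 a) U V)
    (hA : ∀ x ∈ Icc 0 a, |U x| ≤ A) (hN : V a = 0) (h0 : 1 < U 0) : StrictMonoOn U (Icc 0 a) :=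
  strictMonoOn_of_hasDerivWithinAt_pos (convex_Icc 0 a) h.continuousOn
    (fun x hx => ((h x (interior_subset hx)).1.mono interior_subset)) fun x hx => by
      rw [interior_Icc] at hx
      exact h.neumann_slope_pos hp hA1 ha0 ha hA hN h0 ⟨hx.1.le, hx.2⟩

theorem neumann_slope_neg (hp : 2 < p) (hA1 : 1 ≤ A) (ha0 : 0 < a)
    (ha : a ^ 2 * lipConst p A ≤ 1 / 3) (h : IsSol p (Icc 0 a) U V)
    (hA : ∀ x ∈ Icc 0 a, |U x| ≤ A) (hN : V a = 0) (hpos : 0 < U 0) (h0 : U 0 < 1) : V 0 < 0 := by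
  have hlt : ∀ x ∈ Icc 0 a, U x < 1 := fun x hx =>
    h.lt_of_short hp ha (isSol_one p _) hA (fun _ _ => by simpa using hA1)
      (x₀ := a) ⟨ha0.le, le_rfl⟩ hN (x₁ := 0) ⟨le_rfl, ha0.le⟩ h0 hx
  have hgt : ∀ x ∈ Icc 0 a, 0 < U x := fun x hx =>
    h.pos_of_short hp ha hA ⟨ha0.le, le_rfl⟩ hN hpos hx
  have hmono : StrictMonoOn V (Icc 0 a) :=
    strictMonoOn_of_hasDerivWithinAt_pos (convex_Icc 0 a) h.continuousOn_deriv
      (fun x hx => ((h x (interior_subset hx)).2.mono interior_subset))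
      fun x hx => reaction_pos hp (hgt x (interior_subset hx)) (hlt x (interior_subset hx))
  have := hmono ⟨le_rfl, ha0.le⟩ ⟨ha0.le, le_rfl⟩ ha0
  rwa [hN] at this

/-- The initial slope increases with the initial value, above the constant solution. -/
theorem neumann_slope_lt (hp : 2 < p) (hA1 : 1 ≤ A) (ha0 : 0 < a)
    (ha : a ^ 2 * lipConst p A ≤ 1 / 3) (h : IsSol p (Icc 0 a) U V)
    (h' : IsSol p (Icc 0 a) U' V') (hA : ∀ x ∈ Icc 0 a, |U x| ≤ A)
    (hA' : ∀ x ∈ Icc 0 a, |U' x| ≤ A) (hN : V a = 0) (hN' : V' a = 0) (h0 : 1 < U 0)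
    (hlt : U 0 < U' 0) : V 0 < V' 0 := by
  have hm : a ∈ Icc 0 a := ⟨ha0.le, le_rfl⟩
  have hm0 : (0 : ℝ) ∈ Icc 0 a := ⟨le_rfl, ha0.le⟩
  -- Both solutions stay ordered and above `1`, where the reaction term decreases. The gap between
  -- the slopes therefore shrinks strictly to its value `0` at the Neumann end.
  have hanti : StrictAntiOn (fun x => V' x - V x) (Icc 0 a) :=
    strictAntiOn_of_hasDerivWithinAt_neg (convex_Icc 0 a)
      (h'.continuousOn_deriv.sub h.continuousOn_deriv)
      (fun x hx => ((h' x (interior_subset hx)).2.sub (h x (interior_subset hx)).2).mono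
        interior_subset) fun x hx => by
        have hx := interior_subset hx
        have h1 := h.one_lt_of_neumann hp hA1 ha0 ha hA hN h0 hx
        have h2 := h.lt_of_short hp ha h' hA hA' hm (hN.trans hN'.symm) hm0 hlt hx
        exact sub_neg.2 (reaction_strictAntiOn hp h1.le (h1.trans h2).le h2)
  have := hanti hm0 hm ha0
  simp only [hN, hN'] at this
  linarith

end IsSol

/-! ### Existence of solutions with a prescribed value and a critical point -/

section Profile

/-- The reaction term, frozen outside of `[-A, A]`. -/
noncomputable def truncReaction (p A t : ℝ) : ℝ := reaction p (max (-A) (min t A))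

variable {p A : ℝ}

theorem abs_trunc_le (hA : 0 ≤ A) (t : ℝ) : |max (-A) (min t A)| ≤ A :=
  abs_le.2 ⟨le_max_left _ _, max_le (by linarith) (min_le_right _ _)⟩

theorem truncReaction_of_abs_le {t : ℝ} (ht : |t| ≤ A) : truncReaction p A t = reaction p t := by
  rw [truncReaction, min_eq_left (abs_le.1 ht).2, max_eq_right (abs_le.1 ht).1]

theorem truncReaction_lipschitz (hp : 2 < p) (hA : 0 ≤ A) (s t : ℝ) :
    |truncReaction p A s - truncReaction p A t| ≤ lipConst p A * |s - t| := by
  refine (reaction_lipschitz hp (abs_trunc_le hA s) (abs_trunc_le hA t)).trans ?_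
  refine mul_le_mul_of_nonneg_left ?_ (zero_le_one.trans (one_le_lipConst hp hA))
  have h1 := abs_max_sub_max_le_max (-A) (min s A) (-A) (min t A)
  have h2 := abs_min_sub_min_le_max s A t A
  simp only [sub_self, abs_zero, abs_nonneg, sup_of_le_left, sup_of_le_right] at h1 h2
  exact h1.trans h2

theorem abs_truncReaction_le (hp : 2 < p) (hA : 0 ≤ A) (t : ℝ) :
    |truncReaction p A t| ≤ lipConst p A * A := by
  have := reaction_lipschitz hp (abs_trunc_le hA t) (t := 0) (by simpa using hA)
  rw [reaction_zero, sub_zero, sub_zero] at this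
  exact this.trans (mul_le_mul_of_nonneg_left (abs_trunc_le hA t)
    (zero_le_one.trans (one_le_lipConst hp hA)))

theorem continuous_truncReaction (hp : 2 < p) (A : ℝ) : Continuous (truncReaction p A) :=
  (continuous_reaction hp).comp (continuous_const.max (continuous_id.min continuous_const))

theorem abs_integral_le_of_mem_Icc {b C y x : ℝ} {f : ℝ → ℝ} (hC : 0 ≤ C) (hy : y ∈ Icc 0 b)
    (hx : x ∈ Icc 0 b) (hf : ∀ t ∈ Icc 0 b, |f t| ≤ C) : |∫ t in y..x, f t| ≤ b * C := by
  have h1 := intervalIntegral.norm_integral_le_of_norm_le_const (a := y) (b := x) (f := f) (C := C)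
    fun t ht => hf t ((uIoc_subset_uIcc.trans (uIcc_subset_Icc hy hx)) ht)
  have h2 : |x - y| ≤ b := abs_le.2 ⟨by linarith [hx.1, hy.2], by linarith [hx.2, hy.1]⟩
  rw [Real.norm_eq_abs] at h1
  rw [mul_comm]
  exact h1.trans (mul_le_mul_of_nonneg_left h2 hC)

/-- Prescribing `U 0` and `V a` gives a fixed-point equation with two successive integrations, from
`a` for the slope and from `0` for the value. The first smallness condition makes it a contraction.
-/
theorem exists_profile (hp : 2 < p) {a b c : ℝ} (hab : a ∈ Icc 0 b)
    (hshort : b ^ 2 * lipConst p A ≤ 1 / 3) (hshort' : b ^ 2 * (lipConst p A * A) ≤ 1)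
    (hc : 0 ≤ c) (hcA : c + 1 ≤ A) :
    ∃ U V, IsSol p (Icc 0 b) U V ∧ U 0 = c ∧ V a = 0 ∧ ∀ x ∈ Icc 0 b, |U x| ≤ A := by
  have hA : 0 ≤ A := by linarith
  have hK := one_le_lipConst hp hA
  have hb : 0 ≤ b := hab.1.trans hab.2
  have h0 : (0 : ℝ) ∈ Icc 0 b := ⟨le_rfl, hb⟩
  let F : C(Icc (0 : ℝ) b, ℝ) → ℝ → ℝ := fun u t => truncReaction p A (IccExtend hb u t)
  have hF : ∀ u, Continuous (F u) := fun u =>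
    (continuous_truncReaction hp A).comp u.continuous.Icc_extend'
  let V : C(Icc (0 : ℝ) b, ℝ) → ℝ → ℝ := fun u x => ∫ t in a..x, F u t
  have hV : ∀ u x, HasDerivAt (V u) (F u x) x := fun u x =>
    intervalIntegral.integral_hasDerivAt_right ((hF u).intervalIntegrable _ _)
      ((hF u).stronglyMeasurableAtFilter _ _) (hF u).continuousAt
  have hVc : ∀ u, Continuous (V u) := fun u =>
    continuous_iff_continuousAt.2 fun x => (hV u x).continuousAt
  let W : C(Icc (0 : ℝ) b, ℝ) → ℝ → ℝ := fun u x => c + ∫ t in (0 : ℝ)..x, V u t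
  have hW : ∀ u x, HasDerivAt (W u) (V u x) x := fun u x =>
    (intervalIntegral.integral_hasDerivAt_right ((hVc u).intervalIntegrable _ _)
      ((hVc u).stronglyMeasurableAtFilter _ _) (hVc u).continuousAt).const_add c
  have hWc : ∀ u, Continuous (W u) := fun u =>
    continuous_iff_continuousAt.2 fun x => (hW u x).continuousAt
  let T : C(Icc (0 : ℝ) b, ℝ) → C(Icc (0 : ℝ) b, ℝ) := fun u =>
    ⟨fun x => W u x, (hWc u).comp continuous_subtype_val⟩
  have hT : ContractingWith (1 / 3) T := by
    refine ⟨by rw [← NNReal.coe_lt_coe]; norm_num, LipschitzWith.of_dist_le_mul fun u v => ?_⟩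
    have hd : 0 ≤ dist u v := dist_nonneg
    have e1 : ∀ t ∈ Icc 0 b, |F u t - F v t| ≤ lipConst p A * dist u v := fun t ht => by
      refine (truncReaction_lipschitz hp hA _ _).trans
        (mul_le_mul_of_nonneg_left ?_ (by linarith))
      rw [IccExtend_of_mem _ _ ht, IccExtend_of_mem _ _ ht]
      exact ContinuousMap.dist_apply_le_dist (f := u) (g := v) ⟨t, ht⟩
    have e2 : ∀ x ∈ Icc 0 b, |V u x - V v x| ≤ b * (lipConst p A * dist u v) := fun x hx => by
      simp only [V]
      rw [← intervalIntegral.integral_sub ((hF u).intervalIntegrable _ _)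
        ((hF v).intervalIntegrable _ _)]
      exact abs_integral_le_of_mem_Icc (by positivity) hab hx e1
    have e3 : ∀ x ∈ Icc 0 b, |W u x - W v x| ≤ b * (b * (lipConst p A * dist u v)) :=
      fun x hx => by
      simp only [W]
      rw [add_sub_add_left_eq_sub, ← intervalIntegral.integral_sub
        ((hVc u).intervalIntegrable _ _) ((hVc v).intervalIntegrable _ _)]
      exact abs_integral_le_of_mem_Icc (by positivity) h0 hx e2
    rw [ContinuousMap.dist_le (by positivity)]
    intro x
    refine (e3 x x.2).trans ?_
    calc b * (b * (lipConst p A * dist u v)) = b ^ 2 * lipConst p A * dist u v := by ring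
      _ ≤ 1 / 3 * dist u v := mul_le_mul_of_nonneg_right hshort hd
      _ = _ := by norm_num
  set u := ContractingWith.fixedPoint T hT with hu
  have hfix : T u = u := hT.fixedPoint_isFixedPt
  have hWu : ∀ x ∈ Icc 0 b, IccExtend hb u x = W u x := fun x hx => by
    rw [IccExtend_of_mem _ _ hx]
    exact (DFunLike.congr_fun hfix ⟨x, hx⟩).symm
  have hV1 : ∀ x ∈ Icc 0 b, |V u x| ≤ b * (lipConst p A * A) := fun x hx =>
    abs_integral_le_of_mem_Icc (by positivity) hab hx fun t _ => abs_truncReaction_le hp hA _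
  -- The solution stays within `1` of `c`, and `c + 1 ≤ A`, so the truncation is never active.
  have hW1 : ∀ x ∈ Icc 0 b, |W u x| ≤ A := fun x hx => by
    have := abs_integral_le_of_mem_Icc (by positivity) h0 hx hV1
    have h1 : b * (b * (lipConst p A * A)) = b ^ 2 * (lipConst p A * A) := by ring
    have h2 := abs_le.1 (this.trans (h1.trans_le hshort'))
    refine abs_le.2 ⟨?_, ?_⟩ <;> simp only [W] <;> linarith [h2.1, h2.2]
  refine ⟨W u, V u, fun x hx => ⟨(hW u x).hasDerivWithinAt, ?_⟩, by simp [W], by simp [V], hW1⟩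
  refine (hV u x).hasDerivWithinAt.congr_deriv ?_
  simp only [F]
  rw [hWu x hx, truncReaction_of_abs_le (hW1 x hx)]

end Profile

/-! ### The compact core of a bound-state -/

section Core

variable (G : RegularKnotGraph)

/-- The derivative along the compact edges, when `V` is the derivative on each edge. -/
def coreSlope (V : G.Fn) : G.CoreEdge → ℝ → ℝ
  | Sum.inl i => V (G.pendant i)
  | Sum.inr (j, false) => V (G.loop j)
  | Sum.inr (j, true) => fun x => -V (G.loop j) (2 * G.ℓ - x)

/-- Minus the slope at the far end of a loop is the outgoing slope of its reversed half. Each loop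
therefore counts as two compact edges. -/
theorem outflow_eq (V : G.Fn) :
    G.outflow V = ∑ h, V (G.halfLine h) 0 + ∑ κ, G.coreSlope V κ 0 := by
  simp only [outflow, Fintype.sum_sum_type, Fintype.sum_prod_type, Fintype.sum_bool, coreSlope,
    sub_zero]
  congr 2
  exact Finset.sum_congr rfl fun j _ => by ring

theorem card_coreEdge : (Fintype.card G.CoreEdge : ℝ) = G.P + 2 * G.L := by
  simp [CoreEdge, mul_comm]

theorem coreEdge_nonempty (h : 1 ≤ G.P + G.L) : Nonempty G.CoreEdge := by
  rcases Nat.eq_zero_or_pos G.P with h0 | h0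
  · exact ⟨Sum.inr (⟨0, by omega⟩, false)⟩
  · exact ⟨Sum.inl ⟨0, h0⟩⟩

variable {G} {p A c : ℝ} {u V : G.Fn}

theorem ContinuousAtKnot.exists_const (hu : G.ContinuousAtKnot u) :
    ∃ c, (∀ e, u e 0 = c) ∧ ∀ κ, G.onCore u κ 0 = c := by
  obtain ⟨c, h1, h2⟩ := hu
  refine ⟨c, h1, ?_⟩
  rintro (i | ⟨j, _ | _⟩)
  · exact h1 _
  · exact h1 _
  · simpa [onCore] using h2 j

/-- A solution has a critical point inside each loop. -/
theorem IsClassical.exists_loop_critical (hℓ : 0 < G.ℓ) (h : G.IsClassical p u V) (j : Fin G.L) :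
    ∃ x₀ ∈ Ioo 0 (2 * G.ℓ), V (G.loop j) x₀ = 0 := by
  obtain ⟨c, h1, h2⟩ := h.memH1.1
  have hs : IsSol p (Icc 0 (2 * G.ℓ)) (u (G.loop j)) (V (G.loop j)) := h.sol (G.loop j)
  obtain ⟨z, hz, hz0⟩ := exists_hasDerivAt_eq_zero (f' := V (G.loop j))
    (by linarith : (0 : ℝ) < 2 * G.ℓ) hs.continuousOn (by rw [h1, h2]) fun x hx =>
      (hs x ⟨hx.1.le, hx.2.le⟩).1.hasDerivAt (Icc_mem_nhds hx.1 hx.2)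
  exact ⟨z, hz, hz0⟩

/-- Each compact edge starts an interval, the whole pendant or loop, with a critical point. -/
theorem IsClassical.exists_edge (hℓ : 0 < G.ℓ) (h : G.IsClassical p u V) (κ : G.CoreEdge) :
    ∃ a, G.ℓ ≤ a ∧ a ≤ 2 * G.ℓ ∧ IsSol p (Icc 0 a) (G.onCore u κ) (G.coreSlope V κ) ∧
      (∃ x₀ ∈ Icc 0 a, G.coreSlope V κ x₀ = 0) ∧
      ∃ e : Fin G.P ⊕ Fin G.L, G.onCore u κ '' Icc 0 a = u (Sum.inr e) '' G.dom (Sum.inr e) := by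
  match κ with
  | Sum.inl i =>
    exact ⟨G.ℓ, le_rfl, by linarith, h.sol (G.pendant i), ⟨G.ℓ, ⟨hℓ.le, le_rfl⟩, h.neumann i⟩,
      Sum.inl i, rfl⟩
  | Sum.inr (j, false) =>
    obtain ⟨z, hz, hz0⟩ := h.exists_loop_critical hℓ j
    exact ⟨2 * G.ℓ, by linarith, le_rfl, h.sol (G.loop j), ⟨z, ⟨hz.1.le, hz.2.le⟩, hz0⟩,
      Sum.inr j, rfl⟩
  | Sum.inr (j, true) =>
    obtain ⟨z, hz, hz0⟩ := h.exists_loop_critical hℓ j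
    have hs : IsSol p (Icc 0 (2 * G.ℓ)) (u (G.loop j)) (V (G.loop j)) := h.sol (G.loop j)
    refine ⟨2 * G.ℓ, by linarith, le_rfl, hs.reflect,
      ⟨2 * G.ℓ - z, ⟨by linarith [hz.2], by linarith [hz.1]⟩, by simp [coreSlope, hz0]⟩,
      Sum.inr j, ?_⟩
    change (u (G.loop j) ∘ fun x => 2 * G.ℓ - x) '' Icc 0 (2 * G.ℓ) = _
    rw [image_comp, image_const_sub_Icc]
    simp [dom]

/-- The compact edges of a bound-state satisfy a Neumann problem with given initial value. -/
structure IsCore (G : RegularKnotGraph) (p A c : ℝ) (u V : G.Fn) : Prop where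
  sol : ∀ κ, IsSol p (Icc 0 G.ℓ) (G.onCore u κ) (G.coreSlope V κ)
  bound : ∀ κ, ∀ x ∈ Icc 0 G.ℓ, |G.onCore u κ x| ≤ A
  init : ∀ κ, G.onCore u κ 0 = c
  neumann : ∀ κ, G.coreSlope V κ G.ℓ = 0

theorem IsClassical.isCore (hp : 2 < p) (hℓ : 0 < G.ℓ)
    (hs : (2 * G.ℓ) ^ 2 * lipConst p A ≤ 1 / 3) (h : G.IsClassical p u V)
    (hA : ∀ e : Fin G.P ⊕ Fin G.L, ∀ x ∈ G.dom (Sum.inr e), |u (Sum.inr e) x| ≤ A)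
    (hc : ∀ κ, G.onCore u κ 0 = c) : G.IsCore p A c u V := by
  refine ⟨fun κ => ?_, fun κ x hx => ?_, hc, fun κ => ?_⟩
  · obtain ⟨a, ha, _, hsol, _⟩ := h.exists_edge hℓ κ
    exact hsol.mono (Icc_subset_Icc_right ha)
  · obtain ⟨a, ha, _, _, _, e, he⟩ := h.exists_edge hℓ κ
    obtain ⟨y, hy, hyx⟩ := he.subset ⟨x, ⟨hx.1, hx.2.trans ha⟩, rfl⟩
    rw [← hyx]
    exact hA e y hy
  · have hl : ∀ j, V (G.loop j) G.ℓ = 0 := fun j => by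
      obtain ⟨c, h1, h2⟩ := h.memH1.1
      have hsol : IsSol p (Icc 0 (2 * G.ℓ)) (u (G.loop j)) (V (G.loop j)) := h.sol (G.loop j)
      have := (hsol.symm_of_short hp (by linarith) hs (hA (Sum.inr j)) (by rw [h1, h2])
        (x := G.ℓ) ⟨hℓ.le, by linarith⟩).2
      rw [two_mul, add_sub_cancel_right] at this
      linarith
    match κ with
    | Sum.inl i => exact h.neumann i
    | Sum.inr (j, false) => exact hl j
    | Sum.inr (j, true) =>
      simp only [coreSlope]
      rw [two_mul, add_sub_cancel_right, hl, neg_zero]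

theorem sq_short (hK : 0 ≤ lipConst p A) (hs : (2 * G.ℓ) ^ 2 * lipConst p A ≤ 1 / 3) :
    G.ℓ ^ 2 * lipConst p A ≤ 1 / 3 := by
  have : 0 ≤ G.ℓ ^ 2 * lipConst p A := by positivity
  nlinarith

theorem IsCore.eqOn (hp : 2 < p) (hℓ : 0 < G.ℓ) (hs : G.ℓ ^ 2 * lipConst p A ≤ 1 / 3)
    {u' V' : G.Fn} (h : G.IsCore p A c u V) (h' : G.IsCore p A c u' V') (κ κ' : G.CoreEdge) :
    EqOn (G.onCore u κ) (G.onCore u' κ') (Icc 0 G.ℓ) ∧ G.coreSlope V κ 0 = G.coreSlope V' κ' 0 := by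
  have := (h.sol κ).eqOn_of_short hp hs (h'.sol κ') (h.bound κ) (h'.bound κ') (x₀ := G.ℓ)
    ⟨hℓ.le, le_rfl⟩ ((h.neumann κ).trans (h'.neumann κ').symm) (x₁ := 0) ⟨le_rfl, hℓ.le⟩
    ((h.init κ).trans (h'.init κ').symm)
  exact ⟨this.1, this.2 ⟨le_rfl, hℓ.le⟩⟩

/-! ### Half-lines of a bound-state -/

theorem IsClassical.halfLine (hp : 2 < p) (h : G.IsClassical p u V) (hc : ∀ e, u e 0 = c)
    (hc0 : 0 < c) (k : Fin G.H) : ∃ y, 0 ≤ y ∧ soliton p y = c ∧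
      ((V (G.halfLine k) 0 = solitonSlope p y ∧
          ∀ x, 0 ≤ x → u (G.halfLine k) x = soliton p (x + y)) ∨
        (V (G.halfLine k) 0 = -solitonSlope p y ∧
          ∀ x, 0 ≤ x → u (G.halfLine k) x = soliton p (x - y))) := by
  have := (h.sol (G.halfLine k)).exists_soliton hp (h.memH1.2 (G.halfLine k)) (by rwa [hc])
  rwa [hc] at this

theorem IsClassical.abs_slope_halfLine_le (hp : 2 < p) (h : G.IsClassical p u V)
    (hc : ∀ e, u e 0 = c) (hc0 : 0 < c) (k : Fin G.H) : |V (G.halfLine k) 0| ≤ c := by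
  obtain ⟨y, _, hy, ⟨hV, _⟩ | ⟨hV, _⟩⟩ := h.halfLine hp hc hc0 k
  · rw [hV, ← hy]; exact abs_solitonSlope_le hp y
  · rw [hV, ← hy, abs_neg]; exact abs_solitonSlope_le hp y

/-- The slopes of a positive solution at the knot are controlled by its value there. -/
theorem IsClassical.abs_coreSlope_le (hp : 2 < p) (hℓ : 0 < G.ℓ) (hH : 1 ≤ G.H)
    (h : G.IsClassical p u V) (hpos : G.Positive u) (hc : ∀ e, u e 0 = c)
    (hc' : ∀ κ, G.onCore u κ 0 = c) (hc0 : 0 < c) (κ : G.CoreEdge) :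
    |G.coreSlope V κ 0| ≤ (G.H + (G.P + 2 * G.L)) * c := by
  -- After adding `c` all core slopes are nonnegative, so each one is bounded by their sum, which
  -- the Kirchhoff condition controls.
  have hge : ∀ κ, 0 ≤ G.coreSlope V κ 0 + c := fun κ => by
    obtain ⟨a, ha, _, hsol, ⟨x₀, hx₀, hV⟩, e, he⟩ := h.exists_edge hℓ κ
    have := hsol.neg_le_slope (fun x hx => ?_) hx₀ hV
    · rw [hc' κ] at this; linarith
    · obtain ⟨y, hy, hyx⟩ := he.subset ⟨x, hx, rfl⟩
      rw [← hyx]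
      exact (hpos _ y hy).le
  have h1 : G.coreSlope V κ 0 + c ≤ ∑ κ, (G.coreSlope V κ 0 + c) :=
    Finset.single_le_sum (fun κ _ => hge κ) (Finset.mem_univ κ)
  have hK := h.kirchhoff
  rw [outflow_eq] at hK
  have h2 : -∑ k, V (G.halfLine k) 0 ≤ G.H * c := by
    rw [← Finset.sum_neg_distrib]
    calc _ ≤ ∑ _k : Fin G.H, c := Finset.sum_le_sum fun k _ =>
          (neg_le_abs _).trans (h.abs_slope_halfLine_le hp hc hc0 k)
      _ = _ := by simp
  rw [Finset.sum_add_distrib, Finset.sum_const, Finset.card_univ, nsmul_eq_mul,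
    card_coreEdge] at h1
  have h3 : (1 : ℝ) ≤ G.H := by exact_mod_cast hH
  have h4 : (0 : ℝ) ≤ (G.P + 2 * G.L) * c := by positivity
  have h5 := hge κ
  rw [abs_le]
  constructor <;> nlinarith

end Core

/-- A bound for positive solutions on the compact edges, independent of the length. -/
theorem exists_bound_of_positive {p : ℝ} (hp : 2 < p) (H P L : ℕ) (hH : 1 ≤ H) :
    ∃ A, ∀ G : RegularKnotGraph, G.H = H → G.P = P → G.L = L → 0 < G.ℓ →
      ∀ u V : G.Fn, G.IsClassical p u V → G.Positive u →
        ∀ e : Fin G.P ⊕ Fin G.L, ∀ x ∈ G.dom (Sum.inr e), |u (Sum.inr e) x| ≤ A := by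
  obtain ⟨A, hA⟩ := exists_bound_of_energy_le hp
    (((H + (P + 2 * L)) * soliton p 0) ^ 2 / 2 + soliton p 0 ^ p / p)
  refine ⟨A, ?_⟩
  rintro G rfl rfl rfl hℓ u V h hpos e x hx
  obtain ⟨c, hc, hc'⟩ := h.memH1.1.exists_const
  have hI := G.isEdgeDomain_dom hℓ
  have hc0 : 0 < c := by
    rw [← hc (Sum.inr e)]; exact hpos _ 0 (hI _).zero_mem
  have hcM : c ≤ soliton p 0 := by
    obtain ⟨y, _, hy, _⟩ := h.halfLine hp hc hc0 ⟨0, hH⟩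
    rw [← hy]; exact soliton_le_zero hp y
  have hV : |V (Sum.inr e) 0| ≤ (G.H + (G.P + 2 * G.L)) * c := by
    rcases e with i | j
    · exact h.abs_coreSlope_le hp hℓ hH hpos hc hc' hc0 (Sum.inl i)
    · exact h.abs_coreSlope_le hp hℓ hH hpos hc hc' hc0 (Sum.inr (j, false))
  -- Energy conservation carries the bound on value and slope at the knot along the whole edge,
  -- regardless of its length.
  refine hA _ (V (Sum.inr e) x) ?_
  rw [(h.sol (Sum.inr e)).energy_eq hp (hI _).convex hx (hI _).zero_mem, hc]
  have hp0 : 0 < p := by linarith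
  have h1 : V (Sum.inr e) 0 ^ 2 ≤ ((G.H + (G.P + 2 * G.L)) * soliton p 0) ^ 2 := by
    rw [← sq_abs]
    refine pow_le_pow_left₀ (abs_nonneg _) (hV.trans ?_) 2
    gcongr
  have h2 : c ^ p ≤ soliton p 0 ^ p := Real.rpow_le_rpow hc0.le hcM hp0.le
  rw [energy, abs_of_pos hc0]
  have h3 : c ^ p / p ≤ soliton p 0 ^ p / p := by gcongr
  nlinarith [sq_nonneg c]

/-! ### Positive bound-states and their incidence index -/

/-- The smallness condition on the length of the compact edges, with `A` an a priori bound. -/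
structure IsShort (G : RegularKnotGraph) (p A : ℝ) : Prop where
  pos : 0 < G.ℓ
  halfLine : 1 ≤ G.H
  soliton_le : soliton p 0 + 1 ≤ A
  lip : (2 * G.ℓ) ^ 2 * lipConst p A ≤ 1 / 3
  lip' : (2 * G.ℓ) ^ 2 * (lipConst p A * A) ≤ 1
  slope : ((G.P + 2 * G.L) * (G.ℓ * lipConst p A * (3 / 2))) ^ 2 < 1 - 2 / p
  bound : ∀ u V : G.Fn, G.IsClassical p u V → G.Positive u →
    ∀ e : Fin G.P ⊕ Fin G.L, ∀ x ∈ G.dom (Sum.inr e), |u (Sum.inr e) x| ≤ A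

section Index

variable {G : RegularKnotGraph} {p A θ y : ℝ} {s : Finset (Fin G.H)} {u V : G.Fn}

theorem IsShort.one_le (hp : 2 < p) (hG : G.IsShort p A) : 1 ≤ A := by
  linarith [hG.soliton_le, soliton_pos hp 0]

theorem IsShort.sq (hp : 2 < p) (hG : G.IsShort p A) : G.ℓ ^ 2 * lipConst p A ≤ 1 / 3 :=
  sq_short (zero_le_one.trans (one_le_lipConst hp (zero_le_one.trans (hG.one_le hp)))) hG.lip

theorem core_card_pos (h : 1 ≤ G.P + G.L) : (0 : ℝ) < G.P + 2 * G.L := by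
  have : (1 : ℝ) ≤ G.P + G.L := by exact_mod_cast h
  have : (0 : ℝ) ≤ G.L := Nat.cast_nonneg _
  linarith

/-- `u` is `φ(· + y)` on the half-lines of `s`, `φ(· - y)` on the others, and `V` is its
derivative. -/
structure IsSplit (G : RegularKnotGraph) (p y : ℝ) (s : Finset (Fin G.H)) (u V : G.Fn) : Prop where
  pos : 0 < y
  mem : ∀ h ∈ s, ∀ x, 0 ≤ x → u (G.halfLine h) x = soliton p (x + y)
  notMem : ∀ h ∉ s, ∀ x, 0 ≤ x → u (G.halfLine h) x = soliton p (x - y)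
  slope_mem : ∀ h ∈ s, V (G.halfLine h) 0 = solitonSlope p y
  slope_notMem : ∀ h ∉ s, V (G.halfLine h) 0 = -solitonSlope p y

theorem IsSplit.outflow (h : G.IsSplit p y s u V) :
    ∑ k, V (G.halfLine k) 0 = ((s.card : ℝ) - sᶜ.card) * solitonSlope p y := by
  rw [← Finset.sum_add_sum_compl s, Finset.sum_congr rfl h.slope_mem,
    Finset.sum_congr rfl fun k hk => h.slope_notMem k (Finset.mem_compl.1 hk)]
  simp only [Finset.sum_const, nsmul_eq_mul]
  ring

theorem IsSplit.init (h : G.IsSplit p y s u V) (hH : 1 ≤ G.H) {c : ℝ} (hc : ∀ e, u e 0 = c) :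
    soliton p y = c := by
  rw [← hc (G.halfLine ⟨0, hH⟩)]
  by_cases hs : (⟨0, hH⟩ : Fin G.H) ∈ s
  · rw [h.mem _ hs 0 le_rfl, zero_add]
  · rw [h.notMem _ hs 0 le_rfl, zero_sub, soliton_neg]

theorem isSplit_of_isClassical (hp : 2 < p) (h : G.IsClassical p u V) {y : ℝ} (hy : 0 < y)
    {s : Finset (Fin G.H)}
    (h1 : ∀ h ∈ s, ∀ x, 0 ≤ x → u (G.halfLine h) x = soliton p (x + y))
    (h2 : ∀ h ∉ s, ∀ x, 0 ≤ x → u (G.halfLine h) x = soliton p (x - y)) :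
    G.IsSplit p y s u V := by
  have key : ∀ k z, (∀ x, 0 ≤ x → u (G.halfLine k) x = soliton p (x + z)) →
      V (G.halfLine k) 0 = solitonSlope p z := by
    intro k z hz
    have e1 := (h.sol (G.halfLine k) 0 self_mem_Ici).1
    have e2 := (((isSol_soliton hp (Ici 0) z).congr fun x hx => hz x hx) 0 self_mem_Ici).1
    have := (uniqueDiffOn_Ici (0 : ℝ) 0 self_mem_Ici).eq_deriv _ e1 e2
    simpa using this
  refine ⟨hy, h1, h2, fun k hk => key k y (h1 k hk), fun k hk => ?_⟩
  rw [← solitonSlope_neg]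
  exact key k (-y) (h2 k hk)

theorem IsClassical.isCore_of_positive (hp : 2 < p) (hG : G.IsShort p A)
    (h : G.IsClassical p u V) (hpos : G.Positive u) {c : ℝ} (hc : ∀ κ, G.onCore u κ 0 = c) :
    G.IsCore p A c u V :=
  h.isCore hp hG.pos hG.lip (hG.bound u V h hpos) hc

/-- The knot value is common and the soliton is injective on `[0, ∞)`, so all half-lines share one
shift `y`. -/
theorem exists_isSplit (hp : 2 < p) (hG : G.IsShort p A) (hPL : 1 ≤ G.P + G.L)
    (h : G.IsClassical p u V) (hpos : G.Positive u) : ∃ y s, G.IsSplit p y s u V := by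
  classical
  obtain ⟨c, hc, hc'⟩ := h.memH1.1.exists_const
  have hc0 : 0 < c := by
    rw [← hc (G.halfLine ⟨0, hG.halfLine⟩)]
    exact hpos _ 0 ((G.isEdgeDomain_dom hG.pos _).zero_mem)
  obtain ⟨y, hy0, hy, _⟩ := h.halfLine hp hc hc0 ⟨0, hG.halfLine⟩
  have hall : ∀ k, (V (G.halfLine k) 0 = solitonSlope p y ∧
          ∀ x, 0 ≤ x → u (G.halfLine k) x = soliton p (x + y)) ∨
        (V (G.halfLine k) 0 = -solitonSlope p y ∧
          ∀ x, 0 ≤ x → u (G.halfLine k) x = soliton p (x - y)) := fun k => by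
    obtain ⟨z, hz0, hz, hk⟩ := h.halfLine hp hc hc0 k
    rwa [(soliton_strictAntiOn hp).injOn hz0 hy0 (hz.trans hy.symm)] at hk
  have hypos : 0 < y := by
    -- If `y = 0`, the half-lines contribute no slope, while `c = φ(0) > 1` makes every compact edge
    -- leave the knot upwards. With at least one compact edge this contradicts the Kirchhoff
    -- condition.
    refine lt_of_le_of_ne hy0 fun h0 => ?_
    subst h0
    have hcore := h.isCore_of_positive hp hG hpos hc'
    have hK := h.kirchhoff
    rw [outflow_eq, Finset.sum_eq_zero (fun k _ => by
      rcases hall k with hk | hk <;> simpa [solitonSlope_zero] using hk.1), zero_add] at hK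
    have := G.coreEdge_nonempty hPL
    have hps : 0 < ∑ κ, G.coreSlope V κ 0 :=
      Finset.sum_pos (fun κ _ => (hcore.sol κ).neumann_slope_pos hp (hG.one_le hp) hG.pos
        (hG.sq hp) (hcore.bound κ) (hcore.neumann κ)
        (by rw [hcore.init, ← hy]; exact one_lt_soliton_zero hp) ⟨le_rfl, hG.pos⟩)
        Finset.univ_nonempty
    linarith
  refine ⟨y, Finset.univ.filter fun k => ∀ x, 0 ≤ x → u (G.halfLine k) x = soliton p (x + y),
    isSplit_of_isClassical hp h hypos (fun k hk => (Finset.mem_filter.1 hk).2) fun k hk => ?_⟩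
  rcases hall k with hk' | hk'
  · exact absurd (Finset.mem_filter.2 ⟨Finset.mem_univ k, hk'.2⟩) hk
  · exact hk'.2

theorem IsSplit.hasCounts (h : G.IsSplit p y s u V) : G.HasCounts p u s.card sᶜ.card :=
  ⟨y, h.pos, s, rfl, rfl, h.mem, h.notMem⟩

theorem exists_hasIncidenceIndex (hp : 2 < p) (hG : G.IsShort p A) (hPL : 1 ≤ G.P + G.L)
    (hu : G.IsBoundState p u) (hpos : G.Positive u) : ∃ θ, G.HasIncidenceIndex p u θ := by
  obtain ⟨V, hV⟩ := hu.exists_isClassical hp hG.pos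
  obtain ⟨y, s, hs⟩ := exists_isSplit hp hG hPL hV hpos
  exact ⟨_, _, _, hs.hasCounts, rfl⟩

/-- The complete description of a positive bound-state with incidence index `θ`. -/
structure IsProfile (G : RegularKnotGraph) (p A θ y : ℝ) (s : Finset (Fin G.H)) (u V : G.Fn) :
    Prop where
  split : G.IsSplit p y s u V
  core : G.IsCore p A (soliton p y) u V
  slope : ∀ κ, G.coreSlope V κ 0 = -(θ * solitonSlope p y)

theorem IsPositiveBoundStateWithIndex.exists_isProfile (hp : 2 < p) (hG : G.IsShort p A)
    (hPL : 1 ≤ G.P + G.L) {Hp Hm : ℕ} (hH : G.H = Hp + Hm) {θ : ℝ}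
    (hθ : θ = ((Hp : ℝ) - (Hm : ℝ)) / ((G.P : ℝ) + 2 * (G.L : ℝ)))
    (hu : G.IsPositiveBoundStateWithIndex p θ u) :
    ∃ y s V, s.card = Hp ∧ G.IsProfile p A θ y s u V := by
  obtain ⟨hb, hpos, Hp', Hm', ⟨y, hy, s, hs, hs', h1, h2⟩, hθ'⟩ := hu
  obtain ⟨V, hV⟩ := hb.exists_isClassical hp hG.pos
  have hN := core_card_pos hPL
  have hcard : Hp' + Hm' = Hp + Hm := by
    rw [← hH, ← hs, ← hs', Finset.card_add_card_compl, Fintype.card_fin]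
  have hcard' : (Hp' : ℝ) + Hm' = Hp + Hm := by exact_mod_cast hcard
  -- The index fixes the difference of the two counts and `H` fixes their sum, so `θ` determines
  -- both.
  have heq : (Hp' : ℝ) - Hm' = Hp - Hm := by
    rw [hθ', div_left_inj' hN.ne'] at hθ
    exact hθ
  have hHp : Hp' = Hp := by
    have : (Hp' : ℝ) = Hp := by linarith
    exact_mod_cast this
  have hsplit := isSplit_of_isClassical hp hV hy h1 h2
  obtain ⟨c, hc, hc'⟩ := hV.memH1.1.exists_const
  have hyc := hsplit.init hG.halfLine hc
  have hcore := hV.isCore_of_positive hp hG hpos hc'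
  rw [← hyc] at hcore
  refine ⟨y, s, V, hs.trans hHp, hsplit, hcore, fun κ => ?_⟩
  have hK := hV.kirchhoff
  rw [outflow_eq, hsplit.outflow, Finset.sum_congr rfl fun κ' _ =>
    (hcore.eqOn hp hG.pos (hG.sq hp) hcore κ' κ).2, Finset.sum_const, Finset.card_univ,
    nsmul_eq_mul, card_coreEdge, hs, hs', heq] at hK
  rw [hθ]
  field_simp
  linarith

/-! ### Shape of a profile and the sign of its core slope -/

theorem IsProfile.coreSymmetric (hp : 2 < p) (hG : G.IsShort p A)
    (h : G.IsProfile p A θ y s u V) : G.CoreSymmetric u := fun κ κ' =>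
  (h.core.eqOn hp hG.pos (hG.sq hp) h.core κ κ').1

/-- With the next two lemmas: the core slope at the knot has the sign of `φ(y) - 1`. Since this
slope is `-θ φ'(y)` and `φ'(y) < 0`, the sign of `θ` locates `φ(y)` relative to `1`. -/
theorem IsProfile.soliton_lt_one_slope (hp : 2 < p) (hG : G.IsShort p A)
    (h : G.IsProfile p A θ y s u V) (κ : G.CoreEdge) (hlt : soliton p y < 1) :
    G.coreSlope V κ 0 < 0 :=
  (h.core.sol κ).neumann_slope_neg hp (hG.one_le hp) hG.pos (hG.sq hp) (h.core.bound κ)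
    (h.core.neumann κ) (by rw [h.core.init]; exact soliton_pos hp y) (by rwa [h.core.init])

theorem IsProfile.soliton_eq_one_slope (hp : 2 < p) (hG : G.IsShort p A)
    (h : G.IsProfile p A θ y s u V) (κ : G.CoreEdge) (heq : soliton p y = 1) :
    G.coreSlope V κ 0 = 0 :=
  ((h.core.sol κ).neumann_eq_one hp (hG.one_le hp) hG.pos (hG.sq hp) (h.core.bound κ)
    (h.core.neumann κ) (by rwa [h.core.init]) ⟨le_rfl, hG.pos.le⟩).2

theorem IsProfile.one_lt_soliton_slope (hp : 2 < p) (hG : G.IsShort p A)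
    (h : G.IsProfile p A θ y s u V) (κ : G.CoreEdge) (hlt : 1 < soliton p y) :
    0 < G.coreSlope V κ 0 :=
  (h.core.sol κ).neumann_slope_pos hp (hG.one_le hp) hG.pos (hG.sq hp) (h.core.bound κ)
    (h.core.neumann κ) (by rwa [h.core.init]) ⟨le_rfl, hG.pos⟩

theorem IsProfile.one_lt_soliton (hp : 2 < p) (hG : G.IsShort p A) (hPL : 1 ≤ G.P + G.L)
    (h : G.IsProfile p A θ y s u V) (hθ : 0 < θ) : 1 < soliton p y := by
  obtain ⟨κ⟩ := G.coreEdge_nonempty hPL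
  have hs : 0 < G.coreSlope V κ 0 := by
    rw [h.slope]
    have := solitonSlope_neg_of_pos hp h.split.pos
    nlinarith
  rcases lt_trichotomy (soliton p y) 1 with h1 | h1 | h1
  · exact absurd (h.soliton_lt_one_slope hp hG κ h1) (not_lt.2 hs.le)
  · exact absurd (h.soliton_eq_one_slope hp hG κ h1) hs.ne'
  · exact h1

theorem IsProfile.soliton_eq_one (hp : 2 < p) (hG : G.IsShort p A) (hPL : 1 ≤ G.P + G.L)
    (h : G.IsProfile p A 0 y s u V) : soliton p y = 1 := by
  obtain ⟨κ⟩ := G.coreEdge_nonempty hPL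
  have hs : G.coreSlope V κ 0 = 0 := by rw [h.slope, zero_mul, neg_zero]
  rcases lt_trichotomy (soliton p y) 1 with h1 | h1 | h1
  · exact absurd hs (h.soliton_lt_one_slope hp hG κ h1).ne
  · exact h1
  · exact absurd hs (h.one_lt_soliton_slope hp hG κ h1).ne'

theorem IsProfile.coreIncreasing (hp : 2 < p) (hG : G.IsShort p A) (hPL : 1 ≤ G.P + G.L)
    (h : G.IsProfile p A θ y s u V) (hθ : 0 < θ) : G.CoreIncreasing u := fun κ =>
  (h.core.sol κ).neumann_strictMonoOn hp (hG.one_le hp) hG.pos (hG.sq hp) (h.core.bound κ)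
    (h.core.neumann κ) (by rw [h.core.init]; exact h.one_lt_soliton hp hG hPL hθ)

theorem IsProfile.oneOnCore (hp : 2 < p) (hG : G.IsShort p A) (hPL : 1 ≤ G.P + G.L)
    (h : G.IsProfile p A 0 y s u V) : G.OneOnCore u := fun κ _ hx =>
  ((h.core.sol κ).neumann_eq_one hp (hG.one_le hp) hG.pos (hG.sq hp) (h.core.bound κ)
    (h.core.neumann κ) (by rw [h.core.init]; exact h.soliton_eq_one hp hG hPL) hx).1

/-- There is no positive bound-state with a negative incidence index. -/
theorem IsProfile.index_not_neg (hp : 2 < p) (hG : G.IsShort p A) (hPL : 1 ≤ G.P + G.L)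
    (h : G.IsProfile p A θ y s u V) (hθ : θ * (G.P + 2 * G.L) ≤ -1) : False := by
  obtain ⟨κ⟩ := G.coreEdge_nonempty hPL
  have hN := core_card_pos hPL
  have hslope := solitonSlope_neg_of_pos hp h.split.pos
  have hc := soliton_pos hp y
  have hneg : G.coreSlope V κ 0 < 0 := by
    rw [h.slope]
    have : θ < 0 := by nlinarith
    nlinarith
  have hlt : soliton p y < 1 := by
    rcases lt_trichotomy (soliton p y) 1 with h1 | h1 | h1
    · exact h1
    · exact absurd (h.soliton_eq_one_slope hp hG κ h1) hneg.ne
    · exact absurd (h.one_lt_soliton_slope hp hG κ h1) (not_lt.2 hneg.le)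
  have hA := hG.one_le hp
  -- Comparison with the zero solution: the core slope is at most a multiple of `ℓ` times the knot
  -- value.
  have h1 := ((h.core.sol κ).sub_close hp (hG.sq hp) (isSol_zero p _) (h.core.bound κ)
    (fun _ _ => by simp only [abs_zero]; linarith) (x₀ := G.ℓ) ⟨hG.pos.le, le_rfl⟩
    (h.core.neumann κ) (x₁ := 0) ⟨le_rfl, hG.pos.le⟩ (x := 0) ⟨le_rfl, hG.pos.le⟩).2
  rw [sub_zero, sub_zero, h.core.init, abs_of_pos hc, h.slope, abs_neg, abs_mul] at h1
  have hθ1 : 1 ≤ |θ| * (G.P + 2 * G.L) := by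
    have := neg_le_abs θ
    nlinarith
  set N : ℝ := G.P + 2 * G.L
  set B := G.ℓ * lipConst p A * (3 / 2)
  have h2 : |solitonSlope p y| ≤ N * B * soliton p y := by
    calc |solitonSlope p y| ≤ |θ| * N * |solitonSlope p y| :=
          le_mul_of_one_le_left (abs_nonneg _) hθ1
      _ = N * (|θ| * |solitonSlope p y|) := by ring
      _ ≤ N * (G.ℓ * lipConst p A * (3 / 2 * soliton p y)) := by gcongr
      _ = _ := by ring
  have h3 : solitonSlope p y ^ 2 ≤ (N * B) ^ 2 * soliton p y ^ 2 := by
    rw [← sq_abs, ← mul_pow]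
    exact pow_le_pow_left₀ (abs_nonneg _) h2 2
  rw [solitonSlope_sq hp, mul_comm] at h3
  have h4 := le_of_mul_le_mul_right h3 (by positivity)
  -- Since `φ(y) < 1`, the squared soliton slope is at least `(1 - 2 / p) φ(y) ^ 2`, which
  -- contradicts the smallness of the core slope.
  have h5 : soliton p y ^ (p - 2) ≤ 1 := Real.rpow_le_one hc.le hlt.le (by linarith)
  have h6 : 2 / p * soliton p y ^ (p - 2) ≤ 2 / p * 1 :=
    mul_le_mul_of_nonneg_left h5 (div_nonneg (by norm_num) (by linarith))
  have h7 : (N * B) ^ 2 < 1 - 2 / p := hG.slope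
  linarith

/-! ### Uniqueness of the profile with a given nonnegative index -/

theorem solitonSlope_lt (hp : 2 < p) {y z : ℝ} (hy : 0 ≤ y) (hyz : y < z)
    (hz : 1 < soliton p z) : solitonSlope p z < solitonSlope p y := by
  have hanti : StrictAntiOn (solitonSlope p) (Icc y z) := by
    refine strictAntiOn_of_deriv_neg (convex_Icc y z) (continuous_solitonSlope hp).continuousOn ?_
    intro x hx
    rw [interior_Icc] at hx
    rw [(hasDerivAt_solitonSlope hp x).deriv]
    -- The soliton stays above `1` before `z`, where its second derivative is negative.
    refine reaction_neg_of_one_lt hp (hz.trans ?_)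
    exact soliton_strictAntiOn hp (hy.trans hx.1.le) (hy.trans hyz.le) hx.2
  exact hanti ⟨le_rfl, hyz.le⟩ ⟨hyz.le, le_rfl⟩ hyz

/-- A smaller shift means a larger knot value, hence a steeper core, but also a flatter soliton
since both values exceed `1`. The matching condition cannot hold at two different shifts. -/
theorem IsProfile.shift_le (hp : 2 < p) (hG : G.IsShort p A) (hPL : 1 ≤ G.P + G.L) (hθ : 0 < θ)
    {y' : ℝ} {s' : Finset (Fin G.H)} {u' V' : G.Fn} (h : G.IsProfile p A θ y s u V)
    (h' : G.IsProfile p A θ y' s' u' V') : y ≤ y' := by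
  by_contra! hlt
  obtain ⟨κ⟩ := G.coreEdge_nonempty hPL
  have h1 := h.one_lt_soliton hp hG hPL hθ
  have h2 : soliton p y < soliton p y' :=
    soliton_strictAntiOn hp h'.split.pos.le h.split.pos.le hlt
  have h3 := (h.core.sol κ).neumann_slope_lt hp (hG.one_le hp) hG.pos (hG.sq hp) (h'.core.sol κ)
    (h.core.bound κ) (h'.core.bound κ) (h.core.neumann κ) (h'.core.neumann κ)
    (by rwa [h.core.init]) (by rwa [h.core.init, h'.core.init])
  rw [h.slope, h'.slope] at h3
  have h4 := solitonSlope_lt hp h'.split.pos.le hlt h1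
  nlinarith

theorem IsProfile.eq_of_nonneg (hp : 2 < p) (hG : G.IsShort p A) (hPL : 1 ≤ G.P + G.L)
    (hθ : 0 ≤ θ) {y' : ℝ} {s' : Finset (Fin G.H)} {u' V' : G.Fn}
    (h : G.IsProfile p A θ y s u V) (h' : G.IsProfile p A θ y' s' u' V') : y = y' := by
  rcases hθ.eq_or_lt with rfl | hθ
  · exact (soliton_strictAntiOn hp).injOn h.split.pos.le h'.split.pos.le
      ((h.soliton_eq_one hp hG hPL).trans (h'.soliton_eq_one hp hG hPL).symm)
  · exact le_antisymm (h.shift_le hp hG hPL hθ h') (h'.shift_le hp hG hPL hθ h)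

theorem exists_perm_of_card_eq {n : ℕ} {s t : Finset (Fin n)} (h : s.card = t.card) :
    ∃ σ : Equiv.Perm (Fin n), ∀ k, σ k ∈ t ↔ k ∈ s := by
  refine ⟨(Finset.equivOfCardEq h).extendSubtype, fun k => ⟨fun hk => ?_, fun hk => ?_⟩⟩
  · by_contra hks
    exact (Finset.equivOfCardEq h).extendSubtype_not_mem k hks hk
  · exact (Finset.equivOfCardEq h).extendSubtype_mem k hk

/-- The compact edges agree because they solve the same Neumann problem, so only the choice of
half-lines in `s` can differ, and a permutation absorbs it. -/
theorem IsProfile.exists_same (hp : 2 < p) (hG : G.IsShort p A) {s' : Finset (Fin G.H)}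
    {u' V' : G.Fn} (hcard : s'.card = s.card) (h : G.IsProfile p A θ y s u V)
    (h' : G.IsProfile p A θ y s' u' V') :
    ∃ σ : Equiv.Perm (Fin G.H), G.Same u' (G.permHalfLines σ u) := by
  obtain ⟨σ, hσ⟩ := exists_perm_of_card_eq hcard
  have hcore := fun κ => (h'.core.eqOn hp hG.pos (hG.sq hp) h.core κ κ).1
  refine ⟨σ, ?_⟩
  rintro (k | i | j) x hx
  · have hx : 0 ≤ x := hx
    simp only [permHalfLines]
    by_cases hk : k ∈ s'
    · exact (h'.split.mem k hk x hx).trans (h.split.mem _ ((hσ k).2 hk) x hx).symm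
    · exact (h'.split.notMem k hk x hx).trans
        (h.split.notMem _ (fun hk' => hk ((hσ k).1 hk')) x hx).symm
  · exact hcore (Sum.inl i) hx
  · obtain ⟨hx0, hx1⟩ : 0 ≤ x ∧ x ≤ 2 * G.ℓ := hx
    rcases le_total x G.ℓ with hxl | hxl
    · exact hcore (Sum.inr (j, false)) ⟨hx0, hxl⟩
    · have := hcore (Sum.inr (j, true)) (x := 2 * G.ℓ - x) ⟨by linarith, by linarith⟩
      simpa [onCore, permHalfLines] using this

theorem IsPositiveBoundStateWithIndex.exists_perm (hp : 2 < p) (hG : G.IsShort p A)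
    (hPL : 1 ≤ G.P + G.L) {Hp Hm : ℕ} (hH : G.H = Hp + Hm)
    (hθ : θ = ((Hp : ℝ) - (Hm : ℝ)) / ((G.P : ℝ) + 2 * (G.L : ℝ))) (hle : Hm ≤ Hp) {u v : G.Fn}
    (hu : G.IsPositiveBoundStateWithIndex p θ u) (hv : G.IsPositiveBoundStateWithIndex p θ v) :
    ∃ σ : Equiv.Perm (Fin G.H), G.Same v (G.permHalfLines σ u) := by
  obtain ⟨y, s, V, hs, h⟩ := hu.exists_isProfile hp hG hPL hH hθ
  obtain ⟨y', s', V', hs', h'⟩ := hv.exists_isProfile hp hG hPL hH hθ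
  have hθ0 : 0 ≤ θ := by
    rw [hθ]
    exact div_nonneg (sub_nonneg.2 (by exact_mod_cast hle)) (core_card_pos hPL).le
  obtain rfl := h.eq_of_nonneg hp hG hPL hθ0 h'
  exact h.exists_same hp hG (hs'.trans hs.symm) h'

end Index

/-! ### Existence of positive bound-states -/

section Existence

variable {G : RegularKnotGraph} {p A θ y : ℝ} {s : Finset (Fin G.H)} {U W : ℝ → ℝ}

/-- `U` is a solution on a loop, symmetric at first order, with derivative `W`. -/
structure IsLoopProfile (G : RegularKnotGraph) (p A c : ℝ) (U W : ℝ → ℝ) : Prop where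
  sol : IsSol p (Icc 0 (2 * G.ℓ)) U W
  init : U 0 = c
  mid : W G.ℓ = 0
  bound : ∀ x ∈ Icc 0 (2 * G.ℓ), |U x| ≤ A
  final : U (2 * G.ℓ) = c
  slope_final : W (2 * G.ℓ) = -W 0

theorem IsShort.ℓ_mem (hG : G.IsShort p A) : G.ℓ ∈ Icc 0 (2 * G.ℓ) :=
  ⟨hG.pos.le, by linarith [hG.pos]⟩

theorem IsShort.zero_mem (hG : G.IsShort p A) : (0 : ℝ) ∈ Icc 0 (2 * G.ℓ) :=
  ⟨le_rfl, by linarith [hG.pos]⟩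

/-- The solution is built on the whole loop with its critical point at `ℓ`, and mixed uniqueness
makes it symmetric. Its first half then also serves on the pendants, so one function fills the core.
-/
theorem exists_isLoopProfile (hp : 2 < p) (hG : G.IsShort p A) {c : ℝ} (hc : 0 ≤ c)
    (hcM : c ≤ soliton p 0) : ∃ U W, G.IsLoopProfile p A c U W := by
  obtain ⟨U, W, h, h0, hm, hb⟩ := exists_profile hp hG.ℓ_mem hG.lip hG.lip' hc
    (by linarith [hG.soliton_le])
  have he : 2 * G.ℓ - G.ℓ = G.ℓ := by ring
  have := h.reflect.eqOn_of_short hp hG.lip h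
    (fun x hx => hb _ ⟨by linarith [hx.2], by linarith [hx.1]⟩) hb hG.ℓ_mem
    (by simp only [he, hm, neg_zero]) hG.ℓ_mem (by simp only [he])
  have h1 := this.1 hG.zero_mem
  have h2 := this.2 hG.zero_mem
  simp only [sub_zero] at h1 h2
  exact ⟨U, W, h, h0, hm, hb, h1.trans h0, by linarith⟩

/-- The intermediate value theorem is applied to `W y 0 + θ φ'(y)`: it is positive at `y = 0`, where
the soliton is flat and above `1`, and nonpositive where `φ(y) = 1`, since the core is flat there.
-/
theorem exists_matching (hp : 2 < p) (hG : G.IsShort p A) (hθ : 0 ≤ θ) :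
    ∃ y, 0 < y ∧ ∃ U W, G.IsLoopProfile p A (soliton p y) U W ∧ W 0 = -(θ * solitonSlope p y) := by
  have hA := hG.one_le hp
  have hK := one_le_lipConst hp (zero_le_one.trans hA)
  have hsub : Icc 0 G.ℓ ⊆ Icc 0 (2 * G.ℓ) := Icc_subset_Icc_right (by linarith [hG.pos])
  choose U W h using fun y =>
    exists_isLoopProfile hp hG (soliton_pos hp y).le (soliton_le_zero hp y)
  -- The profiles are merely chosen for each `y`; continuity comes from the quantitative comparison,
  -- in which slopes differ by at most a multiple of the difference of the knot values.
  have hcont : Continuous fun y => W y 0 := by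
    rw [continuous_iff_continuousAt]
    intro y
    rw [ContinuousAt, tendsto_iff_dist_tendsto_zero]
    have hlim : Filter.Tendsto (fun z => 2 * G.ℓ * lipConst p A *
        (3 / 2 * |soliton p z - soliton p y|)) (nhds y) (nhds 0) := by
      have hc : Continuous fun z => 2 * G.ℓ * lipConst p A *
          (3 / 2 * |soliton p z - soliton p y|) :=
        continuous_const.mul (continuous_const.mul
          ((continuous_soliton hp).sub continuous_const).abs)
      have := hc.tendsto y
      simpa using this
    refine squeeze_zero (fun _ => dist_nonneg) (fun z => ?_) hlim
    have := ((h z).sol.sub_close hp hG.lip (h y).sol (h z).bound (h y).bound hG.ℓ_mem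
      ((h z).mid.trans (h y).mid.symm) hG.zero_mem hG.zero_mem).2
    rwa [(h z).init, (h y).init] at this
  obtain ⟨y₁, hy₁, hy₁1⟩ := exists_soliton_eq hp one_pos (one_lt_soliton_zero hp).le
  have hy₁0 : 0 < y₁ := lt_of_le_of_ne hy₁ fun h0 => by
    rw [← h0] at hy₁1; exact (one_lt_soliton_zero hp).ne' hy₁1
  have hc2 : ContinuousOn (fun y => W y 0 + θ * solitonSlope p y) (Icc 0 y₁) :=
    (hcont.add (continuous_const.mul (continuous_solitonSlope hp))).continuousOn
  have hpos : 0 < W 0 0 + θ * solitonSlope p 0 := by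
    rw [solitonSlope_zero, mul_zero, add_zero]
    exact ((h 0).sol.mono hsub).neumann_slope_pos hp hA hG.pos (hG.sq hp)
      (fun x hx => (h 0).bound x (hsub hx)) (h 0).mid
      (by rw [(h 0).init]; exact one_lt_soliton_zero hp) ⟨le_rfl, hG.pos⟩
  have hneg : W y₁ 0 + θ * solitonSlope p y₁ ≤ 0 := by
    have := (((h y₁).sol.mono hsub).neumann_eq_one hp hA hG.pos (hG.sq hp)
      (fun x hx => (h y₁).bound x (hsub hx)) (h y₁).mid ((h y₁).init.trans hy₁1)
      (x := 0) ⟨le_rfl, hG.pos.le⟩).2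
    rw [this, zero_add]
    exact mul_nonpos_of_nonneg_of_nonpos hθ (solitonSlope_neg_of_pos hp hy₁0).le
  obtain ⟨y, hy, hy0⟩ := intermediate_value_Icc' hy₁ hc2 ⟨hneg, hpos.le⟩
  simp only at hy0
  refine ⟨y, lt_of_le_of_ne hy.1 fun h0 => ?_, U y, W y, h y, by linarith⟩
  rw [← h0] at hy0
  exact hpos.ne' hy0

/-! ### Gluing soliton pieces and a core profile into a bound-state -/

theorem memLp_soliton (hp : 2 < p) (y : ℝ) :
    MemLp (fun x => soliton p (x + y)) 2 (volume.restrict (Ici 0)) := by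
  set D := (p / 2) ^ (1 / (p - 2)) * (2 : ℝ) ^ (2 / (p - 2))
  have hc : Continuous fun x => soliton p (x + y) :=
    (continuous_soliton hp).comp (continuous_id.add continuous_const)
  rw [memLp_two_iff_integrable_sq hc.aestronglyMeasurable]
  have hi : IntegrableOn (fun x => (D * Real.exp (-y)) ^ 2 * Real.exp (-2 * x)) (Ici 0) := by
    rw [integrableOn_Ici_iff_integrableOn_Ioi]
    exact (integrableOn_exp_mul_Ioi (by norm_num) 0).const_mul _
  refine Integrable.mono' hi (hc.pow 2).aestronglyMeasurable
    (Filter.Eventually.of_forall fun x => ?_)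
  rw [Real.norm_of_nonneg (by positivity)]
  calc soliton p (x + y) ^ 2 ≤ (D * Real.exp (-(x + y))) ^ 2 :=
        pow_le_pow_left₀ (soliton_pos hp _).le (soliton_le_exp hp _) 2
    _ = _ := by
      have h2 : Real.exp (-2 * x) = Real.exp (-x) ^ 2 := by
        rw [← Real.exp_nat_mul]; congr 1; push_cast; ring
      rw [h2, neg_add, Real.exp_add]
      ring

theorem memH1On_soliton (hp : 2 < p) (y : ℝ) :
    MemH1On (Ici 0) fun x => soliton p (x + y) := by
  have hc : Continuous fun x => solitonSlope p (x + y) :=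
    (continuous_solitonSlope hp).comp (continuous_id.add continuous_const)
  refine memH1On_of_hasDerivWithinAt isEdgeDomain_Ici
    (fun x hx => (isSol_soliton hp (Ici 0) y x hx).1) hc.continuousOn (memLp_soliton hp y)
    ((memLp_soliton hp y).mono hc.aestronglyMeasurable
      (Filter.Eventually.of_forall fun x => ?_))
  rw [Real.norm_eq_abs, Real.norm_of_nonneg (soliton_pos hp _).le]
  exact abs_solitonSlope_le hp _

theorem ContinuousOn.memLp_two_Icc {a : ℝ} {f : ℝ → ℝ} (hf : ContinuousOn f (Icc 0 a)) :
    MemLp f 2 (volume.restrict (Icc 0 a)) := by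
  obtain ⟨C, hC⟩ := isCompact_Icc.exists_bound_of_continuousOn hf
  exact MemLp.of_bound (hf.aestronglyMeasurable measurableSet_Icc) C
    ((ae_restrict_iff' measurableSet_Icc).2 (Filter.Eventually.of_forall hC))

theorem IsSol.memH1On {a : ℝ} (ha : 0 < a) (h : IsSol p (Icc 0 a) U W) : MemH1On (Icc 0 a) U :=
  memH1On_of_hasDerivWithinAt (isEdgeDomain_Icc ha) (fun x hx => (h x hx).1) h.continuousOn_deriv
    (ContinuousOn.memLp_two_Icc h.continuousOn) (ContinuousOn.memLp_two_Icc h.continuousOn_deriv)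

/-- The function equal to `φ(· + y)` on the half-lines of `s`, to `φ(· - y)` on the others and to
`U` on the pendants and the loops. -/
noncomputable def glue (G : RegularKnotGraph) (φ : ℝ → ℝ) (y : ℝ) (s : Finset (Fin G.H))
    (U : ℝ → ℝ) : G.Fn :=
  Sum.elim (fun k x => if k ∈ s then φ (x + y) else φ (x + -y)) fun _ => U

theorem glue_isClassical (hp : 2 < p) (hG : G.IsShort p A)
    (h : G.IsLoopProfile p A (soliton p y) U W)
    (hK : ((s.card : ℝ) - sᶜ.card) * solitonSlope p y + (G.P + 2 * G.L) * W 0 = 0) :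
    ∃ V, G.IsClassical p (G.glue (soliton p) y s U) V := by
  have hℓ := hG.pos
  have hsub : Icc 0 G.ℓ ⊆ Icc 0 (2 * G.ℓ) := Icc_subset_Icc_right (by linarith)
  refine ⟨G.glue (solitonSlope p) y s W, ⟨⟨soliton p y, ?_, fun j => h.final⟩, ?_⟩, ?_,
    fun i => h.mid, ?_⟩
  · rintro (k | κ)
    · by_cases hk : k ∈ s <;> simp [glue, hk, soliton_neg]
    · exact h.init
  · rintro (k | i | j)
    · by_cases hk : k ∈ s
      · simpa [glue, hk, dom] using memH1On_soliton hp y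
      · simpa [glue, hk, dom] using memH1On_soliton hp (-y)
    · exact (h.sol.mono hsub).memH1On hℓ
    · exact h.sol.memH1On (by linarith)
  · rintro (k | i | j)
    · by_cases hk : k ∈ s
      · simpa [glue, hk, dom] using isSol_soliton hp (Ici 0) y
      · simpa [glue, hk, dom] using isSol_soliton hp (Ici 0) (-y)
    · exact h.sol.mono hsub
    · exact h.sol
  · have h1 : ∑ k, (G.glue (solitonSlope p) y s W) (G.halfLine k) 0 =
        ((s.card : ℝ) - sᶜ.card) * solitonSlope p y := by
      have e1 : ∀ k ∈ s, (G.glue (solitonSlope p) y s W) (G.halfLine k) 0 = solitonSlope p y :=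
        fun k hk => by simp [glue, hk]
      have e2 : ∀ k ∈ sᶜ, (G.glue (solitonSlope p) y s W) (G.halfLine k) 0 = -solitonSlope p y :=
        fun k hk => by simp [glue, Finset.mem_compl.1 hk, solitonSlope_neg]
      rw [← Finset.sum_add_sum_compl s, Finset.sum_congr rfl e1, Finset.sum_congr rfl e2]
      simp only [Finset.sum_const, nsmul_eq_mul]
      ring
    rw [outflow, h1]
    simp only [glue, Sum.elim_inr, h.slope_final, Finset.sum_const, Finset.card_univ,
      Fintype.card_fin, nsmul_eq_mul]
    linarith

theorem glue_positive (hp : 2 < p) (hG : G.IsShort p A)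
    (h : G.IsLoopProfile p A (soliton p y) U W) : G.Positive (G.glue (soliton p) y s U) := by
  have hpos : ∀ x ∈ Icc 0 (2 * G.ℓ), 0 < U x := fun x hx =>
    h.sol.pos_of_short hp hG.lip h.bound hG.ℓ_mem h.mid (by rw [h.init]; exact soliton_pos hp y) hx
  rintro (k | i | j) x hx
  · by_cases hk : k ∈ s <;> simp [glue, hk, soliton_pos hp]
  · exact hpos x ⟨hx.1, hx.2.trans (by linarith [hG.pos])⟩
  · exact hpos x hx

theorem glue_isBoundState (hp : 2 < p) (hG : G.IsShort p A)
    (h : G.IsLoopProfile p A (soliton p y) U W)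
    (hK : ((s.card : ℝ) - sᶜ.card) * solitonSlope p y + (G.P + 2 * G.L) * W 0 = 0) :
    G.IsBoundState p (G.glue (soliton p) y s U) := by
  obtain ⟨V, hV⟩ := glue_isClassical hp hG h hK
  exact hV.isBoundState hp hG.pos ⟨G.halfLine ⟨0, hG.halfLine⟩, 0, self_mem_Ici,
    (glue_positive hp hG h _ 0 self_mem_Ici).ne'⟩

theorem exists_isPositiveBoundStateWithIndex (hp : 2 < p) (hG : G.IsShort p A)
    (hPL : 1 ≤ G.P + G.L) {Hp Hm : ℕ} (hH : G.H = Hp + Hm)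
    (hθ : θ = ((Hp : ℝ) - (Hm : ℝ)) / ((G.P : ℝ) + 2 * (G.L : ℝ))) (hle : Hm ≤ Hp) :
    ∃ u, G.IsPositiveBoundStateWithIndex p θ u := by
  have hN := core_card_pos hPL
  have hθ0 : 0 ≤ θ := by
    rw [hθ]
    exact div_nonneg (sub_nonneg.2 (by exact_mod_cast hle)) hN.le
  obtain ⟨y, hy, U, W, h, hW⟩ := exists_matching hp hG hθ0
  obtain ⟨s, -, hs⟩ := Finset.exists_subset_card_eq (s := (Finset.univ : Finset (Fin G.H)))
    (n := Hp) (by rw [Finset.card_univ, Fintype.card_fin]; omega)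
  have hs' : sᶜ.card = Hm := by
    rw [Finset.card_compl, Fintype.card_fin, hs]; omega
  refine ⟨G.glue (soliton p) y s U, glue_isBoundState hp hG h ?_, glue_positive hp hG h, Hp, Hm,
    ⟨y, hy, s, hs, hs', fun k hk x _ => by simp [glue, hk],
      fun k hk x _ => by simp [glue, hk, sub_eq_add_neg]⟩, hθ⟩
  rw [hs, hs', hW, hθ]
  field_simp
  ring

end Existence

/-! ### The action of bound-states -/

section Action

variable {G : RegularKnotGraph} {p A Q : ℝ} {u V : G.Fn}

/-- The integral of `|u|^p` over the graph. -/
noncomputable def mass (G : RegularKnotGraph) (p : ℝ) (u : G.Fn) : ℝ :=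
  ∑ e, ∫ x in G.dom e, |u e x| ^ p

theorem IsClassical.neg (h : G.IsClassical p u V) : G.IsClassical p (-u) (-V) := by
  refine ⟨⟨?_, fun e => ?_⟩, fun e => (h.sol e).neg, fun i => ?_, ?_⟩
  · obtain ⟨c, h1, h2⟩ := h.memH1.1
    exact ⟨-c, fun e => by simp [h1], fun j => by simp [h2]⟩
  · obtain ⟨h1, g, hg, hgw⟩ := h.memH1.2 e
    refine ⟨h1.neg, -g, hg.neg, fun x hx => ?_⟩
    simp only [Pi.neg_apply, intervalIntegral.integral_neg]
    rw [hgw x hx]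
    ring
  · simp [h.neumann]
  · have : G.outflow (-V) = -G.outflow V := by
      simp only [outflow, Pi.neg_apply, Finset.sum_neg_distrib, neg_add, Finset.sum_sub_distrib]
      ring
    rw [this, h.kirchhoff, neg_zero]

theorem IsBoundState.neg (hp : 2 < p) (hℓ : 0 < G.ℓ) (hu : G.IsBoundState p u) :
    G.IsBoundState p (-u) := by
  obtain ⟨V, hV⟩ := hu.exists_isClassical hp hℓ
  obtain ⟨e, x, hx, hne⟩ := hu.2.1
  exact hV.neg.isBoundState hp hℓ ⟨e, x, hx, by simpa using hne⟩

theorem IsClassical.integrableOn_abs_rpow (hp : 2 < p) (hℓ : 0 < G.ℓ) (h : G.IsClassical p u V)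
    (e : G.Edge) : IntegrableOn (fun x => |u e x| ^ p) (G.dom e) := by
  have hI := G.isEdgeDomain_dom hℓ e
  have hb : ∃ A, ∀ x ∈ G.dom e, |u e x| ≤ A := by
    match e with
    | Sum.inl k => exact (h.sol (Sum.inl k)).bounded_of_memH1On (h.memH1.2 (Sum.inl k))
    | Sum.inr (Sum.inl i) =>
      exact (isCompact_Icc : IsCompact (Icc 0 G.ℓ)).exists_bound_of_continuousOn
        (h.sol (G.pendant i)).continuousOn
    | Sum.inr (Sum.inr j) =>
      exact (isCompact_Icc : IsCompact (Icc 0 (2 * G.ℓ))).exists_bound_of_continuousOn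
        (h.sol (G.loop j)).continuousOn
  obtain ⟨A, hA⟩ := hb
  exact RegularKnotGraph.integrableOn_abs_rpow hp hI.measurableSet (h.memH1.2 e).1
    (h.sol e).continuousOn hA

theorem MemH1.integrableOn_sq (hℓ : 0 < G.ℓ) (h : G.MemH1 u) (e : G.Edge) :
    IntegrableOn (fun x => deriv (u e) x ^ 2 + u e x ^ 2) (G.dom e) :=
  ((h.2 e).memLp_deriv (G.isEdgeDomain_dom hℓ e)).integrable_sq.add (h.2 e).1.integrable_sq

/-- The bound-state is tested against itself. The action thus becomes a positive multiple of `mass`,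
so ground-states minimize `mass` among bound-states. -/
theorem IsBoundState.sum_sq_eq_mass (hp : 2 < p) (hℓ : 0 < G.ℓ) (hu : G.IsBoundState p u) :
    ∑ e, ∫ x in G.dom e, (deriv (u e) x ^ 2 + u e x ^ 2) = G.mass p u := by
  obtain ⟨V, hV⟩ := hu.exists_isClassical hp hℓ
  have h := hu.2.2 u hu.1
  rw [← sub_eq_zero, mass, ← Finset.sum_sub_distrib, ← h]
  refine Finset.sum_congr rfl fun e _ => ?_
  rw [← integral_sub (hu.1.integrableOn_sq hℓ e) (hV.integrableOn_abs_rpow hp hℓ e)]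
  refine integral_congr_ae (Filter.Eventually.of_forall fun x => ?_)
  have h1 : |u e x| ^ p = |u e x| ^ (p - 2) * u e x * u e x := by
    rw [mul_assoc, ← sq, ← sq_abs, ← Real.rpow_natCast,
      ← Real.rpow_add_of_nonneg (abs_nonneg _) (by linarith) (by norm_num)]
    norm_num
  simp only [h1]
  ring

theorem IsBoundState.action_eq (hp : 2 < p) (hℓ : 0 < G.ℓ) (hu : G.IsBoundState p u) :
    G.action p u = (1 / 2 - 1 / p) * G.mass p u := by
  rw [action, hu.sum_sq_eq_mass hp hℓ, mass]
  ring

theorem IsBoundState.action_le_iff (hp : 2 < p) (hℓ : 0 < G.ℓ) {v : G.Fn}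
    (hu : G.IsBoundState p u) (hv : G.IsBoundState p v) :
    G.action p u ≤ G.action p v ↔ G.mass p u ≤ G.mass p v := by
  rw [hu.action_eq hp hℓ, hv.action_eq hp hℓ]
  refine mul_le_mul_iff_right₀ ?_
  rw [sub_pos]
  exact one_div_lt_one_div_of_lt (by norm_num) hp

theorem mass_congr (hℓ : 0 < G.ℓ) {v : G.Fn} (h : G.Same u v) : G.mass p u = G.mass p v :=
  Finset.sum_congr rfl fun e _ => setIntegral_congr_fun (G.isEdgeDomain_dom hℓ e).measurableSet
    fun x hx => by rw [h e hx]

theorem mass_neg (u : G.Fn) : G.mass p (-u) = G.mass p u := by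
  simp [mass]

/-! ### Bound-states of bounded mass have constant sign -/

/-- A bound-state of small mass varies little on the compact edges. -/
theorem IsBoundState.abs_sub_le_one (hp : 2 < p) (hℓ : 0 < G.ℓ) (hu : G.IsBoundState p u)
    (hQ : 0 < Q) (hℓQ : G.ℓ * Q ≤ 1 / 2) (hm : G.mass p u ≤ Q) (e : Fin G.P ⊕ Fin G.L) {x : ℝ}
    (hx : x ∈ G.dom (Sum.inr e)) : |u (Sum.inr e) x - u (Sum.inr e) 0| ≤ 1 := by
  set e' : G.Edge := Sum.inr e
  have hI := G.isEdgeDomain_dom hℓ e'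
  have hx0 := hI.nonneg hx
  have hx2 : x ≤ 2 * G.ℓ := by
    rcases e with i | j
    · exact hx.2.trans (by linarith)
    · exact hx.2
  have hsq := hu.1.integrableOn_sq hℓ
  have h1 : ∫ t in G.dom e', (deriv (u e') t ^ 2 + u e' t ^ 2) ≤ Q := by
    refine le_trans ?_ ((hu.sum_sq_eq_mass hp hℓ).trans_le hm)
    exact Finset.single_le_sum
      (f := fun e => ∫ t in G.dom e, (deriv (u e) t ^ 2 + u e t ^ 2))
      (fun e _ => integral_nonneg fun t => by positivity) (Finset.mem_univ e')
  have hsub : Icc 0 x ⊆ G.dom e' := hI.Icc_subset hx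
  have hi : IntervalIntegrable (fun t => deriv (u e') t ^ 2 + u e' t ^ 2) volume 0 x :=
    (intervalIntegrable_iff_integrableOn_Icc_of_le hx0).2 ((hsq e').mono_set hsub)
  have h2 : ∫ t in (0 : ℝ)..x, (deriv (u e') t ^ 2 + u e' t ^ 2) ≤ Q := by
    rw [intervalIntegral.integral_of_le hx0]
    refine le_trans (setIntegral_mono_set (hsq e') (Filter.Eventually.of_forall fun t => ?_)
      (Ioc_subset_Icc_self.trans hsub).eventuallyLE) h1
    simp only [Pi.zero_apply]; positivity
  have hac := (hu.1.2 e').absolutelyContinuous hI hx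
  rw [← hac.integral_deriv_eq_sub]
  have hd := hac.intervalIntegrable_deriv
  calc |∫ t in (0 : ℝ)..x, deriv (u e') t| ≤ ∫ t in (0 : ℝ)..x, |deriv (u e') t| :=
        intervalIntegral.abs_integral_le_integral_abs hx0
    _ ≤ ∫ t in (0 : ℝ)..x, ((1 / (2 * Q)) * (deriv (u e') t ^ 2 + u e' t ^ 2) + Q / 2) := by
        refine intervalIntegral.integral_mono_on hx0 hd.abs
          ((hi.const_mul _).add intervalIntegrable_const) fun t _ => ?_
        have h3 : 0 ≤ 1 / (2 * Q) * u e' t ^ 2 := by positivity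
        -- Young's inequality with weight `Q` bounds the variation by `1 / 2 + ℓ Q`, so `ℓ Q ≤ 1 /
        -- 2` suffices.
        have h4 : 0 ≤ 1 / (2 * Q) * (|deriv (u e') t| - Q) ^ 2 := by positivity
        have h5 : 1 / (2 * Q) * (|deriv (u e') t| - Q) ^ 2 =
            1 / (2 * Q) * deriv (u e') t ^ 2 - |deriv (u e') t| + Q / 2 := by
          rw [← sq_abs (deriv (u e') t)]; field_simp; ring
        linarith
    _ = 1 / (2 * Q) * (∫ t in (0 : ℝ)..x, (deriv (u e') t ^ 2 + u e' t ^ 2)) + x * (Q / 2) := by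
        rw [intervalIntegral.integral_add (hi.const_mul _) intervalIntegrable_const,
          intervalIntegral.integral_const_mul, intervalIntegral.integral_const]
        simp
    _ ≤ 1 / (2 * Q) * Q + 2 * G.ℓ * (Q / 2) := by gcongr
    _ ≤ 1 := by
        have : 1 / (2 * Q) * Q = 1 / 2 := by field_simp
        linarith

/-- Half-lines carry pieces of the soliton. Each pendant and loop has a critical point, so
comparison with the zero solution keeps the sign of the knot value. -/
theorem IsClassical.positive (hp : 2 < p) (hG : G.IsShort p A) (h : G.IsClassical p u V) {c : ℝ}
    (hc : ∀ e, u e 0 = c) (hc0 : 0 < c)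
    (hA : ∀ e : Fin G.P ⊕ Fin G.L, ∀ x ∈ G.dom (Sum.inr e), |u (Sum.inr e) x| ≤ A) :
    G.Positive u := by
  rintro (k | i | j) x hx
  · obtain ⟨y, _, _, ⟨_, hu⟩ | ⟨_, hu⟩⟩ := h.halfLine hp hc hc0 k
    · exact (soliton_pos hp _).trans_eq (hu x hx).symm
    · exact (soliton_pos hp _).trans_eq (hu x hx).symm
  · exact (h.sol (G.pendant i)).pos_of_short hp (hG.sq hp) (hA (Sum.inl i)) (x₀ := G.ℓ)
      ⟨hG.pos.le, le_rfl⟩ (h.neumann i) (by rwa [hc]) hx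
  · obtain ⟨z, hz, hz0⟩ := h.exists_loop_critical hG.pos j
    exact (h.sol (G.loop j)).pos_of_short hp hG.lip (hA (Sum.inr j)) (x₀ := z)
      ⟨hz.1.le, hz.2.le⟩ hz0 (by rwa [hc]) hx

/-- A bound-state that is bounded by `A` on the compact edges does not change sign. -/
theorem IsBoundState.positive_or_neg (hp : 2 < p) (hG : G.IsShort p A) (hu : G.IsBoundState p u)
    (hA : ∀ e : Fin G.P ⊕ Fin G.L, ∀ x ∈ G.dom (Sum.inr e), |u (Sum.inr e) x| ≤ A) :
    G.Positive u ∨ G.Positive (-u) := by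
  obtain ⟨V, h⟩ := hu.exists_isClassical hp hG.pos
  obtain ⟨c, hc, -⟩ := h.memH1.1.exists_const
  rcases lt_trichotomy c 0 with h0 | rfl | h0
  · right
    exact h.neg.positive hp hG (c := -c) (fun e => by simp [hc]) (neg_pos.2 h0)
      fun e x hx => by simpa using hA e x hx
  · exfalso
    obtain ⟨e, x, hx, hne⟩ := hu.2.1
    refine hne ?_
    match e with
    | Sum.inl k => exact (h.sol (Sum.inl k)).eqOn_zero hp (h.memH1.2 (Sum.inl k)) (hc _) hx
    | Sum.inr (Sum.inl i) =>
      exact (h.sol (G.pendant i)).eq_zero_of_short hp (hG.sq hp) (hA (Sum.inl i)) (x₀ := G.ℓ)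
        ⟨hG.pos.le, le_rfl⟩ (h.neumann i) (hc _) hx
    | Sum.inr (Sum.inr j) =>
      obtain ⟨z, hz, hz0⟩ := h.exists_loop_critical hG.pos j
      exact (h.sol (G.loop j)).eq_zero_of_short hp hG.lip (hA (Sum.inr j)) (x₀ := z)
        ⟨hz.1.le, hz.2.le⟩ hz0 (hc _) hx
  · exact Or.inl (h.positive hp hG hc h0 hA)

/-- The half-lines alone limit the knot value: up to sign it is a value of the soliton. Together
with a variation of at most `1` this gives the bound `A` on the core. -/
theorem IsBoundState.abs_knot_le (hp : 2 < p) (hG : G.IsShort p A) (hu : G.IsBoundState p u)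
    (e : G.Edge) : |u e 0| ≤ soliton p 0 := by
  obtain ⟨V, h⟩ := hu.exists_isClassical hp hG.pos
  obtain ⟨c, hc, -⟩ := h.memH1.1.exists_const
  rw [hc]
  rcases lt_trichotomy c 0 with h0 | rfl | h0
  · obtain ⟨y, _, hy, _⟩ := h.neg.halfLine hp (c := -c) (fun e => by simp [hc]) (neg_pos.2 h0)
      ⟨0, hG.halfLine⟩
    rw [abs_of_neg h0, ← hy]
    exact soliton_le_zero hp y
  · rw [abs_zero]; exact (soliton_pos hp 0).le
  · obtain ⟨y, _, hy, _⟩ := h.halfLine hp hc h0 ⟨0, hG.halfLine⟩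
    rw [abs_of_pos h0, ← hy]
    exact soliton_le_zero hp y

theorem IsBoundState.positive_or_neg_of_mass_le (hp : 2 < p) (hG : G.IsShort p A)
    (hu : G.IsBoundState p u) (hQ : 0 < Q) (hℓQ : G.ℓ * Q ≤ 1 / 2) (hm : G.mass p u ≤ Q) :
    G.Positive u ∨ G.Positive (-u) := by
  refine hu.positive_or_neg hp hG fun e x hx => ?_
  have h1 := hu.abs_sub_le_one hp hG.pos hQ hℓQ hm e hx
  have h2 := hu.abs_knot_le hp hG (Sum.inr e)
  have h3 := abs_sub_abs_le_abs_sub (u (Sum.inr e) x) (u (Sum.inr e) 0)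
  linarith [hG.soliton_le]

/-! ### A competitor of mass bounded independently of the length -/

/-- A bound, independent of the length, for the mass of the positive bound-state that decreases
along all half-lines. -/
noncomputable def massBound (p A : ℝ) (H P L : ℕ) : ℝ :=
  H * (∫ x in Ici 0, |soliton p x| ^ p) + (P + L) * A ^ p + 1

theorem massBound_pos (hA : 0 ≤ A) (H P L : ℕ) : 0 < massBound p A H P L := by
  have : 0 ≤ ∫ x in Ici (0 : ℝ), |soliton p x| ^ p := integral_nonneg fun x => by positivity
  unfold massBound
  positivity

theorem integrableOn_soliton_rpow (hp : 2 < p) (y : ℝ) :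
    IntegrableOn (fun x => |soliton p (x + y)| ^ p) (Ici 0) :=
  integrableOn_abs_rpow hp measurableSet_Ici (memLp_soliton hp y)
    ((continuous_soliton hp).comp (continuous_id.add continuous_const)).continuousOn
    fun x _ => by rw [abs_of_pos (soliton_pos hp _)]; exact soliton_le_zero hp _

theorem mass_le_massBound (hp : 2 < p) (hG : G.IsShort p A) (hPL : 1 ≤ G.P + G.L) {θ : ℝ}
    (hθ : θ = ((G.H : ℝ) - ((0 : ℕ) : ℝ)) / ((G.P : ℝ) + 2 * (G.L : ℝ)))
    (hu : G.IsPositiveBoundStateWithIndex p θ u) :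
    G.mass p u ≤ massBound p A G.H G.P G.L := by
  obtain ⟨y, s, V₀, hs, h⟩ := hu.exists_isProfile hp hG hPL (add_zero G.H).symm hθ
  obtain ⟨V, hV⟩ := hu.1.exists_isClassical hp hG.pos
  have hA := hG.one_le hp
  have hp0 : 0 ≤ p := by linarith
  have hsu : ∀ k, k ∈ s := fun k => by
    have : s = Finset.univ := Finset.card_eq_iff_eq_univ s |>.1 (by simpa using hs)
    rw [this]; exact Finset.mem_univ k
  have h1 : ∀ k, ∫ x in G.dom (G.halfLine k), |u (G.halfLine k) x| ^ p ≤
      ∫ x in Ici 0, |soliton p x| ^ p := fun k => by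
    refine setIntegral_mono_on (hV.integrableOn_abs_rpow hp hG.pos _)
      (by simpa [dom] using integrableOn_soliton_rpow hp 0) measurableSet_Ici fun x hx => ?_
    have hx : 0 ≤ x := hx
    rw [h.split.mem k (hsu k) x hx, abs_of_pos (soliton_pos hp _), abs_of_pos (soliton_pos hp _)]
    refine Real.rpow_le_rpow (soliton_pos hp _).le ?_ hp0
    have hy := h.split.pos.le
    exact (soliton_strictAntiOn hp).antitoneOn hx (add_nonneg hx hy) (by linarith)
  -- The Lipschitz constant is at least `1`, so the smallness condition already bounds the length of
  -- every loop.
  have hℓ1 : 2 * G.ℓ ≤ 1 := by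
    have := one_le_lipConst hp (zero_le_one.trans hA)
    nlinarith [hG.lip, hG.pos]
  have h2 : ∀ e : Fin G.P ⊕ Fin G.L, ∫ x in G.dom (Sum.inr e), |u (Sum.inr e) x| ^ p ≤ A ^ p :=
    fun e => by
    have hdom : ∃ a, 0 ≤ a ∧ a ≤ 1 ∧ G.dom (Sum.inr e) = Icc 0 a := by
      rcases e with i | j
      · exact ⟨G.ℓ, hG.pos.le, by linarith [hG.pos], rfl⟩
      · exact ⟨2 * G.ℓ, by linarith [hG.pos], hℓ1, rfl⟩
    obtain ⟨a, ha0, ha1, ha⟩ := hdom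
    have hb := hG.bound u V hV hu.2.1 e
    have hi := hV.integrableOn_abs_rpow hp hG.pos (Sum.inr e)
    rw [ha] at hb hi ⊢
    calc _ ≤ ∫ _x in Icc 0 a, A ^ p := setIntegral_mono_on hi
          (by simp) measurableSet_Icc fun x hx =>
            Real.rpow_le_rpow (abs_nonneg _) (hb x hx) hp0
      _ = a * A ^ p := by simp [ha0]
      _ ≤ 1 * A ^ p := by gcongr
      _ = A ^ p := one_mul _
  rw [mass, massBound, Fintype.sum_sum_type]
  have h3 := Finset.sum_le_sum fun k (_ : k ∈ Finset.univ) => h1 k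
  have h4 := Finset.sum_le_sum fun e (_ : e ∈ Finset.univ) => h2 e
  simp only [Finset.sum_const, Finset.card_univ, nsmul_eq_mul, Fintype.card_fin,
    Fintype.card_sum, Nat.cast_add] at h3 h4
  exact (add_le_add h3 h4).trans (by linarith)

end Action

/-! ### Action ground-states -/

section GroundState

variable {G : RegularKnotGraph} {p A θ : ℝ} {u v w : G.Fn}

theorem HasIncidenceIndex.exists_card (h : G.HasIncidenceIndex p u θ) :
    ∃ Hp Hm : ℕ, G.H = Hp + Hm ∧ θ = ((Hp : ℝ) - (Hm : ℝ)) / ((G.P : ℝ) + 2 * (G.L : ℝ)) := by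
  obtain ⟨Hp, Hm, ⟨y, _, s, hs, hs', _⟩, hθ⟩ := h
  refine ⟨Hp, Hm, ?_, hθ⟩
  rw [← hs, ← hs', Finset.card_add_card_compl, Fintype.card_fin]

theorem IsPositiveBoundStateWithIndex.core_of_lt (hp : 2 < p) (hG : G.IsShort p A)
    (hPL : 1 ≤ G.P + G.L) {Hp Hm : ℕ} (hH : G.H = Hp + Hm)
    (hθ : θ = ((Hp : ℝ) - (Hm : ℝ)) / ((G.P : ℝ) + 2 * (G.L : ℝ))) (hlt : Hm < Hp)
    (hu : G.IsPositiveBoundStateWithIndex p θ u) : G.CoreSymmetric u ∧ G.CoreIncreasing u := by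
  obtain ⟨y, s, V, _, h⟩ := hu.exists_isProfile hp hG hPL hH hθ
  refine ⟨h.coreSymmetric hp hG, h.coreIncreasing hp hG hPL ?_⟩
  rw [hθ]
  exact div_pos (sub_pos.2 (by exact_mod_cast hlt)) (core_card_pos hPL)

theorem IsPositiveBoundStateWithIndex.core_of_eq (hp : 2 < p) (hG : G.IsShort p A)
    (hPL : 1 ≤ G.P + G.L) {Hp Hm : ℕ} (hH : G.H = Hp + Hm)
    (hθ : θ = ((Hp : ℝ) - (Hm : ℝ)) / ((G.P : ℝ) + 2 * (G.L : ℝ))) (heq : Hp = Hm)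
    (hu : G.IsPositiveBoundStateWithIndex p θ u) : G.CoreSymmetric u ∧ G.OneOnCore u := by
  obtain ⟨y, s, V, _, h⟩ := hu.exists_isProfile hp hG hPL hH hθ
  refine ⟨h.coreSymmetric hp hG, ?_⟩
  rw [heq, sub_self, zero_div] at hθ
  subst hθ
  exact h.oneOnCore hp hG hPL

theorem IsPositiveBoundStateWithIndex.not_lt (hp : 2 < p) (hG : G.IsShort p A)
    (hPL : 1 ≤ G.P + G.L) {Hp Hm : ℕ} (hH : G.H = Hp + Hm)
    (hθ : θ = ((Hp : ℝ) - (Hm : ℝ)) / ((G.P : ℝ) + 2 * (G.L : ℝ)))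
    (hu : G.IsPositiveBoundStateWithIndex p θ u) : ¬ Hp < Hm := by
  intro hlt
  obtain ⟨y, s, V, _, h⟩ := hu.exists_isProfile hp hG hPL hH hθ
  refine h.index_not_neg hp hG hPL ?_
  rw [hθ, div_mul_cancel₀ _ (core_card_pos hPL).ne']
  have : (Hp : ℝ) + 1 ≤ Hm := by exact_mod_cast hlt
  linarith

theorem IsBoundState.core_of_positive (hp : 2 < p) (hG : G.IsShort p A) (hPL : 1 ≤ G.P + G.L)
    (hu : G.IsBoundState p u) (hpos : G.Positive u) :
    G.CoreSymmetric u ∧ (G.CoreIncreasing u ∨ G.OneOnCore u) := by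
  obtain ⟨θ, hθ⟩ := exists_hasIncidenceIndex hp hG hPL hu hpos
  have hu' : G.IsPositiveBoundStateWithIndex p θ u := ⟨hu, hpos, hθ⟩
  obtain ⟨Hp, Hm, hH, hθ'⟩ := hθ.exists_card
  rcases lt_trichotomy Hm Hp with hlt | heq | hlt
  · exact (hu'.core_of_lt hp hG hPL hH hθ' hlt).imp_right Or.inl
  · exact (hu'.core_of_eq hp hG hPL hH hθ' heq.symm).imp_right Or.inr
  · exact absurd hlt (hu'.not_lt hp hG hPL hH hθ')

/-- With compact edges, comparison with the bound-state for `H⁺ = H` bounds the mass. Without them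
the required bound on the core is vacuous. -/
theorem IsActionGroundState.positive_or_neg (hp : 2 < p) (hG : G.IsShort p A)
    (hQ : G.ℓ * massBound p A G.H G.P G.L ≤ 1 / 2) (hu : G.IsActionGroundState p u) :
    G.Positive u ∨ G.Positive (-u) := by
  rcases Nat.eq_zero_or_pos (G.P + G.L) with h0 | hPL
  · refine hu.1.positive_or_neg hp hG fun e => ?_
    rcases e with i | j
    · exact absurd i.2 (by omega)
    · exact absurd j.2 (by omega)
  · obtain ⟨w, hw⟩ := exists_isPositiveBoundStateWithIndex hp hG hPL (add_zero G.H).symm rfl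
      (Nat.zero_le _)
    refine hu.1.positive_or_neg_of_mass_le hp hG
      (massBound_pos (zero_le_one.trans (hG.one_le hp)) _ _ _) hQ ?_
    exact ((hu.1.action_le_iff hp hG.pos hw.1).1 (hu.2 w hw.1)).trans
      (mass_le_massBound hp hG hPL rfl hw)

theorem IsActionGroundState.structure (hp : 2 < p) (hG : G.IsShort p A)
    (hQ : G.ℓ * massBound p A G.H G.P G.L ≤ 1 / 2) (hu : G.IsActionGroundState p u) :
    ∃ s : ℝ, (s = 1 ∨ s = -1) ∧ G.Positive (s • u) ∧
      G.CoreSymmetric (s • u) ∧ (G.CoreIncreasing (s • u) ∨ G.OneOnCore (s • u)) := by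
  have key : ∀ w : G.Fn, G.IsBoundState p w → G.Positive w →
      G.CoreSymmetric w ∧ (G.CoreIncreasing w ∨ G.OneOnCore w) := fun w hw hpos => by
    rcases Nat.eq_zero_or_pos (G.P + G.L) with h0 | hPL
    · have : IsEmpty G.CoreEdge := by
        rw [← Fintype.card_eq_zero_iff]
        simp only [CoreEdge, Fintype.card_sum, Fintype.card_prod, Fintype.card_fin,
          Fintype.card_bool]
        omega
      exact ⟨fun κ => isEmptyElim κ, Or.inl fun κ => isEmptyElim κ⟩
    · exact hw.core_of_positive hp hG hPL hpos
  rcases hu.positive_or_neg hp hG hQ with hpos | hpos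
  · refine ⟨1, Or.inl rfl, ?_⟩
    rw [one_smul]
    exact ⟨hpos, key u hu.1 hpos⟩
  · refine ⟨-1, Or.inr rfl, ?_⟩
    rw [neg_one_smul]
    exact ⟨hpos, key _ (hu.1.neg hp hG.pos) hpos⟩

/-- With a single half-line, all bound-states of small mass agree up to the sign. -/
theorem exists_unique_of_single_halfLine (hp : 2 < p) (hG : G.IsShort p A)
    (hQ : G.ℓ * massBound p A G.H G.P G.L ≤ 1 / 2) (hH : G.H = 1) :
    ∃ w, G.IsBoundState p w ∧
      ∀ v, G.IsBoundState p v → G.mass p v ≤ G.mass p w → G.Same v w ∨ G.Same v (-w) := by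
  have hsub : Subsingleton (Fin G.H) := by rw [hH]; infer_instance
  have key : ∀ w : G.Fn, (∀ v, G.IsBoundState p v → G.Positive v → G.Same v w) →
      ∀ v, G.IsBoundState p v → (G.Positive v ∨ G.Positive (-v)) →
        G.Same v w ∨ G.Same v (-w) := by
    rintro w hw v hv (hpos | hpos)
    · exact Or.inl (hw v hv hpos)
    · refine Or.inr fun e x hx => ?_
      have := hw _ (hv.neg hp hG.pos) hpos e hx
      simp only [Pi.neg_apply] at this ⊢
      linarith
  rcases Nat.eq_zero_or_pos (G.P + G.L) with h0 | hPL
  · obtain ⟨U, W, h⟩ := exists_isLoopProfile hp hG (soliton_pos hp 0).le le_rfl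
    have hP : G.P = 0 := by omega
    have hL : G.L = 0 := by omega
    have hne : ∀ e : Fin G.P ⊕ Fin G.L, False := fun e => by
      rcases e with i | j
      · exact absurd i.2 (by omega)
      · exact absurd j.2 (by omega)
    refine ⟨G.glue (soliton p) 0 ∅ U,
      glue_isBoundState hp hG h (by simp [solitonSlope_zero, hP, hL]), fun v hv _ => ?_⟩
    refine key _ (fun v hv hpos => ?_) v hv
      (hv.positive_or_neg hp hG fun e => (hne e).elim)
    obtain ⟨V, hV⟩ := hv.exists_isClassical hp hG.pos
    obtain ⟨c, hc, -⟩ := hV.memH1.1.exists_const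
    have hc0 : 0 < c := by
      rw [← hc (G.halfLine ⟨0, hG.halfLine⟩)]; exact hpos _ 0 self_mem_Ici
    rintro (k | e) x hx
    · obtain ⟨y, hy0, _, hy⟩ := hV.halfLine hp hc hc0 k
      have hK := hV.kirchhoff
      have h1 : ∑ i, V (G.pendant i) 0 = 0 :=
        Finset.sum_eq_zero fun i _ => (hne (Sum.inl i)).elim
      have h2 : ∑ j, (V (G.loop j) 0 - V (G.loop j) (2 * G.ℓ)) = 0 :=
        Finset.sum_eq_zero fun j _ => (hne (Sum.inr j)).elim
      rw [outflow, h1, h2, Fintype.sum_subsingleton _ k, add_zero, add_zero] at hK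
      have hy1 : solitonSlope p y = 0 := by
        rcases hy with hy | hy <;> linarith [hy.1]
      have hy2 : y = 0 := by
        by_contra hne
        exact (solitonSlope_neg_of_pos hp (lt_of_le_of_ne hy0 (Ne.symm hne))).ne hy1
      subst hy2
      rcases hy with ⟨_, hy⟩ | ⟨_, hy⟩ <;> simpa [glue] using hy x hx
    · exact (hne e).elim
  · obtain ⟨w, hw⟩ := exists_isPositiveBoundStateWithIndex hp hG hPL (add_zero G.H).symm rfl
      (Nat.zero_le _)
    refine ⟨w, hw.1, fun v hv hm => ?_⟩
    refine key w (fun v hv hpos => ?_) v hv (hv.positive_or_neg_of_mass_le hp hG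
      (massBound_pos (zero_le_one.trans (hG.one_le hp)) _ _ _) hQ
      (hm.trans (mass_le_massBound hp hG hPL rfl hw)))
    obtain ⟨θ, hθ⟩ := exists_hasIncidenceIndex hp hG hPL hv hpos
    have hv' : G.IsPositiveBoundStateWithIndex p θ v := ⟨hv, hpos, hθ⟩
    obtain ⟨Hp, Hm, hH', hθ'⟩ := hθ.exists_card
    have hle := not_lt.1 (hv'.not_lt hp hG hPL hH' hθ')
    -- With a single half-line, excluding negative indices leaves one possible index, that of `w`.
    obtain ⟨rfl, rfl⟩ : Hp = G.H ∧ Hm = 0 := by omega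
    subst hθ'
    obtain ⟨σ, hσ⟩ := hw.exists_perm hp hG hPL hH' rfl hle hv'
    rintro (k | e) x hx
    · refine (hσ _ hx).trans ?_
      simp only [permHalfLines, Subsingleton.elim (σ k) k]
    · exact hσ _ hx

theorem groundState_of_single_halfLine (hp : 2 < p) (hG : G.IsShort p A)
    (hQ : G.ℓ * massBound p A G.H G.P G.L ≤ 1 / 2) (hH : G.H = 1) :
    (∃ u, G.IsActionGroundState p u) ∧
      ∀ u v, G.IsActionGroundState p u → G.IsActionGroundState p v →
        G.Same v u ∨ G.Same v (-u) := by
  obtain ⟨w, hw, hmin⟩ := exists_unique_of_single_halfLine hp hG hQ hH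
  have hsame : ∀ u, G.IsActionGroundState p u → G.Same u w ∨ G.Same u (-w) := fun u hu =>
    hmin u hu.1 ((hu.1.action_le_iff hp hG.pos hw).1 (hu.2 w hw))
  -- `w` is minimal because a bound-state of smaller mass would equal `w` or `-w`, which have the
  -- same mass.
  refine ⟨⟨w, hw, fun v hv => ?_⟩, fun u v hu hv => ?_⟩
  · rw [hw.action_le_iff hp hG.pos hv]
    by_contra! hlt
    rcases hmin v hv hlt.le with h | h
    · exact hlt.ne (mass_congr hG.pos h)
    · exact hlt.ne ((mass_congr hG.pos h).trans (mass_neg w))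
  · rcases hsame u hu with h | h <;> rcases hsame v hv with h' | h'
    · exact Or.inl fun e x hx => (h' e hx).trans (h e hx).symm
    · refine Or.inr fun e x hx => ?_
      have h1 := h e hx
      have h2 := h' e hx
      simp only [Pi.neg_apply] at h2 ⊢
      linarith
    · refine Or.inr fun e x hx => ?_
      have h1 := h e hx
      have h2 := h' e hx
      simp only [Pi.neg_apply] at h1 ⊢
      linarith
    · exact Or.inl fun e x hx => (h' e hx).trans (h e hx).symm

end GroundState

/-- Graphs with sufficiently short compact edges satisfy all smallness conditions. -/
theorem exists_isShort {p : ℝ} (hp : 2 < p) (H P L : ℕ) (hH : 1 ≤ H) :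
    ∃ A ℓ₀ : ℝ, 0 < ℓ₀ ∧ ∀ ℓ : ℝ, 0 < ℓ → ℓ < ℓ₀ →
      IsShort ⟨H, P, L, ℓ⟩ p A ∧ ℓ * massBound p A H P L ≤ 1 / 2 := by
  obtain ⟨A₀, hA₀⟩ := exists_bound_of_positive hp H P L hH
  set A := max A₀ (soliton p 0 + 1)
  -- `A` is fixed before `ℓ`, so each smallness condition is a strict inequality at `ℓ = 0` between
  -- continuous functions of `ℓ`.
  have key : ∀ f : ℝ → ℝ, Continuous f → ∀ b, f 0 < b → ∀ᶠ ℓ in nhds (0 : ℝ), f ℓ < b :=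
    fun f hf b hb => (hf.tendsto 0).eventually_lt_const hb
  have h2p : 2 / p < 1 := by rw [div_lt_one (by linarith)]; exact hp
  have h1 := key (fun ℓ => (2 * ℓ) ^ 2 * lipConst p A) (by fun_prop) (1 / 3) (by norm_num)
  have h2 := key (fun ℓ => (2 * ℓ) ^ 2 * (lipConst p A * A)) (by fun_prop) 1 (by norm_num)
  have h3 := key (fun ℓ => (((P : ℝ) + 2 * L) * (ℓ * lipConst p A * (3 / 2))) ^ 2) (by fun_prop)
    (1 - 2 / p) (by simpa using h2p)
  have h4 := key (fun ℓ => ℓ * massBound p A H P L) (by fun_prop) (1 / 2) (by norm_num)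
  obtain ⟨ε, hε, h⟩ := Metric.eventually_nhds_iff.1 (h1.and (h2.and (h3.and h4)))
  refine ⟨A, ε, hε, fun ℓ hℓ hlt => ?_⟩
  obtain ⟨e1, e2, e3, e4⟩ := h (y := ℓ)
    (by rw [dist_zero_right, Real.norm_of_nonneg hℓ.le]; exact hlt)
  exact ⟨⟨hℓ, hH, le_max_right _ _, e1.le, e2.le, e3, fun u V hu hpos e x hx =>
    (hA₀ ⟨H, P, L, ℓ⟩ rfl rfl rfl hℓ u V hu hpos e x hx).trans (le_max_left _ _)⟩, e4.le⟩

end RegularKnotGraph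

/-! ### Assembly of the theorem -/

theorem mainTheorem4 (p : ℝ) (hp : 2 < p) (H P L : ℕ) (hH : 1 ≤ H) :
    ∃ ℓ₀ : ℝ, 0 < ℓ₀ ∧ ∀ ℓ : ℝ, 0 < ℓ → ℓ < ℓ₀ → ∀ G : RegularKnotGraph, G = ⟨H, P, L, ℓ⟩ →
      (1 ≤ P + L →
        (∀ u, G.IsBoundState p u → G.Positive u → ∃ θ : ℝ, G.HasIncidenceIndex p u θ) ∧
        ∀ Hp Hm : ℕ, H = Hp + Hm →
          ∀ θ : ℝ, θ = ((Hp : ℝ) - (Hm : ℝ)) / ((P : ℝ) + 2 * (L : ℝ)) →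
            (Hm < Hp → G.UniquePositiveBoundState p θ ∧
              ∀ u, G.IsPositiveBoundStateWithIndex p θ u →
                G.CoreSymmetric u ∧ G.CoreIncreasing u) ∧
            (Hp = Hm → G.UniquePositiveBoundState p θ ∧
              ∀ u, G.IsPositiveBoundStateWithIndex p θ u → G.OneOnCore u) ∧
            (Hp < Hm → ¬ ∃ u, G.IsPositiveBoundStateWithIndex p θ u)) ∧
      (∀ u, G.IsActionGroundState p u → ∃ s : ℝ, (s = 1 ∨ s = -1) ∧ G.Positive (s • u) ∧
        G.CoreSymmetric (s • u) ∧ (G.CoreIncreasing (s • u) ∨ G.OneOnCore (s • u))) ∧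
      (H = 1 → (∃ u, G.IsActionGroundState p u) ∧
        ∀ u v, G.IsActionGroundState p u → G.IsActionGroundState p v →
          G.Same v u ∨ G.Same v (-u)) := by
  obtain ⟨A, ℓ₀, hℓ₀, hshort⟩ := RegularKnotGraph.exists_isShort hp H P L hH
  refine ⟨ℓ₀, hℓ₀, ?_⟩
  rintro ℓ hℓ hlt G rfl
  obtain ⟨hG, hQ⟩ := hshort ℓ hℓ hlt
  refine ⟨fun hPL => ⟨fun u hu hpos =>
    RegularKnotGraph.exists_hasIncidenceIndex hp hG hPL hu hpos, fun Hp Hm hH' θ hθ => ?_⟩,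
    fun u hu => hu.structure hp hG hQ,
    fun hH1 => RegularKnotGraph.groundState_of_single_halfLine hp hG hQ hH1⟩
  -- Existence and uniqueness are the same argument for positive and zero index.
  have huniq : Hm ≤ Hp →
      RegularKnotGraph.UniquePositiveBoundState ⟨H, P, L, ℓ⟩ p θ := fun hle =>
    ⟨RegularKnotGraph.exists_isPositiveBoundStateWithIndex hp hG hPL hH' hθ hle,
      fun u v hu hv => hu.exists_perm hp hG hPL hH' hθ hle hv⟩
  exact ⟨fun h => ⟨huniq h.le, fun u hu => hu.core_of_lt hp hG hPL hH' hθ h⟩,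
    fun h => ⟨huniq h.ge, fun u hu => (hu.core_of_eq hp hG hPL hH' hθ h).2⟩,
    fun h ⟨u, hu⟩ => hu.not_lt hp hG hPL hH' hθ h⟩
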